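/- Let $d\ge 1$, $\mathbb{R}^d_+=(0,\infty)^d$ and $\alpha=(\alpha_1,\dots,\alpha_d)\in[-1/2,\infty)^d$, and write $|\alpha|=\alpha_1+\dots+\alpha_d$ and $|n|=n_1+\dots+n_d$ for $n\in\mathbb{N}^d$, $\mathbb{N}=\{0,1,2,\dots\}$. Let $\mu_\alpha$ be the measure on $\mathbb{R}^d_+$ given by $d\mu_\alpha(x)=\prod_{i=1}^d x_i^{2\alpha_i+1}\,dx$, and let $$\ell^\alpha_n(x)=\prod_{i=1}^d\Big(\frac{2\,\Gamma(n_i+1)}{\Gamma(n_i+\alpha_i+1)}\Big)^{1/2}L_{n_i}^{\alpha_i}(x_i^2)\,e^{-x_i^2/2},\qquad n\in\mathbb{N}^d,$$ be the Laguerre functions of convolution type, where $L_k^a(t)=\sum_{j=0}^k\frac{(-1)^j}{j!}\binom{k+a}{k-j}t^j$ are the Laguerre polynomials. Functions are real- or complex-valued (the statement holds over either scalar field). An atom is a measurable function $a$ on $\mathbb{R}^d_+$ supported in a ball $B=\{y\in\mathbb{R}^d_+:|y-x_0|<\rho\}$, $x_0\in\mathbb{R}^d_+$, $\rho>0$, such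 that $\int_B a\,d\mu_\alpha=0$ and $\|a\|_{L^2(\mu_\alpha)}\le\mu_\alpha(B)^{-1/2}$. The Hardy space $H^1(\mathbb{R}^d_+,\mu_\alpha)$ consists of all $f\in L^1(\mu_\alpha)$ of the form $f=\sum_{j=0}^\infty\lambda_ja_j$ with atoms $a_j$, scalars $\lambda_j$ with $\sum_j|\lambda_j|<\infty$, and convergence in $L^1(\mu_\alpha)$; $\|f\|_{H^1(\mathbb{R}^d_+,\mu_\alpha)}$ is the infimum of $\sum_j|\lambda_j|$ over all such representations. Then for every $f\in H^1(\mathbb{R}^d_+,\mu_\alpha)$ the coefficients $\langle f,\ell^\alpha_n\rangle=\int f\,\ell^\alpha_n\,d\mu_\alpha$ are absolutely convergent integrals, and there is a constant $C$, depending only on $d$ and $\alpha$, such that $$\sum_{n\in\mathbb{N}^d}\frac{|\langle f,\ell^\alpha_n\rangle|}{(|n|+1)^{d+|\alpha|/2}}\le C\,\|f\|_{H^1(\mathbb{R}^d_+,\mu_\alpha)}\qquad\text{for all } f\in H^1(\mathbb{R}^d_+,\mu_\alpha).$$ The exponent is sharp: for every $\varepsilon>0$ there is an $f\in H^1(\mathbb{R}^d_+,\mu_\alpha)$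 such that $$\sum_{n\in\mathbb{N}^d}\frac{|\langle f,\ell^\alpha_n\rangle|}{(|n|+1)^{d+|\alpha|/2-\varepsilon}}=\infty.$$ -/

import Mathlib

open MeasureTheory Filter Topology
open scoped ENNReal

noncomputable section

namespace LaguerreHardy

/-- The open orthant `(0,∞)^d` in Euclidean space. -/
def orthant (d : ℕ) : Set (EuclideanSpace ℝ (Fin d)) :=
  {x | ∀ i, 0 < x i}

/-- The measure `dμ_α(x) = x^{2α+1} dx` on `(0,∞)^d`, seen as a measure on `ℝ^d` concentrated on
the orthant. -/
def laguerreMeasure {d : ℕ} (α : Fin d → ℝ) : Measure (EuclideanSpace ℝ (Fin d)) :=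
  (volume.restrict (orthant d)).withDensity
    fun x => ENNReal.ofReal (∏ i, x i ^ (2 * α i + 1))

/-- The Laguerre polynomial `L_k^a(t) = ∑_{j ≤ k} (-1)^j binom(k+a, k-j) t^j / j!` (for `a > -1`),
the generalized binomial coefficient being `Γ(k+a+1) / (Γ(a+j+1) (k-j)!)`. -/
def laguerrePoly (a : ℝ) (k : ℕ) (t : ℝ) : ℝ :=
  ∑ j ∈ Finset.range (k + 1),
    (-1) ^ j * (Real.Gamma (k + a + 1) / (Real.Gamma (a + j + 1) * (Nat.factorial (k - j) : ℝ)))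
      * t ^ j / (Nat.factorial j : ℝ)

/-- The one-dimensional Laguerre function of convolution type of order `a`. -/
def laguerreFun1 (a : ℝ) (k : ℕ) (u : ℝ) : ℝ :=
  Real.sqrt (2 * Real.Gamma (k + 1) / Real.Gamma (k + a + 1)) * laguerrePoly a k (u ^ 2)
    * Real.exp (-u ^ 2 / 2)

/-- The `d`-dimensional Laguerre function of convolution type: the tensor product of the
one-dimensional ones. -/
def laguerreFun {d : ℕ} (α : Fin d → ℝ) (n : Fin d → ℕ) (x : EuclideanSpace ℝ (Fin d)) : ℝ :=
  ∏ i, laguerreFun1 (α i) (n i) (x i)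

/-- The Fourier–Laguerre coefficient `⟨f, ℓ_n^α⟩ = ∫ f ℓ_n^α dμ_α` (`ℓ_n^α` is real-valued). -/
def laguerreCoeff {𝕜 : Type*} [RCLike 𝕜] {d : ℕ} (α : Fin d → ℝ)
    (f : EuclideanSpace ℝ (Fin d) → 𝕜) (n : Fin d → ℕ) : 𝕜 :=
  ∫ x, f x * (laguerreFun α n x : 𝕜) ∂(laguerreMeasure α)

/-- `(1,2)`-atoms on `((0,∞)^d, μ_α)`. Both the diameter of the orthant (`d ≥ 1`) and its measure
are infinite, so that every radius `ρ > 0` is allowed and there is no additional constant atom.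
As `μ_α` is concentrated on the orthant, the part of a ball outside of it plays no role. -/
structure IsAtom {𝕜 : Type*} [RCLike 𝕜] {d : ℕ} (α : Fin d → ℝ)
    (a : EuclideanSpace ℝ (Fin d) → 𝕜) : Prop where
  aestronglyMeasurable : AEStronglyMeasurable a (laguerreMeasure α)
  exists_ball : ∃ x₀ ∈ orthant d, ∃ ρ : ℝ, 0 < ρ ∧
    (∀ x ∈ orthant d, x ∉ Metric.ball x₀ ρ → a x = 0) ∧
    ∫ x in Metric.ball x₀ ρ, a x ∂(laguerreMeasure α) = 0 ∧
    eLpNorm a 2 (laguerreMeasure α) ≤ (laguerreMeasure α (Metric.ball x₀ ρ)) ^ (-(1 / 2) : ℝ)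

/-- `f = ∑ c_j a_j` is an atomic decomposition: `∑ |c_j| < ∞`, the `a_j` are atoms, and the series
converges to `f` in `L^1(μ_α)`. -/
structure IsAtomicDecomposition {𝕜 : Type*} [RCLike 𝕜] {d : ℕ} (α : Fin d → ℝ)
    (f : EuclideanSpace ℝ (Fin d) → 𝕜) (c : ℕ → 𝕜)
    (a : ℕ → EuclideanSpace ℝ (Fin d) → 𝕜) : Prop where
  isAtom : ∀ j, IsAtom α (a j)
  summable : Summable fun j => ‖c j‖
  tendsto : Tendsto
    (fun m : ℕ => eLpNorm (fun x => f x - ∑ j ∈ Finset.range m, c j * a j x) 1 (laguerreMeasure α))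
    atTop (𝓝 0)

/-- Membership in the atomic Hardy space `H^1((0,∞)^d, μ_α)`. -/
def MemH1 {𝕜 : Type*} [RCLike 𝕜] {d : ℕ} (α : Fin d → ℝ)
    (f : EuclideanSpace ℝ (Fin d) → 𝕜) : Prop :=
  Integrable f (laguerreMeasure α) ∧ ∃ c a, IsAtomicDecomposition α f c a

/-- The norm of `H^1((0,∞)^d, μ_α)`: the infimum of `∑ |c_j|` over all atomic decompositions
(meaningful for `f` in the space). -/
def normH1 {𝕜 : Type*} [RCLike 𝕜] {d : ℕ} (α : Fin d → ℝ)
    (f : EuclideanSpace ℝ (Fin d) → 𝕜) : ℝ :=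
  sInf {s : ℝ | ∃ c a, IsAtomicDecomposition α f c a ∧ s = ∑' j, ‖c j‖}

end LaguerreHardy

end

/-! Write `Q = d + |α|` and `E = d + |α|/2 = d/2 + Q/2`. By linearity and density the inequality
reduces to atoms, and for an atom on a ball of radius `ρ` the `ℓ¹` norm of its coefficients over the
cube `{0,…,N-1}^d` is estimated in two ways. Size: Bessel, Cauchy–Schwarz over `N^d` indices and
`μ_α(B) ≥ c ρ^{2Q}` give `N^{d/2} ρ^{-Q} = N^E (Nρ²)^{-Q/2}` up to a constant. Cancellation: the
mean zero allows `ℓ_n` to be replaced by `ℓ_n - ℓ_n(x₀)`, and a bound for `∑_n (ℓ_n(x) - ℓ_n(x₀))²`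
gives `N^E (Nρ²)^{1/8}`. Both are `N^E` times a power of the scale-invariant quantity `Nρ²`, with
exponents of opposite sign, so summing over dyadic shells of indices costs a two-sided geometric
series, bounded uniformly in `ρ` (`exists_atom_cube_bound`, `exists_atom_bound`).

The analytic core is the pair of kernel bounds `exists_kernel_bounds` in one variable. For order
`-1/2` the Laguerre functions are even Hermite functions up to sign and normalization. Their
derivatives are combinations of the functions `u ℓ_k^{1/2}`, orthonormal for `du`, with coefficients
of size `√k`. This is a Bernstein inequality `‖f'‖² ≤ 4N‖f‖²`, and duality turns it into bounds for
`∑_{k<N} ℓ_k(u)²` and `∑_{k<N} (ℓ_k(u) - ℓ_k(v))²`, with no asymptotics of Laguerre functions. Order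
`a ≥ -1/2` follows because `ℓ_k^a` is an average of dilated `ℓ_k^{-1/2}` against a Beta law
(`laguerreFun1_eq_integral`). Tensor products are handled by expanding the square into products of
one-variable kernels (`sum_cube_sq_sub_le`).

Sharpness is by contradiction. If the sum with exponent `E - ε` were finite on all of `H¹`,
Banach–Steinhaus on `ℓ¹` would bound it uniformly on any sequence of atoms. Fixed multiples of the
differences of normalized indicators of balls shrinking dyadically to the origin are atoms, so by
telescoping the sum for the `m`-th indicator would grow at most linearly in `m` on the box of
indices of size `4^m`. There, however, `ℓ_n` is at least `c 4^{m|α|/2}` on the `m`-th ball, which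
forces growth like `4^{εm}`. -/

namespace LaguerreHardy

/-! ### Laguerre polynomials: Gamma integrals and orthonormality. -/

/-- The coefficient of `t ^ j` in the Laguerre polynomial `L_k^a`. -/
noncomputable def polyCoeff (a : ℝ) (k j : ℕ) : ℝ :=
  (-1) ^ j * (Real.Gamma (k + a + 1) / (Real.Gamma (a + j + 1) * (Nat.factorial (k - j) : ℝ)))
    / (Nat.factorial j : ℝ)

lemma laguerrePoly_eq_sum (a : ℝ) (k : ℕ) (t : ℝ) :
    laguerrePoly a k t = ∑ j ∈ Finset.range (k + 1), polyCoeff a k j * t ^ j := by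
  unfold laguerrePoly polyCoeff
  refine Finset.sum_congr rfl fun j _ => ?_
  ring

lemma Gamma_add_nat {x : ℝ} (hx : 0 < x) (j : ℕ) :
    Real.Gamma (x + j) = (ascPochhammer ℝ j).eval x * Real.Gamma x := by
  induction j with
  | zero => simp
  | succ j ih =>
    rw [ascPochhammer_succ_eval, Nat.cast_succ, ← add_assoc, Real.Gamma_add_one (by positivity), ih]
    ring

lemma integrableOn_pow_mul_gaussian {a : ℝ} (ha : -1 < a) (m : ℕ) :
    IntegrableOn (fun u : ℝ => u ^ (2 * m) * (Real.exp (-u ^ 2) * u ^ (2 * a + 1))) (Set.Ioi 0) := by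
  have h := integrableOn_rpow_mul_exp_neg_mul_sq (b := 1) one_pos (s := 2 * m + (2 * a + 1))
    (by have : (0 : ℝ) ≤ m := m.cast_nonneg
        linarith)
  refine h.congr_fun (fun u hu => ?_) measurableSet_Ioi
  have hu : 0 < u := hu
  have e : u ^ (2 * (m : ℝ)) = u ^ (2 * m) := by
    rw [← Real.rpow_natCast]; push_cast; rfl
  simp only [Real.rpow_add hu, e]
  ring_nf

lemma integral_pow_mul_gaussian {a : ℝ} (ha : -1 < a) (m : ℕ) :
    ∫ u in Set.Ioi (0 : ℝ), u ^ (2 * m) * (Real.exp (-u ^ 2) * u ^ (2 * a + 1))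
      = Real.Gamma (m + a + 1) / 2 := by
  have h := integral_rpow_mul_exp_neg_rpow (p := 2) (q := 2 * m + (2 * a + 1)) (by norm_num)
    (by have : (0 : ℝ) ≤ m := m.cast_nonneg
        linarith)
  rw [show (2 * (m : ℝ) + (2 * a + 1) + 1) / 2 = m + a + 1 by ring] at h
  rw [show Real.Gamma (m + a + 1) / 2 = 1 / 2 * Real.Gamma (m + a + 1) by ring, ← h]
  refine setIntegral_congr_fun measurableSet_Ioi fun u hu => ?_
  have hu : 0 < u := hu
  have e : u ^ (2 * (m : ℝ)) = u ^ (2 * m) := by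
    rw [← Real.rpow_natCast]; push_cast; rfl
  simp only [Real.rpow_add hu, e, Real.rpow_two]
  ring

/-- The quotient `Γ(i+j+a+1)/Γ(i+a+1)` is a monic polynomial of degree `j` in `i`, and the remaining
factors are signed binomial coefficients. The sum is thus a `k`-th forward difference, which kills
degree below `k` and gives `k!` in degree `k`. -/
lemma sum_polyCoeff_mul_Gamma {a : ℝ} (ha : -1 < a) (k j : ℕ) (hj : j ≤ k) :
    ∑ i ∈ Finset.range (k + 1), polyCoeff a k i * Real.Gamma ((i + j : ℕ) + a + 1)
      = if j = k then (-1) ^ k * Real.Gamma (k + a + 1) else 0 := by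
  set P : Polynomial ℝ := (ascPochhammer ℝ j).comp (Polynomial.X + Polynomial.C (a + 1)) with hP
  have hmon : P.Monic := (monic_ascPochhammer ℝ j).comp_X_add_C _
  have hdeg : P.natDegree = j := by
    rw [hP, Polynomial.natDegree_comp, Polynomial.natDegree_X_add_C, ascPochhammer_natDegree, mul_one]
  have hG : ∀ i : ℕ, 0 < Real.Gamma (a + i + 1) := fun i =>
    Real.Gamma_pos_of_pos (by have : (0 : ℝ) ≤ i := i.cast_nonneg
                              linarith)
  have key : ∑ i ∈ Finset.range (k + 1), polyCoeff a k i * Real.Gamma ((i + j : ℕ) + a + 1)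
      = (-1) ^ k * Real.Gamma (k + a + 1) / k.factorial * (fwdDiff 1)^[k] P.eval 0 := by
    rw [fwdDiff_iter_eq_sum_shift, Finset.mul_sum]
    refine Finset.sum_congr rfl fun i hi => ?_
    have hik : i ≤ k := Nat.lt_succ_iff.1 (Finset.mem_range.1 hi)
    have e1 : Real.Gamma ((i + j : ℕ) + a + 1) = P.eval (i : ℝ) * Real.Gamma (a + i + 1) := by
      have := Gamma_add_nat (x := a + i + 1) (by have : (0 : ℝ) ≤ i := i.cast_nonneg
                                                 linarith) j
      rw [hP, Polynomial.eval_comp]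
      simp only [Polynomial.eval_add, Polynomial.eval_X, Polynomial.eval_C]
      rw [show ((i + j : ℕ) : ℝ) + a + 1 = a + i + 1 + j by push_cast; ring, this,
        show (i : ℝ) + (a + 1) = a + i + 1 by ring]
    have e2 : ((k.choose i : ℕ) : ℝ) = k.factorial / (i.factorial * (k - i).factorial) :=
      Nat.cast_choose ℝ hik
    have e3 : (-1 : ℝ) ^ k * (-1) ^ (k - i) = (-1) ^ i := by
      rw [← pow_add, show k + (k - i) = i + 2 * (k - i) by omega, pow_add, pow_mul]; simp
    rw [e1, polyCoeff]
    simp only [zero_add, nsmul_eq_mul, mul_one, zsmul_eq_mul]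
    push_cast
    rw [e2, ← e3]
    have := (hG i).ne'
    have h1 : (k.factorial : ℝ) ≠ 0 := by positivity
    have h2 : (i.factorial : ℝ) ≠ 0 := by positivity
    have h3 : ((k - i).factorial : ℝ) ≠ 0 := by positivity
    field_simp
  rw [key]
  split_ifs with h
  · have := Polynomial.fwdDiff_iter_degree_eq_factorial P
    rw [hdeg, h, hmon.leadingCoeff] at this
    rw [this]
    have h1 : (k.factorial : ℝ) ≠ 0 := by positivity
    simp
    field_simp
  · rw [Polynomial.fwdDiff_iter_eq_zero_of_degree_lt (by rw [hdeg]; omega)]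
    simp

lemma integrableOn_polys_mul_gaussian {a : ℝ} (ha : -1 < a) (p q : Polynomial ℝ) :
    IntegrableOn (fun u : ℝ => p.eval (u ^ 2) * q.eval (u ^ 2) * (Real.exp (-u ^ 2) *
      u ^ (2 * a + 1))) (Set.Ioi 0) := by
  simp_rw [← Polynomial.eval_mul, Polynomial.eval_eq_sum_range, Finset.sum_mul]
  refine integrable_finsetSum _ fun i _ => ?_
  have := (integrableOn_pow_mul_gaussian ha i).const_mul ((p * q).coeff i)
  refine this.congr (Eventually.of_forall fun u => ?_)
  simp only [pow_mul]; ring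

/-- The Laguerre polynomial as a bundled polynomial. -/
noncomputable def laguerrePolynomial (a : ℝ) (k : ℕ) : Polynomial ℝ :=
  ∑ j ∈ Finset.range (k + 1), Polynomial.monomial j (polyCoeff a k j)

lemma eval_laguerrePolynomial (a : ℝ) (k : ℕ) (t : ℝ) :
    (laguerrePolynomial a k).eval t = laguerrePoly a k t := by
  simp [laguerrePolynomial, laguerrePoly_eq_sum, Polynomial.eval_finsetSum]

lemma integral_pow_mul_laguerrePoly {a : ℝ} (ha : -1 < a) (k j : ℕ) (hj : j ≤ k) :
    ∫ u in Set.Ioi (0 : ℝ), (u ^ 2) ^ j * laguerrePoly a k (u ^ 2) *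
      (Real.exp (-u ^ 2) * u ^ (2 * a + 1))
      = if j = k then (-1) ^ k * Real.Gamma (k + a + 1) / 2 else 0 := by
  have : ∀ u : ℝ, (u ^ 2) ^ j * laguerrePoly a k (u ^ 2) * (Real.exp (-u ^ 2) * u ^ (2 * a + 1))
      = ∑ i ∈ Finset.range (k + 1), polyCoeff a k i *
        (u ^ (2 * (i + j)) * (Real.exp (-u ^ 2) * u ^ (2 * a + 1))) := by
    intro u
    rw [laguerrePoly_eq_sum, Finset.mul_sum, Finset.sum_mul]
    refine Finset.sum_congr rfl fun i _ => ?_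
    rw [pow_mul, pow_add]; ring
  simp_rw [this]
  rw [integral_finsetSum _ fun i _ => (integrableOn_pow_mul_gaussian ha (i + j)).const_mul _]
  simp_rw [integral_const_mul, integral_pow_mul_gaussian ha]
  have h := sum_polyCoeff_mul_Gamma ha k j hj
  simp_rw [← mul_div_assoc, ← Finset.sum_div]
  rw [h]; split_ifs <;> simp

lemma laguerreFun1_mul_eq (a : ℝ) (k m : ℕ) (u : ℝ) :
    laguerreFun1 a k u * laguerreFun1 a m u * u ^ (2 * a + 1) =
      Real.sqrt (2 * Real.Gamma (k + 1) / Real.Gamma (k + a + 1)) *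
      Real.sqrt (2 * Real.Gamma (m + 1) / Real.Gamma (m + a + 1)) *
      ((laguerrePolynomial a k).eval (u ^ 2) * (laguerrePolynomial a m).eval (u ^ 2) *
        (Real.exp (-u ^ 2) * u ^ (2 * a + 1))) := by
  have : Real.exp (-u ^ 2) = Real.exp (-u ^ 2 / 2) * Real.exp (-u ^ 2 / 2) := by
    rw [← Real.exp_add, add_halves]
  rw [eval_laguerrePolynomial, eval_laguerrePolynomial, laguerreFun1, laguerreFun1, this]
  ring

lemma integrableOn_laguerreFun1_mul {a : ℝ} (ha : -1 < a) (k m : ℕ) :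
    IntegrableOn (fun u => laguerreFun1 a k u * laguerreFun1 a m u * u ^ (2 * a + 1))
      (Set.Ioi 0) := by
  simp_rw [laguerreFun1_mul_eq]
  exact (integrableOn_polys_mul_gaussian ha _ _).const_mul _

/-- Orthonormality of the one-dimensional Laguerre functions. -/
lemma integral_laguerreFun1_mul {a : ℝ} (ha : -1 < a) (k m : ℕ) :
    ∫ u in Set.Ioi (0 : ℝ), laguerreFun1 a k u * laguerreFun1 a m u * u ^ (2 * a + 1)
      = if k = m then 1 else 0 := by
  wlog h : m ≤ k generalizing k m
  · have := this m k (by omega)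
    simp_rw [mul_comm (laguerreFun1 a k _), this, eq_comm]
  have hG : 0 < Real.Gamma (k + a + 1) :=
    Real.Gamma_pos_of_pos (by have : (0 : ℝ) ≤ k := k.cast_nonneg
                              linarith)
  simp_rw [laguerreFun1_mul_eq, integral_const_mul, eval_laguerrePolynomial]
  -- Only the factor of lower degree `m ≤ k` is expanded: every power that occurs is at most `k`,
  -- and only the power `k`, present when `m = k`, contributes.
  have : ∀ u : ℝ, laguerrePoly a k (u ^ 2) * laguerrePoly a m (u ^ 2) *
      (Real.exp (-u ^ 2) * u ^ (2 * a + 1)) = ∑ j ∈ Finset.range (m + 1), polyCoeff a m j *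
        ((u ^ 2) ^ j * laguerrePoly a k (u ^ 2) * (Real.exp (-u ^ 2) * u ^ (2 * a + 1))) := by
    intro u
    rw [laguerrePoly_eq_sum a m, Finset.mul_sum, Finset.sum_mul]
    exact Finset.sum_congr rfl fun i _ => by ring
  simp_rw [this]
  have hint : ∀ j, IntegrableOn (fun u : ℝ => (u ^ 2) ^ j * laguerrePoly a k (u ^ 2) *
      (Real.exp (-u ^ 2) * u ^ (2 * a + 1))) (Set.Ioi 0) := fun j => by
    have := integrableOn_polys_mul_gaussian ha (Polynomial.X ^ j) (laguerrePolynomial a k)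
    simpa [eval_laguerrePolynomial] using this
  rw [integral_finsetSum _ fun j _ => (hint j).const_mul _]
  simp_rw [integral_const_mul]
  rw [Finset.sum_congr rfl fun j hj => by
    rw [integral_pow_mul_laguerrePoly ha k j (by
      have := Finset.mem_range.1 hj
      omega)]]
  rcases eq_or_lt_of_le h with rfl | hlt
  · simp only [mul_ite, mul_zero, Finset.sum_ite_eq', Finset.mem_range, Nat.lt_succ_self, if_true]
    rw [Real.mul_self_sqrt (by positivity), polyCoeff, Real.Gamma_nat_eq_factorial]
    rw [show a + (m : ℝ) + 1 = m + a + 1 by ring]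
    have h1 : (m.factorial : ℝ) ≠ 0 := by positivity
    have h2 : ((-1 : ℝ) ^ m) * (-1) ^ m = 1 := by rw [← mul_pow]; simp
    have h3 := hG.ne'
    simp only [Nat.sub_self, Nat.factorial_zero, Nat.cast_one, mul_one]
    field_simp
    linear_combination h2
  · rw [if_neg hlt.ne', Finset.sum_eq_zero, mul_zero]
    intro j hj
    have := Finset.mem_range.1 hj
    rw [if_neg (by omega), mul_zero]

lemma integral_sq_sum_laguerreFun1 {a : ℝ} (ha : -1 < a) (N : ℕ) (b : ℕ → ℝ) :
    ∫ u in Set.Ioi (0 : ℝ), (∑ k ∈ Finset.range N, b k * laguerreFun1 a k u) ^ 2 * u ^ (2 * a + 1)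
      = ∑ k ∈ Finset.range N, b k ^ 2 := by
  have : ∀ u : ℝ, (∑ k ∈ Finset.range N, b k * laguerreFun1 a k u) ^ 2 * u ^ (2 * a + 1)
      = ∑ k ∈ Finset.range N, ∑ m ∈ Finset.range N, b k * b m *
        (laguerreFun1 a k u * laguerreFun1 a m u * u ^ (2 * a + 1)) := by
    intro u
    rw [sq, Finset.sum_mul_sum, Finset.sum_mul]
    refine Finset.sum_congr rfl fun k _ => ?_
    rw [Finset.sum_mul]
    exact Finset.sum_congr rfl fun m _ => by ring
  simp_rw [this]
  rw [integral_finsetSum _ fun k _ => integrable_finsetSum _ fun m _ =>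
    (integrableOn_laguerreFun1_mul ha k m).const_mul _]
  refine Finset.sum_congr rfl fun k hk => ?_
  rw [integral_finsetSum _ fun m _ => (integrableOn_laguerreFun1_mul ha k m).const_mul _]
  simp_rw [integral_const_mul, integral_laguerreFun1_mul ha]
  simp only [mul_ite, mul_one, mul_zero, Finset.sum_ite_eq, hk, if_true, sq]

lemma integrableOn_sq_sum_laguerreFun1 {a : ℝ} (ha : -1 < a) (N : ℕ) (b : ℕ → ℝ) :
    IntegrableOn (fun u => (∑ k ∈ Finset.range N, b k * laguerreFun1 a k u) ^ 2 *
      u ^ (2 * a + 1)) (Set.Ioi 0) := by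
  have : ∀ u : ℝ, (∑ k ∈ Finset.range N, b k * laguerreFun1 a k u) ^ 2 * u ^ (2 * a + 1)
      = ∑ k ∈ Finset.range N, ∑ m ∈ Finset.range N, b k * b m *
        (laguerreFun1 a k u * laguerreFun1 a m u * u ^ (2 * a + 1)) := by
    intro u
    rw [sq, Finset.sum_mul_sum, Finset.sum_mul]
    refine Finset.sum_congr rfl fun k _ => ?_
    rw [Finset.sum_mul]
    exact Finset.sum_congr rfl fun m _ => by ring
  simp_rw [this]
  exact integrable_finsetSum _ fun k _ => integrable_finsetSum _ fun m _ =>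
    (integrableOn_laguerreFun1_mul ha k m).const_mul _

/-! ### Contiguous relation and derivative of the Laguerre functions. -/

lemma laguerrePoly_zero {a : ℝ} (ha : -1 < a) (t : ℝ) : laguerrePoly a 0 t = 1 := by
  have : Real.Gamma (a + 1) ≠ 0 := (Real.Gamma_pos_of_pos (by linarith)).ne'
  simp [laguerrePoly, this]

/-- Needed so that both terms of the derivative of `ℓ_k^a` are of order `a + 1`. Coefficientwise it
is `Γ(x+1) = xΓ(x)`; the top power is separate, being absent from the degree `k` polynomial. -/
lemma laguerrePoly_succ {a : ℝ} (ha : -1 < a) (k : ℕ) (t : ℝ) :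
    laguerrePoly a (k + 1) t = laguerrePoly (a + 1) (k + 1) t - laguerrePoly (a + 1) k t := by
  have hk : (0 : ℝ) ≤ k := k.cast_nonneg
  simp only [laguerrePoly_eq_sum]
  rw [Finset.sum_range_succ, Finset.sum_range_succ _ (k + 1), add_sub_right_comm,
    ← Finset.sum_sub_distrib]
  congr 1
  · refine Finset.sum_congr rfl fun j hj => ?_
    rw [← sub_mul]
    congr 1
    have hjk : j ≤ k := Nat.lt_succ_iff.1 (Finset.mem_range.1 hj)
    have hj0 : (0 : ℝ) ≤ j := j.cast_nonneg
    obtain ⟨i, rfl⟩ := Nat.exists_eq_add_of_le hjk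
    rw [polyCoeff, polyCoeff, polyCoeff, show j + i + 1 - j = i + 1 by omega,
      show j + i - j = i by omega, Nat.factorial_succ]
    have g1 : Real.Gamma (((j + i + 1 : ℕ) : ℝ) + (a + 1) + 1)
        = (((j + i : ℕ) : ℝ) + a + 2) * Real.Gamma (((j + i : ℕ) : ℝ) + a + 2) := by
      rw [← Real.Gamma_add_one (by linarith)]; push_cast; ring_nf
    have g2 : Real.Gamma (a + 1 + j + 1) = (a + j + 1) * Real.Gamma (a + j + 1) := by
      rw [← Real.Gamma_add_one (by linarith)]; ring_nf
    have g3 : ((j + i + 1 : ℕ) : ℝ) + a + 1 = ((j + i : ℕ) : ℝ) + a + 2 := by push_cast; ring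
    have g4 : ((j + i : ℕ) : ℝ) + (a + 1) + 1 = ((j + i : ℕ) : ℝ) + a + 2 := by ring
    rw [g1, g2, g3, g4]
    have h1 : Real.Gamma (a + j + 1) ≠ 0 := (Real.Gamma_pos_of_pos (by linarith)).ne'
    have h2 : a + j + 1 ≠ 0 := by linarith
    push_cast
    field_simp
    ring
  · congr 1
    have h1 : Real.Gamma (a + k + 2) ≠ 0 := (Real.Gamma_pos_of_pos (by linarith)).ne'
    have h2 : Real.Gamma (a + k + 3) ≠ 0 := (Real.Gamma_pos_of_pos (by linarith)).ne'
    simp only [polyCoeff, Nat.sub_self, Nat.factorial_zero, Nat.cast_one, mul_one]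
    push_cast
    rw [show (k : ℝ) + 1 + a + 1 = a + k + 2 by ring, show a + ((k : ℝ) + 1) + 1 = a + k + 2 by ring,
      show (k : ℝ) + 1 + (a + 1) + 1 = a + k + 3 by ring,
      show a + 1 + ((k : ℝ) + 1) + 1 = a + k + 3 by ring, div_self h1, div_self h2]

lemma hasDerivAt_laguerrePoly_succ (a : ℝ) (k : ℕ) (t : ℝ) :
    HasDerivAt (laguerrePoly a (k + 1)) (-laguerrePoly (a + 1) k t) t := by
  have e : laguerrePoly a (k + 1) = fun t =>
      ∑ j ∈ Finset.range (k + 1), polyCoeff a (k + 1) (j + 1) * t ^ (j + 1)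
        + polyCoeff a (k + 1) 0 := by
    funext t
    rw [laguerrePoly_eq_sum, Finset.sum_range_succ', pow_zero, mul_one]
  rw [e, laguerrePoly_eq_sum, ← Finset.sum_neg_distrib]
  refine HasDerivAt.add_const _ (HasDerivAt.fun_sum fun j hj => ?_)
  refine ((hasDerivAt_pow (j + 1) t).const_mul _).congr_deriv ?_
  have g1 : ((k + 1 : ℕ) : ℝ) + a + 1 = k + (a + 1) + 1 := by push_cast; ring
  have g2 : a + ((j + 1 : ℕ) : ℝ) + 1 = a + 1 + j + 1 := by push_cast; ring
  rw [polyCoeff, polyCoeff, g1, g2, Nat.add_sub_add_right, Nat.factorial_succ, pow_succ]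
  have h1 : (j.factorial : ℝ) ≠ 0 := by positivity
  simp only [Nat.add_sub_cancel]
  push_cast
  field_simp

/-- The Gaussian contributes `-u L_k^a = -u (L_k^{a+1} - L_{k-1}^{a+1})` and the polynomial `-2u
L_{k-1}^{a+1}`, whose sum is `-u (L_k^{a+1} + L_{k-1}^{a+1})`. The square roots come from changing
the normalizing constants (`c1`, `c2`). At `k = 0` the truncated index `k - 1` is harmless, its
factor `√k` being zero. -/
lemma hasDerivAt_laguerreFun1 {a : ℝ} (ha : -1 < a) (k : ℕ) (u : ℝ) :
    HasDerivAt (laguerreFun1 a k) (-u * (Real.sqrt (k + a + 1) * laguerreFun1 (a + 1) k u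
      + Real.sqrt k * laguerreFun1 (a + 1) (k - 1) u)) u := by
  have hk : (0 : ℝ) ≤ k := k.cast_nonneg
  have hE : HasDerivAt (fun u : ℝ => Real.exp (-u ^ 2 / 2)) (Real.exp (-u ^ 2 / 2) * -u) u := by
    have : HasDerivAt (fun u : ℝ => -u ^ 2 / 2) (-u) u := by
      refine (((hasDerivAt_pow 2 u).neg).div_const 2).congr_deriv ?_
      simp
      ring
    exact this.exp
  have hG : 0 < Real.Gamma (k + a + 1) := Real.Gamma_pos_of_pos (by linarith)
  have hG1 : 0 < Real.Gamma (k + 1) := Real.Gamma_pos_of_pos (by linarith)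
  have c1 : Real.sqrt (2 * Real.Gamma (k + 1) / Real.Gamma (k + a + 1)) =
      Real.sqrt (k + a + 1) *
        Real.sqrt (2 * Real.Gamma (k + 1) / Real.Gamma (k + (a + 1) + 1)) := by
    rw [← Real.sqrt_mul (by linarith), show (k : ℝ) + (a + 1) + 1 = k + a + 1 + 1 by ring,
      Real.Gamma_add_one (s := k + a + 1) (by linarith)]
    congr 1
    have : (k : ℝ) + a + 1 ≠ 0 := by linarith
    field_simp
  cases k with
  | zero =>
    have e : laguerreFun1 a 0 = fun u => Real.sqrt (2 * Real.Gamma ((0 : ℕ) + 1) /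
        Real.Gamma ((0 : ℕ) + a + 1)) * Real.exp (-u ^ 2 / 2) := by
      funext u; rw [laguerreFun1, laguerrePoly_zero ha, mul_one]
    rw [e]
    refine (hE.const_mul _).congr_deriv ?_
    rw [c1, laguerreFun1, laguerrePoly_zero (by linarith)]
    simp
    ring
  | succ k =>
    have c2 : Real.sqrt (2 * Real.Gamma ((k + 1 : ℕ) + 1) / Real.Gamma ((k + 1 : ℕ) + a + 1)) =
        Real.sqrt ((k + 1 : ℕ) : ℝ) *
          Real.sqrt (2 * Real.Gamma (k + 1) / Real.Gamma (k + (a + 1) + 1)) := by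
      rw [← Real.sqrt_mul hk, Real.Gamma_add_one (s := ((k + 1 : ℕ) : ℝ)) (by positivity)]
      congr 1
      push_cast
      rw [show (k : ℝ) + 1 + a + 1 = k + (a + 1) + 1 by ring]
      ring
    have hL : HasDerivAt (fun u : ℝ => laguerrePoly a (k + 1) (u ^ 2))
        (-laguerrePoly (a + 1) k (u ^ 2) * (2 * u)) u := by
      refine ((hasDerivAt_laguerrePoly_succ a k (u ^ 2)).comp u (hasDerivAt_pow 2 u)).congr_deriv ?_
      simp
    have := (hL.const_mul (Real.sqrt (2 * Real.Gamma ((k + 1 : ℕ) + 1) /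
      Real.Gamma ((k + 1 : ℕ) + a + 1)))).mul hE
    refine this.congr_deriv ?_
    rw [laguerreFun1, laguerreFun1, Nat.add_sub_cancel]
    generalize hs : Real.sqrt (2 * Real.Gamma ((k + 1 : ℕ) + 1) /
      Real.Gamma ((k + 1 : ℕ) + a + 1)) = s at *
    rw [laguerrePoly_succ ha k]
    linear_combination (-u * laguerrePoly (a + 1) (k + 1) (u ^ 2) * Real.exp (-u ^ 2 / 2)) * c1
      + (-u * laguerrePoly (a + 1) k (u ^ 2) * Real.exp (-u ^ 2 / 2)) * c2

/-! ### Order `-1/2`: Bernstein inequality and kernel bounds. -/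

lemma continuous_laguerreFun1 (a : ℝ) (k : ℕ) : Continuous (laguerreFun1 a k) := by
  unfold laguerreFun1 laguerrePoly
  fun_prop

/-- For order `1/2` the weight `u^{2a+1}` is `u²`, which is absorbed into the square: the functions
`u ℓ_k^{1/2}` are orthonormal for `du`. For order `-1/2` the weight is `1`. -/
lemma integrableOn_sq_sum_half (N : ℕ) (b : ℕ → ℝ) :
    IntegrableOn (fun u => (u * ∑ k ∈ Finset.range N, b k * laguerreFun1 (1 / 2) k u) ^ 2)
      (Set.Ioi 0) := by
  refine (integrableOn_sq_sum_laguerreFun1 (a := 1 / 2) (by norm_num) N b).congr_fun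
    (fun u hu => ?_) measurableSet_Ioi
  dsimp only
  rw [show (2 * (1 / 2 : ℝ) + 1) = 2 by norm_num, Real.rpow_two]; ring

lemma integral_sq_sum_half (N : ℕ) (b : ℕ → ℝ) :
    ∫ u in Set.Ioi (0 : ℝ), (u * ∑ k ∈ Finset.range N, b k * laguerreFun1 (1 / 2) k u) ^ 2
      = ∑ k ∈ Finset.range N, b k ^ 2 := by
  rw [← integral_sq_sum_laguerreFun1 (a := 1 / 2) (by norm_num) N b]
  refine setIntegral_congr_fun measurableSet_Ioi fun u hu => ?_
  rw [show (2 * (1 / 2 : ℝ) + 1) = 2 by norm_num, Real.rpow_two]; ring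

lemma integrableOn_sq_sum_neg_half (N : ℕ) (b : ℕ → ℝ) :
    IntegrableOn (fun u => (∑ k ∈ Finset.range N, b k * laguerreFun1 (-1 / 2) k u) ^ 2)
      (Set.Ioi 0) := by
  have := integrableOn_sq_sum_laguerreFun1 (a := -1 / 2) (by norm_num) N b
  simpa [show (2 * (-1 / 2 : ℝ) + 1) = 0 by norm_num] using this

lemma integral_sq_sum_neg_half (N : ℕ) (b : ℕ → ℝ) :
    ∫ u in Set.Ioi (0 : ℝ), (∑ k ∈ Finset.range N, b k * laguerreFun1 (-1 / 2) k u) ^ 2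
      = ∑ k ∈ Finset.range N, b k ^ 2 := by
  rw [← integral_sq_sum_laguerreFun1 (a := -1 / 2) (by norm_num) N b]
  simp [show (2 * (-1 / 2 : ℝ) + 1) = 0 by norm_num]

/-- A Bernstein inequality: combinations of the first `N` Hermite-type functions have derivatives
controlled in `L²`. -/
lemma exists_deriv_bound (N : ℕ) (b : ℕ → ℝ) : ∃ g : ℝ → ℝ, Continuous g ∧
    (∀ u, HasDerivAt (fun u => ∑ k ∈ Finset.range N, b k * laguerreFun1 (-1 / 2) k u) (g u) u) ∧
    IntegrableOn (fun u => g u ^ 2) (Set.Ioi 0) ∧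
    ∫ u in Set.Ioi (0 : ℝ), g u ^ 2 ≤ 4 * N * ∑ k ∈ Finset.range N, b k ^ 2 := by
  -- `B` is the part of the derivative with index `k - 1`. Its term `k = 0` vanishes, and reindexing
  -- by one writes it in distinct orthonormal functions, so that Parseval applies; the other form
  -- matches the derivative formula.
  obtain ⟨B, M, c, hB, hc⟩ : ∃ (B : ℝ → ℝ) (M : ℕ) (c : ℕ → ℝ),
      (∀ u, B u = u * ∑ k ∈ Finset.range M, c k * laguerreFun1 (1 / 2) k u ∧
        B u = u * ∑ k ∈ Finset.range N, b k * Real.sqrt k * laguerreFun1 (1 / 2) (k - 1) u) ∧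
      ∑ k ∈ Finset.range M, c k ^ 2 ≤ N * ∑ k ∈ Finset.range N, b k ^ 2 := by
    cases N with
    | zero => exact ⟨fun _ => 0, 0, fun _ => 0, fun u => by simp, by simp⟩
    | succ M =>
      refine ⟨_, M, fun k => b (k + 1) * Real.sqrt (k + 1 : ℕ), fun u => ⟨rfl, ?_⟩, ?_⟩
      · dsimp only
        rw [Finset.sum_range_succ' _ M]
        simp
      · rw [Finset.sum_range_succ' _ M, mul_add, Finset.mul_sum]
        refine le_add_of_le_of_nonneg (Finset.sum_le_sum fun k hk => ?_) (by positivity)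
        rw [mul_pow, Real.sq_sqrt (by positivity), mul_comm]
        have : k + 1 ≤ M + 1 := by have := Finset.mem_range.1 hk; omega
        gcongr
  set A : ℝ → ℝ := fun u => u * ∑ k ∈ Finset.range N,
    (b k * Real.sqrt (k + 1 / 2)) * laguerreFun1 (1 / 2) k u with hA
  have hBe : B = fun u => u * ∑ k ∈ Finset.range M, c k * laguerreFun1 (1 / 2) k u :=
    funext fun u => (hB u).1
  have hAc : Continuous A := by
    have := continuous_laguerreFun1 (1 / 2)
    fun_prop
  have hBc : Continuous B := by
    have := continuous_laguerreFun1 (1 / 2)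
    rw [hBe]
    fun_prop
  have hAi : IntegrableOn (fun u => A u ^ 2) (Set.Ioi 0) := integrableOn_sq_sum_half N _
  have hBi : IntegrableOn (fun u => B u ^ 2) (Set.Ioi 0) := by
    rw [hBe]; exact integrableOn_sq_sum_half M _
  have hle : ∀ u, (-(A u + B u)) ^ 2 ≤ 2 * A u ^ 2 + 2 * B u ^ 2 := fun u => by
    nlinarith [sq_nonneg (A u - B u)]
  have hgi : IntegrableOn (fun u => (-(A u + B u)) ^ 2) (Set.Ioi 0) := by
    refine ((hAi.const_mul 2).add (hBi.const_mul 2)).mono' ?_ (Eventually.of_forall fun u => ?_)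
    · exact Continuous.aestronglyMeasurable (by fun_prop)
    · rw [Real.norm_of_nonneg (sq_nonneg _)]; exact hle u
  refine ⟨fun u => -(A u + B u), by fun_prop, fun u => ?_, hgi, ?_⟩
  · have := HasDerivAt.fun_sum (u := Finset.range N) fun k _ =>
      (hasDerivAt_laguerreFun1 (a := -1 / 2) (by norm_num) k u).const_mul (b k)
    refine this.congr_deriv ?_
    dsimp only
    rw [(hB u).2]
    simp only [hA]
    rw [← mul_add, ← Finset.sum_add_distrib, ← neg_mul, Finset.mul_sum]
    refine Finset.sum_congr rfl fun k _ => ?_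
    rw [show (-1 / 2 : ℝ) + 1 = 1 / 2 by norm_num,
      show (k : ℝ) + -1 / 2 + 1 = k + 1 / 2 by ring]
    ring
  · calc ∫ u in Set.Ioi (0 : ℝ), (-(A u + B u)) ^ 2
        ≤ ∫ u in Set.Ioi (0 : ℝ), (2 * A u ^ 2 + 2 * B u ^ 2) :=
          integral_mono hgi ((hAi.const_mul 2).add (hBi.const_mul 2)) hle
      _ = 2 * ∑ k ∈ Finset.range N, (b k * Real.sqrt (k + 1 / 2)) ^ 2
          + 2 * ∑ k ∈ Finset.range M, c k ^ 2 := by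
          rw [integral_add (hAi.const_mul 2) (hBi.const_mul 2), integral_const_mul,
            integral_const_mul, integral_sq_sum_half, hBe, integral_sq_sum_half]
      _ ≤ 2 * (N * ∑ k ∈ Finset.range N, b k ^ 2) + 2 * (N * ∑ k ∈ Finset.range N, b k ^ 2) := by
          gcongr
          rw [Finset.mul_sum]
          refine Finset.sum_le_sum fun k hk => ?_
          have h1 : ((k + 1 : ℕ) : ℝ) ≤ N := Nat.cast_le.2 (Finset.mem_range.1 hk)
          rw [mul_pow, Real.sq_sqrt (by positivity), mul_comm]
          push_cast at h1
          exact mul_le_mul_of_nonneg_right (by linarith) (sq_nonneg _)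
      _ = _ := by ring

/-- Cauchy–Schwarz on `[v, u]`, obtained by expanding `∫ (g - c)² ≥ 0` with `c` the mean slope. -/
lemma sq_sub_le_of_hasDerivAt {f g : ℝ → ℝ} (hg : Continuous g) (hf : ∀ u, HasDerivAt f (g u) u)
    (hgi : IntegrableOn (fun u => g u ^ 2) (Set.Ioi 0)) {u v : ℝ} (hv : 0 ≤ v) (hvu : v ≤ u) :
    (f u - f v) ^ 2 ≤ (u - v) * ∫ u in Set.Ioi (0 : ℝ), g u ^ 2 := by
  rcases eq_or_lt_of_le hvu with rfl | hlt
  · simp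
  have h1 : f u - f v = ∫ x in v..u, g x :=
    (intervalIntegral.integral_eq_sub_of_hasDerivAt (fun x _ => hf x)
      (hg.intervalIntegrable _ _)).symm
  have h2 : ∫ x in v..u, g x ^ 2 ≤ ∫ u in Set.Ioi (0 : ℝ), g u ^ 2 := by
    rw [intervalIntegral.integral_of_le hvu]
    refine setIntegral_mono_set hgi (Eventually.of_forall fun x => sq_nonneg _)
      (Eventually.of_forall fun x hx => ?_)
    exact lt_of_le_of_lt hv hx.1
  set c := (f u - f v) / (u - v) with hc
  have hpos : 0 < u - v := by linarith
  have h3 : 0 ≤ ∫ x in v..u, (g x - c) ^ 2 :=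
    intervalIntegral.integral_nonneg hvu fun x _ => sq_nonneg _
  have h4 : ∫ x in v..u, (g x - c) ^ 2
      = (∫ x in v..u, g x ^ 2) - 2 * c * (f u - f v) + c ^ 2 * (u - v) := by
    have : ∀ x, (g x - c) ^ 2 = g x ^ 2 - 2 * c * g x + c ^ 2 := fun x => by ring
    simp_rw [this]
    rw [intervalIntegral.integral_add, intervalIntegral.integral_sub,
      intervalIntegral.integral_const_mul, ← h1, intervalIntegral.integral_const, smul_eq_mul]
    · ring
    all_goals exact Continuous.intervalIntegrable (by fun_prop) _ _
  have h5 : f u - f v = c * (u - v) := by rw [hc]; field_simp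
  have h6 : (u - v) * c ^ 2 ≤ ∫ x in v..u, g x ^ 2 := by rw [h4, h5] at h3; nlinarith
  rw [h5]
  calc (c * (u - v)) ^ 2 = (u - v) * ((u - v) * c ^ 2) := by ring
    _ ≤ _ := mul_le_mul_of_nonneg_left (h6.trans h2) hpos.le

/-- Duality: with coefficients `b_k = ℓ_k(u) - ℓ_k(v)` the combination `f` satisfies `f(u) - f(v) =
S`, the sum to be bounded. Bernstein and Cauchy–Schwarz give `S² ≤ |u-v| · 4N · S`, and one factor
`S` cancels. -/
lemma sum_sq_sub_neg_half_le (N : ℕ) {u v : ℝ} (hu : 0 ≤ u) (hv : 0 ≤ v) :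
    ∑ k ∈ Finset.range N, (laguerreFun1 (-1 / 2) k u - laguerreFun1 (-1 / 2) k v) ^ 2
      ≤ 4 * N * |u - v| := by
  wlog h : v ≤ u generalizing u v
  · have := this hv hu (by linarith)
    rw [abs_sub_comm]
    refine le_of_eq_of_le (Finset.sum_congr rfl fun k _ => ?_) this
    ring
  set b : ℕ → ℝ := fun k => laguerreFun1 (-1 / 2) k u - laguerreFun1 (-1 / 2) k v with hb
  obtain ⟨g, hg, hf, hgi, hle⟩ := exists_deriv_bound N b
  have h1 := sq_sub_le_of_hasDerivAt hg hf hgi hv h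
  have h2 : ∑ k ∈ Finset.range N, b k * laguerreFun1 (-1 / 2) k u
      - ∑ k ∈ Finset.range N, b k * laguerreFun1 (-1 / 2) k v = ∑ k ∈ Finset.range N, b k ^ 2 := by
    rw [← Finset.sum_sub_distrib]
    exact Finset.sum_congr rfl fun k _ => by rw [hb]; ring
  rw [h2] at h1
  have hS : 0 ≤ ∑ k ∈ Finset.range N, b k ^ 2 := Finset.sum_nonneg fun k _ => sq_nonneg _
  rw [abs_of_nonneg (by linarith)]
  rcases hS.eq_or_lt with h0 | h0
  · rw [← h0]
    have : 0 ≤ u - v := by linarith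
    positivity
  · have h3 := mul_le_mul_of_nonneg_left hle (by linarith : 0 ≤ u - v)
    have h4 := h1.trans h3
    change ∑ k ∈ Finset.range N, b k ^ 2 ≤ _
    nlinarith

/-- The same duality with `b_k = ℓ_k(u)`, so `f(u) = S = ‖f‖²`. By Bernstein `f` stays close to `S`
on an interval of length `N^{-1/2}`; comparing with `‖f‖²` there gives `S² ≤ 10 √N S`. -/
lemma sum_sq_neg_half_le (N : ℕ) {u : ℝ} (hu : 0 ≤ u) :
    ∑ k ∈ Finset.range N, laguerreFun1 (-1 / 2) k u ^ 2 ≤ 10 * Real.sqrt N := by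
  rcases Nat.eq_zero_or_pos N with rfl | hN
  · simp
  set b : ℕ → ℝ := fun k => laguerreFun1 (-1 / 2) k u with hb
  set f : ℝ → ℝ := fun v => ∑ k ∈ Finset.range N, b k * laguerreFun1 (-1 / 2) k v with hfd
  obtain ⟨g, hg, hf, hgi, hle⟩ := exists_deriv_bound N b
  set S := ∑ k ∈ Finset.range N, b k ^ 2 with hSd
  have hfu : f u = S := Finset.sum_congr rfl fun k _ => by rw [hb]; ring
  have hfc : Continuous f := continuous_iff_continuousAt.2 fun v => (hf v).continuousAt
  set r := Real.sqrt N with hr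
  have hr0 : 0 < r := Real.sqrt_pos.2 (by exact_mod_cast hN)
  have hr2 : (N : ℝ) = r ^ 2 := (Real.sq_sqrt (by positivity)).symm
  have hS : 0 ≤ S := Finset.sum_nonneg fun k _ => sq_nonneg _
  -- From `S² ≤ 2 f(v)² + 2 (f(v) - S)²` and `(f(v) - S)² ≤ 4 r S` on this interval.
  have hpt : ∀ v ∈ Set.Icc u (u + r⁻¹), S ^ 2 - 8 * r * S ≤ 2 * f v ^ 2 := by
    intro v hv
    have h1 := sq_sub_le_of_hasDerivAt hg hf hgi hu hv.1
    change (f v - f u) ^ 2 ≤ _ at h1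
    have h2 : (f v - f u) ^ 2 ≤ r⁻¹ * (4 * N * S) := by
      refine h1.trans (mul_le_mul (by linarith [hv.2]) hle ?_ (by positivity))
      exact integral_nonneg fun _ => sq_nonneg _
    rw [hr2, hfu, show r⁻¹ * (4 * r ^ 2 * S) = 4 * r * S by field_simp] at h2
    nlinarith [sq_nonneg (f v + (f v - S))]
  have hle' : u ≤ u + r⁻¹ := by have := inv_pos.2 hr0; linarith
  have hint : ∫ v in u..(u + r⁻¹), (S ^ 2 - 8 * r * S) ≤ ∫ v in u..(u + r⁻¹), 2 * f v ^ 2 :=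
    intervalIntegral.integral_mono_on hle' (by simp)
      (Continuous.intervalIntegrable (by fun_prop) _ _) hpt
  have h2 : ∫ x in u..(u + r⁻¹), f x ^ 2 ≤ S := by
    rw [intervalIntegral.integral_of_le hle', hSd, ← integral_sq_sum_neg_half]
    refine setIntegral_mono_set (integrableOn_sq_sum_neg_half N b)
      (Eventually.of_forall fun x => sq_nonneg _) (Eventually.of_forall fun x hx => ?_)
    exact lt_of_le_of_lt hu hx.1
  rw [intervalIntegral.integral_const, intervalIntegral.integral_const_mul, smul_eq_mul] at hint
  have h3 : r⁻¹ * (S ^ 2 - 8 * r * S) ≤ 2 * S := by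
    rw [add_sub_cancel_left] at hint; linarith
  have h4 : S ^ 2 - 8 * r * S ≤ 2 * S * r := by
    have := mul_le_mul_of_nonneg_left h3 hr0.le
    rw [mul_inv_cancel_left₀ hr0.ne'] at this
    linarith
  change S ≤ _
  rcases hS.eq_or_lt with h0 | h0
  · rw [← h0]; positivity
  · nlinarith

/-! ### Passage from order `-1/2` to order `a` by Beta averages. -/

/-- Log-convexity between `x` and `x + 1` treats the fractional part of `b`, the functional equation
the integer part. The lower bound `x ≥ 1/2` lets each factor `x + (θ + m)` be absorbed into a
multiple of `x`. -/
lemma Gamma_add_le {b : ℝ} (hb : 0 ≤ b) :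
    ∃ C : ℝ, 0 < C ∧ ∀ x : ℝ, 1 / 2 ≤ x → Real.Gamma (x + b) ≤ C * x ^ b * Real.Gamma x := by
  obtain ⟨m, θ, hθ0, hθ1, rfl⟩ : ∃ (m : ℕ) (θ : ℝ), 0 ≤ θ ∧ θ < 1 ∧ b = θ + m :=
    ⟨⌊b⌋₊, b - ⌊b⌋₊, by linarith [Nat.floor_le hb], by linarith [Nat.lt_floor_add_one b], by ring⟩
  clear hb
  induction m with
  | zero =>
    refine ⟨1, one_pos, fun x hx => ?_⟩
    have hG : 0 < Real.Gamma x := Real.Gamma_pos_of_pos (by linarith)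
    rcases hθ0.eq_or_lt with rfl | h0
    · simp
    · have := Real.Gamma_mul_add_mul_le_rpow_Gamma_mul_rpow_Gamma (s := x) (t := x + 1)
        (a := 1 - θ) (b := θ) (by linarith) (by linarith) (by linarith) h0 (by ring)
      rw [show (1 - θ) * x + θ * (x + 1) = x + θ by ring, Real.Gamma_add_one (by linarith),
        Real.mul_rpow (by linarith) hG.le] at this
      have e : Real.Gamma x ^ (1 - θ) * Real.Gamma x ^ θ = Real.Gamma x := by
        rw [← Real.rpow_add hG]; simp
      simp only [Nat.cast_zero, add_zero, one_mul]
      calc _ ≤ _ := this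
        _ = x ^ θ * (Real.Gamma x ^ (1 - θ) * Real.Gamma x ^ θ) := by ring
        _ = _ := by rw [e]
  | succ m ih =>
    obtain ⟨C, hC, h⟩ := ih
    have hm : (0 : ℝ) ≤ θ + m := by positivity
    refine ⟨(1 + 2 * (θ + m)) * C, by positivity, fun x hx => ?_⟩
    have hx0 : 0 < x := by linarith
    have hG : 0 < Real.Gamma x := Real.Gamma_pos_of_pos hx0
    push_cast
    rw [show x + (θ + (m + 1)) = x + (θ + m) + 1 by ring, Real.Gamma_add_one (by linarith),
      show θ + ((m : ℝ) + 1) = θ + m + 1 by ring, Real.rpow_add hx0 (θ + m) 1, Real.rpow_one]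
    calc (x + (θ + m)) * Real.Gamma (x + (θ + m))
        ≤ ((1 + 2 * (θ + m)) * x) * (C * x ^ (θ + m) * Real.Gamma x) := by
          refine mul_le_mul ?_ (h x hx) (Real.Gamma_nonneg_of_nonneg (by linarith)) (by positivity)
          nlinarith
      _ = _ := by ring

open ProbabilityTheory in
lemma integral_betaMeasure_pow {p q : ℝ} (hp : 0 < p) (hq : 0 < q) (j : ℕ) :
    ∫ s, s ^ j ∂(betaMeasure p q) = beta (p + j) q / beta p q := by
  have h1 : ∀ {p' : ℝ}, 0 < p' → ∀ x, 0 ≤ betaPDFReal p' q x := fun hp' x => by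
    by_cases hx : 0 < x ∧ x < 1
    · exact (betaPDFReal_pos hx.1 hx.2 hp' hq).le
    · rw [betaPDFReal, if_neg hx]
  have hpj : 0 < p + j := by positivity
  have h2 : ∫ x, betaPDFReal (p + j) q x = 1 := by
    rw [integral_eq_lintegral_of_nonneg_ae (Eventually.of_forall (h1 hpj))
      (measurable_betaPDFReal _ _).aestronglyMeasurable]
    have := lintegral_betaPDF_eq_one hpj hq
    unfold betaPDF at this
    rw [this]; rfl
  have h3 : ∀ s, betaPDFReal p q s * s ^ j
      = beta (p + j) q / beta p q * betaPDFReal (p + j) q s := by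
    intro s
    unfold betaPDFReal
    split_ifs with hs
    · rw [show p + (j : ℝ) - 1 = (p - 1) + j by ring, Real.rpow_add hs.1, Real.rpow_natCast]
      have b1 := (beta_pos hp hq).ne'
      have b2 := (beta_pos hpj hq).ne'
      field_simp
    · simp
  rw [betaMeasure, integral_withDensity_eq_integral_toReal_smul
    (by unfold betaPDF; exact (measurable_betaPDFReal _ _).ennreal_ofReal)
    (Eventually.of_forall fun x => by simp [betaPDF])]
  have h4 : ∀ s, (betaPDF p q s).toReal • s ^ j
      = beta (p + j) q / beta p q * betaPDFReal (p + j) q s := by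
    intro s
    rw [betaPDF, ENNReal.toReal_ofReal (h1 hp s), smul_eq_mul, h3]
  simp_rw [h4]
  rw [integral_const_mul, h2, mul_one]

open ProbabilityTheory in
/-- The probability measure carrying Laguerre functions of order `-1/2` to those of order `a`. -/
lemma exists_transfer_measure {a : ℝ} (ha : -1 / 2 ≤ a) :
    ∃ β : Measure ℝ, IsProbabilityMeasure β ∧ β.restrict (Set.Icc 0 1) = β ∧
      ∀ j : ℕ, ∫ s, s ^ j ∂β = Real.Gamma (j + 1 / 2) * Real.Gamma (a + 1) /
        (Real.Gamma (a + j + 1) * Real.Gamma (1 / 2)) := by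
  have hh : Real.Gamma (1 / 2) ≠ 0 := (Real.Gamma_pos_of_pos (by norm_num)).ne'
  rcases ha.eq_or_lt with rfl | h
  -- The law is Beta with parameters `1/2` and `a + 1/2`; at `a = -1/2` the second parameter is zero
  -- and the law degenerates to a point mass at `1`.
  · refine ⟨Measure.dirac 1, inferInstance, ?_, fun j => ?_⟩
    · exact Measure.restrict_eq_self_of_ae_mem (by simp [ae_dirac_eq])
    · have h1 : Real.Gamma ((j : ℝ) + 1 / 2) ≠ 0 := (Real.Gamma_pos_of_pos (by positivity)).ne'
      rw [integral_dirac, one_pow, show (-1 / 2 : ℝ) + 1 = 1 / 2 by norm_num,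
        show (-1 / 2 : ℝ) + j + 1 = j + 1 / 2 by ring, div_self (mul_ne_zero h1 hh)]
  · have hb : 0 < a + 1 / 2 := by linarith
    refine ⟨betaMeasure (1 / 2) (a + 1 / 2), isProbabilityMeasureBeta (by norm_num) hb, ?_,
      fun j => ?_⟩
    · refine Measure.restrict_eq_self_of_ae_mem ?_
      rw [betaMeasure, ae_withDensity_iff
        (by unfold betaPDF; exact (measurable_betaPDFReal _ _).ennreal_ofReal)]
      refine Eventually.of_forall fun x hx => ?_
      by_contra hx'
      apply hx
      rw [Set.mem_Icc, not_and_or, not_le, not_le] at hx'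
      rcases hx' with hx' | hx'
      · exact betaPDF_eq_zero_of_nonpos hx'.le
      · exact betaPDF_eq_zero_of_one_le hx'.le
    · rw [integral_betaMeasure_pow (by norm_num) hb, beta, beta,
        show 1 / 2 + (j : ℝ) + (a + 1 / 2) = a + j + 1 by ring,
        show (1 / 2 : ℝ) + (a + 1 / 2) = a + 1 by ring, add_comm (1 / 2 : ℝ) (j : ℝ)]
      have h1 : Real.Gamma (a + 1 / 2) ≠ 0 := (Real.Gamma_pos_of_pos hb).ne'
      have h2 : Real.Gamma (a + 1) ≠ 0 := (Real.Gamma_pos_of_pos (by linarith)).ne'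
      have h3 : Real.Gamma (a + j + 1) ≠ 0 := (Real.Gamma_pos_of_pos (by
        have : (0 : ℝ) ≤ j := j.cast_nonneg
        linarith)).ne'
      generalize Real.Gamma (a + 1 / 2) = g at *
      field_simp

lemma integrable_of_continuous_of_restrict {β : Measure ℝ} [IsProbabilityMeasure β]
    (hβ : β.restrict (Set.Icc 0 1) = β) {f : ℝ → ℝ} (hf : Continuous f) : Integrable f β := by
  rw [← hβ]
  exact hf.continuousOn.integrableOn_compact isCompact_Icc

lemma sq_integral_le {β : Measure ℝ} [IsProbabilityMeasure β]
    (hβ : β.restrict (Set.Icc 0 1) = β) {f : ℝ → ℝ} (hf : Continuous f) :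
    (∫ s, f s ∂β) ^ 2 ≤ ∫ s, f s ^ 2 ∂β := by
  set c := ∫ s, f s ∂β with hc
  have hfi := integrable_of_continuous_of_restrict hβ hf
  have hf2 : Integrable (fun s => f s ^ 2) β :=
    integrable_of_continuous_of_restrict hβ (hf.pow 2)
  have h : 0 ≤ ∫ s, (f s - c) ^ 2 ∂β := integral_nonneg fun _ => sq_nonneg _
  have e : ∀ s, (f s - c) ^ 2 = f s ^ 2 - 2 * c * f s + c ^ 2 := fun s => by ring
  have hd : Integrable (fun s => f s ^ 2 - 2 * c * f s) β := hf2.sub (hfi.const_mul _)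
  simp_rw [e] at h
  rw [integral_add hd (integrable_const _),
    integral_sub hf2 (hfi.const_mul _), integral_const_mul, integral_const, ← hc] at h
  simp at h
  nlinarith

/-- The integrand in the representation of `ℓ_k^a` through `ℓ_k^{-1/2}`. -/
noncomputable def transferKernel (k : ℕ) (u s : ℝ) : ℝ :=
  laguerreFun1 (-1 / 2) k (u * Real.sqrt s) * Real.exp (-(1 - s) * u ^ 2 / 2)

lemma continuous_transferKernel (k : ℕ) (u : ℝ) : Continuous (transferKernel k u) := by
  have := continuous_laguerreFun1 (-1 / 2) k
  unfold transferKernel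
  fun_prop

/-- After the substitution `u√s` the two exponentials combine into `e^{-u²/2}`, independent of `s`.
What remains is a polynomial in `s`, and the moments of `β` replace each `Γ(j + 1/2)` in the
coefficients of `L_k^{-1/2}` by `Γ(a + j + 1)`. -/
lemma laguerreFun1_eq_integral {a : ℝ} (ha : -1 / 2 ≤ a) {β : Measure ℝ} [IsProbabilityMeasure β]
    (hβ : β.restrict (Set.Icc 0 1) = β)
    (hmom : ∀ j : ℕ, ∫ s, s ^ j ∂β = Real.Gamma (j + 1 / 2) * Real.Gamma (a + 1) /
        (Real.Gamma (a + j + 1) * Real.Gamma (1 / 2))) (k : ℕ) (u : ℝ) :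
    laguerreFun1 a k u = Real.sqrt (Real.Gamma (k + a + 1) / Real.Gamma (k + 1 / 2)) *
      (Real.Gamma (1 / 2) / Real.Gamma (a + 1)) * ∫ s, transferKernel k u s ∂β := by
  have hk : (0 : ℝ) ≤ k := k.cast_nonneg
  set c := Real.sqrt (2 * Real.Gamma (k + 1) / Real.Gamma (k + -1 / 2 + 1)) with hc
  have h1 : ∫ s, transferKernel k u s ∂β
      = ∫ s, ∑ j ∈ Finset.range (k + 1), c * Real.exp (-u ^ 2 / 2) * (polyCoeff (-1 / 2) k j *
          (u ^ 2) ^ j) * s ^ j ∂β := by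
    rw [← hβ]
    refine setIntegral_congr_fun measurableSet_Icc fun s hs => ?_
    rw [transferKernel, laguerreFun1, mul_pow, Real.sq_sqrt hs.1, mul_assoc, ← Real.exp_add,
      laguerrePoly_eq_sum, Finset.mul_sum, Finset.sum_mul]
    refine Finset.sum_congr rfl fun j _ => ?_
    rw [show -(u ^ 2 * s) / 2 + -(1 - s) * u ^ 2 / 2 = -u ^ 2 / 2 by ring, mul_pow]
    ring
  rw [h1, integral_finsetSum _ fun j _ =>
    (integrable_of_continuous_of_restrict hβ (continuous_pow j)).const_mul _]
  simp_rw [integral_const_mul, hmom]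
  rw [laguerreFun1, laguerrePoly_eq_sum, Finset.mul_sum, Finset.sum_mul, Finset.mul_sum]
  refine Finset.sum_congr rfl fun j hj => ?_
  have hj0 : (0 : ℝ) ≤ j := j.cast_nonneg
  have p0 : 0 < Real.Gamma (k + a + 1) := Real.Gamma_pos_of_pos (by linarith)
  have p1 : 0 < Real.Gamma (k + 1 / 2) := Real.Gamma_pos_of_pos (by positivity)
  have p2 : 0 < Real.Gamma (k + 1) := Real.Gamma_pos_of_pos (by positivity)
  have q1 : Real.Gamma (1 / 2) ≠ 0 := (Real.Gamma_pos_of_pos (by norm_num)).ne'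
  have q2 : Real.Gamma (a + 1) ≠ 0 := (Real.Gamma_pos_of_pos (by linarith)).ne'
  have q3 : Real.Gamma (a + j + 1) ≠ 0 := (Real.Gamma_pos_of_pos (by linarith)).ne'
  have q4 : Real.Gamma ((j : ℝ) + 1 / 2) ≠ 0 := (Real.Gamma_pos_of_pos (by positivity)).ne'
  have e1 : Real.sqrt (Real.Gamma (k + a + 1) / Real.Gamma (k + 1 / 2)) * c
      = Real.sqrt (2 * Real.Gamma (k + 1) / Real.Gamma (k + a + 1)) *
        (Real.Gamma (k + a + 1) / Real.Gamma (k + 1 / 2)) := by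
    have e : Real.Gamma (k + a + 1) / Real.Gamma (k + 1 / 2) *
        (2 * Real.Gamma (k + 1) / Real.Gamma (k + 1 / 2))
        = 2 * Real.Gamma (k + 1) / Real.Gamma (k + a + 1) *
          (Real.Gamma (k + a + 1) / Real.Gamma (k + 1 / 2)) ^ 2 := by
      field_simp
    rw [hc, show (k : ℝ) + -1 / 2 + 1 = k + 1 / 2 by ring, ← Real.sqrt_mul (by positivity), e,
      Real.sqrt_mul (by positivity), Real.sqrt_sq (by positivity)]
  rw [polyCoeff, polyCoeff, show (k : ℝ) + -1 / 2 + 1 = k + 1 / 2 by ring,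
    show (-1 / 2 : ℝ) + j + 1 = j + 1 / 2 by ring]
  have h3 : ((k - j).factorial : ℝ) ≠ 0 := by positivity
  have h2 : (j.factorial : ℝ) ≠ 0 := by positivity
  set A := Real.sqrt (Real.Gamma (k + a + 1) / Real.Gamma (k + 1 / 2))
  set B := Real.sqrt (2 * Real.Gamma (k + 1) / Real.Gamma (k + a + 1))
  have p1' := p1.ne'
  have e2 : A * c * Real.Gamma (k + 1 / 2) = B * Real.Gamma (k + a + 1) := by
    rw [e1]; field_simp
  clear e1
  generalize Real.Gamma (k + 1 / 2) = G at *
  generalize Real.Gamma ((j : ℝ) + 1 / 2) = G' at *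
  field_simp
  linear_combination (-(u ^ 2) ^ j) * e2

/-- The derivative is at most `1` in absolute value, since `c|x| ≤ 1 + c x²/2 ≤ e^{c x²/2}` for `0 ≤
c ≤ 1`. -/
lemma abs_exp_sub_exp_le {c : ℝ} (hc0 : 0 ≤ c) (hc1 : c ≤ 1) (u v : ℝ) :
    |Real.exp (-c * u ^ 2 / 2) - Real.exp (-c * v ^ 2 / 2)| ≤ |u - v| := by
  have hd : ∀ x : ℝ, HasDerivAt (fun u : ℝ => Real.exp (-c * u ^ 2 / 2))
      (Real.exp (-c * x ^ 2 / 2) * (-c * x)) x := fun x => by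
    have : HasDerivAt (fun u : ℝ => -c * u ^ 2 / 2) (-c * x) x := by
      refine (((hasDerivAt_pow 2 x).const_mul (-c)).div_const 2).congr_deriv ?_
      simp
      ring
    exact this.exp
  have hb : ∀ x : ℝ, ‖Real.exp (-c * x ^ 2 / 2) * (-c * x)‖ ≤ 1 := fun x => by
    have h1 : 1 + c * x ^ 2 / 2 ≤ Real.exp (c * x ^ 2 / 2) := by
      linarith [Real.add_one_le_exp (c * x ^ 2 / 2)]
    rw [norm_mul, Real.norm_eq_abs, Real.norm_eq_abs, Real.abs_exp,
      show -c * x ^ 2 / 2 = -(c * x ^ 2 / 2) by ring, Real.exp_neg, inv_mul_le_iff₀ (Real.exp_pos _),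
      mul_one]
    refine le_trans ?_ h1
    rw [neg_mul, abs_neg, abs_mul, abs_of_nonneg hc0, ← sq_abs x]
    nlinarith [mul_nonneg hc0 (sq_nonneg (|x| - 1))]
  have := Convex.norm_image_sub_le_of_norm_hasDerivWithin_le (s := Set.univ) (C := 1)
    (fun x _ => (hd x).hasDerivWithinAt) (fun x _ => hb x) convex_univ (Set.mem_univ v)
    (Set.mem_univ u)
  simpa using this

lemma sum_sq_transferKernel_le (N : ℕ) {u s : ℝ} (hu : 0 ≤ u) (hs : s ∈ Set.Icc (0 : ℝ) 1) :
    ∑ k ∈ Finset.range N, transferKernel k u s ^ 2 ≤ 10 * Real.sqrt N := by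
  refine le_trans (Finset.sum_le_sum fun k _ => ?_)
    (sum_sq_neg_half_le N (u := u * Real.sqrt s) (by positivity))
  rw [transferKernel, mul_pow]
  refine mul_le_of_le_one_right (sq_nonneg _) (pow_le_one₀ (Real.exp_pos _).le ?_)
  rw [Real.exp_le_one_iff]
  nlinarith [mul_nonneg (sub_nonneg.2 hs.2) (sq_nonneg u)]

lemma sum_sq_transferKernel_sub_le (N : ℕ) {u v s : ℝ} (hu : 0 ≤ u) (hv : 0 ≤ v)
    (hs : s ∈ Set.Icc (0 : ℝ) 1) :
    ∑ k ∈ Finset.range N, (transferKernel k u s - transferKernel k v s) ^ 2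
      ≤ 28 * (N * |u - v|) := by
  have hs1 : Real.sqrt s ≤ 1 := Real.sqrt_le_one.2 hs.2
  have he : ∀ w : ℝ, Real.exp (-(1 - s) * w ^ 2 / 2) ≤ 1 := fun w => by
    rw [Real.exp_le_one_iff]
    nlinarith [mul_nonneg (sub_nonneg.2 hs.2) (sq_nonneg w)]
  set E : ℝ → ℝ := fun w => Real.exp (-(1 - s) * w ^ 2 / 2) with hE
  have hE0 : ∀ w, 0 < E w := fun w => Real.exp_pos _
  -- The difference is at most both `1` and `|u - v|`, so its square is at most `|u - v|`, the same
  -- power as in the bound for the Hermite part.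
  have hEd : (E u - E v) ^ 2 ≤ |u - v| := by
    have h1 : |E u - E v| ≤ |u - v| :=
      abs_exp_sub_exp_le (sub_nonneg.2 hs.2) (by linarith [hs.1]) u v
    have h2 : |E u - E v| ≤ 1 := by
      rw [abs_le]; constructor <;> linarith [hE0 u, hE0 v, he u, he v]
    rw [← sq_abs]
    nlinarith [abs_nonneg (E u - E v)]
  have h1 := sum_sq_sub_neg_half_le N (u := u * Real.sqrt s) (v := v * Real.sqrt s)
    (by positivity) (by positivity)
  have h2 := sum_sq_neg_half_le N (u := v * Real.sqrt s) (by positivity)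
  have hN : Real.sqrt N ≤ N := by
    rcases Nat.eq_zero_or_pos N with rfl | hN
    · simp
    · rw [Real.sqrt_le_left (by positivity)]
      have : (1 : ℝ) ≤ N := by exact_mod_cast hN
      nlinarith
  calc ∑ k ∈ Finset.range N, (transferKernel k u s - transferKernel k v s) ^ 2
      ≤ ∑ k ∈ Finset.range N, (2 * (laguerreFun1 (-1 / 2) k (u * Real.sqrt s)
          - laguerreFun1 (-1 / 2) k (v * Real.sqrt s)) ^ 2
          + 2 * (laguerreFun1 (-1 / 2) k (v * Real.sqrt s) ^ 2 * |u - v|)) := by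
        refine Finset.sum_le_sum fun k _ => ?_
        set p := laguerreFun1 (-1 / 2) k (u * Real.sqrt s)
        set q := laguerreFun1 (-1 / 2) k (v * Real.sqrt s)
        have e : transferKernel k u s - transferKernel k v s = (p - q) * E u + q * (E u - E v) := by
          simp only [transferKernel, hE, p, q]; ring
        rw [e]
        have i1 : ((p - q) * E u) ^ 2 ≤ (p - q) ^ 2 := by
          rw [mul_pow]
          exact mul_le_of_le_one_right (sq_nonneg _) (pow_le_one₀ (hE0 u).le (he u))
        have i2 : (q * (E u - E v)) ^ 2 ≤ q ^ 2 * |u - v| := by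
          rw [mul_pow]; exact mul_le_mul_of_nonneg_left hEd (sq_nonneg _)
        nlinarith [sq_nonneg ((p - q) * E u - q * (E u - E v))]
    _ = 2 * ∑ k ∈ Finset.range N, (laguerreFun1 (-1 / 2) k (u * Real.sqrt s)
          - laguerreFun1 (-1 / 2) k (v * Real.sqrt s)) ^ 2
        + 2 * ((∑ k ∈ Finset.range N, laguerreFun1 (-1 / 2) k (v * Real.sqrt s) ^ 2) * |u - v|) := by
        rw [Finset.sum_add_distrib, ← Finset.mul_sum, ← Finset.mul_sum, Finset.sum_mul]
    _ ≤ 2 * (4 * N * |u - v|) + 2 * (10 * N * |u - v|) := by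
        gcongr
        · refine h1.trans (mul_le_mul_of_nonneg_left ?_ (by positivity))
          rw [← sub_mul, abs_mul, abs_of_nonneg (Real.sqrt_nonneg s)]
          exact mul_le_of_le_one_right (abs_nonneg _) hs1
        · exact h2.trans (by linarith)
    _ = _ := by ring

/-- Jensen moves the square inside the average; the sum over `k` is then bounded for each `s`,
uniformly over the support of `β`. -/
lemma sum_sq_integral_le {β : Measure ℝ} [IsProbabilityMeasure β]
    (hβ : β.restrict (Set.Icc 0 1) = β) (N : ℕ) {f : ℕ → ℝ → ℝ} (hf : ∀ k, Continuous (f k))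
    {R : ℕ → ℝ} {T B : ℝ} (hT : 0 ≤ T) (hR : ∀ k < N, R k ^ 2 ≤ T)
    (hB : ∀ s ∈ Set.Icc (0 : ℝ) 1, ∑ k ∈ Finset.range N, f k s ^ 2 ≤ B) :
    ∑ k ∈ Finset.range N, (R k * ∫ s, f k s ∂β) ^ 2 ≤ T * B := by
  calc ∑ k ∈ Finset.range N, (R k * ∫ s, f k s ∂β) ^ 2
      ≤ ∑ k ∈ Finset.range N, T * ∫ s, f k s ^ 2 ∂β := by
        refine Finset.sum_le_sum fun k hk => ?_
        rw [mul_pow]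
        exact mul_le_mul (hR k (Finset.mem_range.1 hk)) (sq_integral_le hβ (hf k))
          (sq_nonneg _) hT
    _ = T * ∫ s, ∑ k ∈ Finset.range N, f k s ^ 2 ∂β := by
        have h2 : ∀ k, Integrable (fun s => f k s ^ 2) β := fun k =>
          integrable_of_continuous_of_restrict hβ ((hf k).pow 2)
        rw [integral_finsetSum _ fun k _ => h2 k, Finset.mul_sum]
    _ ≤ T * ∫ s, B ∂β := by
        refine mul_le_mul_of_nonneg_left ?_ hT
        rw [← hβ]
        refine setIntegral_mono_on ?_ ?_ measurableSet_Icc hB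
        · exact Continuous.integrableOn_Icc (by fun_prop)
        · exact continuous_const.integrableOn_Icc
    _ = T * B := by simp

/-- Kernel bounds for the one-dimensional Laguerre functions, on the diagonal and for
differences. -/
lemma exists_kernel_bounds {a : ℝ} (ha : -1 / 2 ≤ a) : ∃ C : ℝ, 0 < C ∧ ∀ N : ℕ,
    (∀ u : ℝ, 0 ≤ u → ∑ k ∈ Finset.range N, laguerreFun1 a k u ^ 2 ≤ C * (N : ℝ) ^ (a + 1)) ∧
    ∀ u v : ℝ, 0 ≤ u → 0 ≤ v →
      ∑ k ∈ Finset.range N, (laguerreFun1 a k u - laguerreFun1 a k v) ^ 2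
        ≤ C * (N : ℝ) ^ (a + 1) * (Real.sqrt N * |u - v|) := by
  obtain ⟨β, hβp, hβ, hmom⟩ := exists_transfer_measure ha
  obtain ⟨C, hC, hCG⟩ := Gamma_add_le (b := a + 1 / 2) (by linarith)
  set D := (Real.Gamma (1 / 2) / Real.Gamma (a + 1)) ^ 2 with hD
  have hD0 : 0 < D := by
    have h1 : 0 < Real.Gamma (1 / 2) := Real.Gamma_pos_of_pos (by norm_num)
    have h2 : 0 < Real.Gamma (a + 1) := Real.Gamma_pos_of_pos (by linarith)
    positivity
  refine ⟨28 * (C * D), by positivity, fun N => ?_⟩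
  rcases Nat.eq_zero_or_pos N with rfl | hN
  · simp only [Finset.range_zero, Finset.sum_empty]
    exact ⟨fun _ _ => by positivity, fun _ _ _ _ => by positivity⟩
  have hN0 : (0 : ℝ) < N := by exact_mod_cast hN
  set R : ℕ → ℝ := fun k => Real.sqrt (Real.Gamma (k + a + 1) / Real.Gamma (k + 1 / 2)) *
      (Real.Gamma (1 / 2) / Real.Gamma (a + 1)) with hRd
  have hrep : ∀ k u, laguerreFun1 a k u = R k * ∫ s, transferKernel k u s ∂β :=
    fun k u => laguerreFun1_eq_integral ha hβ hmom k u
  have hR : ∀ k < N, R k ^ 2 ≤ C * (N : ℝ) ^ (a + 1 / 2) * D := by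
    intro k hk
    have hk0 : (0 : ℝ) ≤ k := k.cast_nonneg
    have p1 : 0 < Real.Gamma (k + 1 / 2) := Real.Gamma_pos_of_pos (by positivity)
    have p2 : 0 < Real.Gamma (k + a + 1) := Real.Gamma_pos_of_pos (by linarith)
    have hk1 : ((k + 1 : ℕ) : ℝ) ≤ N := Nat.cast_le.2 hk
    push_cast at hk1
    rw [hRd]
    dsimp only
    rw [mul_pow, Real.sq_sqrt (by positivity), ← hD]
    refine mul_le_mul_of_nonneg_right ?_ hD0.le
    rw [div_le_iff₀ p1]
    have := hCG (k + 1 / 2) (by linarith)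
    rw [show (k : ℝ) + 1 / 2 + (a + 1 / 2) = k + a + 1 by ring] at this
    refine this.trans (mul_le_mul_of_nonneg_right (mul_le_mul_of_nonneg_left ?_ hC.le) p1.le)
    exact Real.rpow_le_rpow (by positivity) (by linarith) (by linarith)
  have hT : 0 ≤ C * (N : ℝ) ^ (a + 1 / 2) * D := by positivity
  -- The Gamma ratio in `R k ^ 2` accounts for `N^{a+1/2}`, the kernel of order `-1/2` for the
  -- remaining `√N`.
  have eN : (N : ℝ) ^ (a + 1) = (N : ℝ) ^ (a + 1 / 2) * Real.sqrt N := by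
    rw [Real.sqrt_eq_rpow, ← Real.rpow_add hN0]; ring_nf
  refine ⟨fun u hu => ?_, fun u v hu hv => ?_⟩
  · simp_rw [hrep]
    refine (sum_sq_integral_le hβ N (fun k => continuous_transferKernel k u) hT hR
      fun s hs => sum_sq_transferKernel_le N hu hs).trans ?_
    rw [eN]
    have : 0 ≤ C * (N : ℝ) ^ (a + 1 / 2) * D * Real.sqrt N := by positivity
    linarith
  · have e : ∀ k, laguerreFun1 a k u - laguerreFun1 a k v
        = R k * ∫ s, (transferKernel k u s - transferKernel k v s) ∂β := fun k => by
      rw [integral_sub (integrable_of_continuous_of_restrict hβ (continuous_transferKernel k u))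
        (integrable_of_continuous_of_restrict hβ (continuous_transferKernel k v)), mul_sub,
        hrep, hrep]
    simp_rw [e]
    refine (sum_sq_integral_le hβ N
      (fun k => (continuous_transferKernel k u).sub (continuous_transferKernel k v)) hT hR
      fun s hs => sum_sq_transferKernel_sub_le N hu hv hs).trans (le_of_eq ?_)
    rw [eN]
    have : (N : ℝ) = Real.sqrt N * Real.sqrt N := (Real.mul_self_sqrt hN0.le).symm
    linear_combination (28 * C * (N : ℝ) ^ (a + 1 / 2) * D * |u - v|) * this

/-! ### Several variables: the measure and sums over cubes of indices. -/

section

variable {d : ℕ}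

lemma measurableSet_orthant (d : ℕ) : MeasurableSet (orthant d) := by
  have : orthant d = ⋂ i, {x : EuclideanSpace ℝ (Fin d) | 0 < x i} := by ext x; simp [orthant]
  rw [this]
  exact MeasurableSet.iInter fun i => measurableSet_lt measurable_const (by fun_prop)

lemma measurable_density (α : Fin d → ℝ) : Measurable
    fun x : EuclideanSpace ℝ (Fin d) => ENNReal.ofReal (∏ i, x i ^ (2 * α i + 1)) := by
  fun_prop

lemma density_nonneg (α : Fin d → ℝ) {x : EuclideanSpace ℝ (Fin d)} (hx : x ∈ orthant d) :
    0 ≤ ∏ i, x i ^ (2 * α i + 1) :=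
  Finset.prod_nonneg fun i _ => Real.rpow_nonneg (hx i).le _

lemma laguerreMeasure_apply (α : Fin d → ℝ) {s : Set (EuclideanSpace ℝ (Fin d))}
    (hs : MeasurableSet s) : laguerreMeasure α s =
      ∫⁻ x in s ∩ orthant d, ENNReal.ofReal (∏ i, x i ^ (2 * α i + 1)) := by
  rw [laguerreMeasure, withDensity_apply _ hs, Measure.restrict_restrict hs]

lemma ae_mem_orthant (α : Fin d → ℝ) : ∀ᵐ x ∂(laguerreMeasure α), x ∈ orthant d := by
  refine (withDensity_absolutelyContinuous _ _).ae_le ?_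
  exact ae_restrict_mem (measurableSet_orthant d)

lemma integral_prod_laguerreMeasure (α : Fin d → ℝ) (f : Fin d → ℝ → ℝ) :
    ∫ x, ∏ i, f i (x i) ∂(laguerreMeasure α)
      = ∏ i, ∫ u in Set.Ioi (0 : ℝ), f i u * u ^ (2 * α i + 1) := by
  rw [laguerreMeasure, integral_withDensity_eq_integral_toReal_smul (measurable_density α)
    (Eventually.of_forall fun x => ENNReal.ofReal_lt_top), ← integral_indicator
    (measurableSet_orthant d)]
  have h : ∀ x : EuclideanSpace ℝ (Fin d), (orthant d).indicator (fun x =>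
      (ENNReal.ofReal (∏ i, x i ^ (2 * α i + 1))).toReal • ∏ i, f i (x i)) x
      = ∏ i, (Set.Ioi (0 : ℝ)).indicator (fun u => f i u * u ^ (2 * α i + 1)) (x.ofLp i) := by
    intro x
    by_cases hx : x ∈ orthant d
    · rw [Set.indicator_of_mem hx, ENNReal.toReal_ofReal (density_nonneg α hx), smul_eq_mul,
        mul_comm, ← Finset.prod_mul_distrib]
      exact Finset.prod_congr rfl fun i _ => (Set.indicator_of_mem (Set.mem_Ioi.2 (hx i))
        (fun u => f i u * u ^ (2 * α i + 1))).symm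
    · rw [Set.indicator_of_notMem hx]
      have : ∃ i, ¬ 0 < x i := by simpa [orthant] using hx
      obtain ⟨i, hi⟩ := this
      exact (Finset.prod_eq_zero (Finset.mem_univ i) (Set.indicator_of_notMem hi _)).symm
  simp_rw [h]
  have := (PiLp.volume_preserving_ofLp (Fin d)).integral_comp
    (MeasurableEquiv.toLp 2 (Fin d → ℝ)).symm.measurableEmbedding
    (fun y : Fin d → ℝ => ∏ i, (Set.Ioi (0 : ℝ)).indicator (fun u => f i u * u ^ (2 * α i + 1)) (y i))
  rw [this, integral_fintype_prod_volume_eq_prod]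
  exact Finset.prod_congr rfl fun i _ => integral_indicator measurableSet_Ioi

lemma continuous_laguerreFun (α : Fin d → ℝ) (n : Fin d → ℕ) : Continuous (laguerreFun α n) := by
  have := fun i => continuous_laguerreFun1 (α i) (n i)
  unfold laguerreFun
  fun_prop

lemma integral_laguerreFun_mul {α : Fin d → ℝ} (hα : ∀ i, -1 / 2 ≤ α i) (n m : Fin d → ℕ) :
    ∫ x, laguerreFun α n x * laguerreFun α m x ∂(laguerreMeasure α) = if n = m then 1 else 0 := by
  simp_rw [laguerreFun, ← Finset.prod_mul_distrib]
  rw [integral_prod_laguerreMeasure α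
    (fun i u => laguerreFun1 (α i) (n i) u * laguerreFun1 (α i) (m i) u)]
  simp_rw [integral_laguerreFun1_mul (lt_of_lt_of_le (by norm_num) (hα _))]
  rw [Finset.prod_ite_zero]
  simp [funext_iff]

/-- The square of one function is a single term of the diagonal kernel sum. The resulting
boundedness makes coefficients continuous on `L¹`. -/
lemma exists_abs_laguerreFun_le {α : Fin d → ℝ} (hα : ∀ i, -1 / 2 ≤ α i) (n : Fin d → ℕ) :
    ∃ C : ℝ, 0 ≤ C ∧ ∀ x ∈ orthant d, |laguerreFun α n x| ≤ C := by
  have : ∀ i, ∃ C : ℝ, 0 ≤ C ∧ ∀ u : ℝ, 0 ≤ u → |laguerreFun1 (α i) (n i) u| ≤ C := by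
    intro i
    obtain ⟨C, hC, h⟩ := exists_kernel_bounds (hα i)
    refine ⟨_, Real.sqrt_nonneg (C * ((n i + 1 : ℕ) : ℝ) ^ (α i + 1)), fun u hu => ?_⟩
    refine Real.abs_le_sqrt (le_trans ?_ ((h (n i + 1)).1 u hu))
    exact Finset.single_le_sum (f := fun k => laguerreFun1 (α i) k u ^ 2)
      (fun k _ => sq_nonneg _) (Finset.self_mem_range_succ (n i))
  choose C hC h using this
  refine ⟨∏ i, C i, Finset.prod_nonneg fun i _ => hC i, fun x hx => ?_⟩
  rw [laguerreFun, Finset.abs_prod]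
  exact Finset.prod_le_prod (fun i _ => abs_nonneg _) fun i _ => h i _ (hx i).le

lemma abs_prod_sub_prod_le {ι : Type*} (s : Finset ι) {a b A : ι → ℝ} {η : ℝ} (hη : 0 ≤ η)
    (ha : ∀ i, |a i| ≤ A i) (hb : ∀ i, |b i| ≤ A i) (hab : ∀ i, |a i - b i| ≤ A i * η) :
    |∏ i ∈ s, a i - ∏ i ∈ s, b i| ≤ s.card * η * ∏ i ∈ s, A i := by
  classical
  have hA : ∀ i, 0 ≤ A i := fun i => (abs_nonneg _).trans (ha i)
  induction s using Finset.induction_on with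
  | empty => simp
  | insert i s hi ih =>
    rw [Finset.prod_insert hi, Finset.prod_insert hi, Finset.prod_insert hi,
      Finset.card_insert_of_notMem hi]
    have hP : |∏ i ∈ s, a i| ≤ ∏ i ∈ s, A i := by
      rw [Finset.abs_prod]; exact Finset.prod_le_prod (fun i _ => abs_nonneg _) fun i _ => ha i
    calc |a i * ∏ i ∈ s, a i - b i * ∏ i ∈ s, b i|
        = |(a i - b i) * ∏ i ∈ s, a i + b i * (∏ i ∈ s, a i - ∏ i ∈ s, b i)| := by ring_nf
      _ ≤ |a i - b i| * |∏ i ∈ s, a i| + |b i| * |∏ i ∈ s, a i - ∏ i ∈ s, b i| := by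
        rw [← abs_mul, ← abs_mul]; exact abs_add_le _ _
      _ ≤ (A i * η) * ∏ i ∈ s, A i + A i * (s.card * η * ∏ i ∈ s, A i) := by
        refine add_le_add (mul_le_mul (hab i) hP (abs_nonneg _) (mul_nonneg (hA i) hη))
          (mul_le_mul (hb i) ih (abs_nonneg _) (hA i))
      _ = _ := by push_cast; ring

/-- The cube `{0,…,N-1}^d` of multi-indices. -/
def cube (d N : ℕ) : Finset (Fin d → ℕ) := Fintype.piFinset fun _ => Finset.range N

lemma card_cube (d N : ℕ) : (cube d N).card = N ^ d := by simp [cube]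

/-- Expanding the square gives `∏K_ff - 2∏K_fg + ∏K_gg` with one-variable kernels `K`. By
Cauchy–Schwarz each kernel is at most `A i` and differs from `K_fg` by at most `A i * η`, so
telescoping the products gains one factor `η`, not `η²`. -/
lemma sum_cube_sq_sub_le {f g : Fin d → ℕ → ℝ} {A : Fin d → ℝ} {N : ℕ} {η : ℝ} (hη : 0 ≤ η)
    (hf : ∀ i, ∑ k ∈ Finset.range N, f i k ^ 2 ≤ A i)
    (hg : ∀ i, ∑ k ∈ Finset.range N, g i k ^ 2 ≤ A i)
    (hfg : ∀ i, ∑ k ∈ Finset.range N, (f i k - g i k) ^ 2 ≤ A i * η ^ 2) :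
    ∑ n ∈ cube d N, (∏ i, f i (n i) - ∏ i, g i (n i)) ^ 2 ≤ 2 * d * η * ∏ i, A i := by
  have hA : ∀ i, 0 ≤ A i := fun i => (Finset.sum_nonneg fun k _ => sq_nonneg _).trans (hf i)
  have cs : ∀ (p q : ℕ → ℝ) (P Q : ℝ), 0 ≤ P → 0 ≤ Q → ∑ k ∈ Finset.range N, p k ^ 2 ≤ P ^ 2 →
      ∑ k ∈ Finset.range N, q k ^ 2 ≤ Q ^ 2 → |∑ k ∈ Finset.range N, p k * q k| ≤ P * Q := by
    intro p q P Q hP hQ hp hq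
    refine abs_le_of_sq_le_sq ?_ (mul_nonneg hP hQ)
    refine (Finset.sum_mul_sq_le_sq_mul_sq _ _ _).trans ?_
    rw [mul_pow]
    exact mul_le_mul hp hq (Finset.sum_nonneg fun k _ => sq_nonneg _) (sq_nonneg _)
  have hs : ∀ i, Real.sqrt (A i) ^ 2 = A i := fun i => Real.sq_sqrt (hA i)
  have hs' : ∀ i, Real.sqrt (A i) * Real.sqrt (A i) = A i := fun i => Real.mul_self_sqrt (hA i)
  have hsd : ∀ i, (Real.sqrt (A i) * η) ^ 2 = A i * η ^ 2 := fun i => by rw [mul_pow, hs]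
  have kff : ∀ i, |∑ k ∈ Finset.range N, f i k * f i k| ≤ A i := fun i => by
    rw [← hs' i]; exact cs _ _ _ _ (by positivity) (by positivity) (by simpa [hs] using hf i)
      (by simpa [hs] using hf i)
  have kgg : ∀ i, |∑ k ∈ Finset.range N, g i k * g i k| ≤ A i := fun i => by
    rw [← hs' i]; exact cs _ _ _ _ (by positivity) (by positivity) (by simpa [hs] using hg i)
      (by simpa [hs] using hg i)
  have kfg : ∀ i, |∑ k ∈ Finset.range N, f i k * g i k| ≤ A i := fun i => by
    rw [← hs' i]; exact cs _ _ _ _ (by positivity) (by positivity) (by simpa [hs] using hf i)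
      (by simpa [hs] using hg i)
  have dff : ∀ i, |∑ k ∈ Finset.range N, f i k * f i k - ∑ k ∈ Finset.range N, f i k * g i k|
      ≤ A i * η := fun i => by
    rw [← Finset.sum_sub_distrib, ← hs' i, mul_assoc]
    simp_rw [← mul_sub]
    exact cs _ _ _ _ (by positivity) (by positivity) (by simpa [hs] using hf i)
      (by rw [hsd]; exact hfg i)
  have dgg : ∀ i, |∑ k ∈ Finset.range N, g i k * g i k - ∑ k ∈ Finset.range N, f i k * g i k|
      ≤ A i * η := fun i => by
    rw [abs_sub_comm, ← Finset.sum_sub_distrib, ← hs' i, mul_assoc]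
    simp_rw [← sub_mul, mul_comm (_ - _ : ℝ)]
    exact cs _ _ _ _ (by positivity) (by positivity) (by simpa [hs] using hg i)
      (by rw [hsd]; exact hfg i)
  have h1 := abs_prod_sub_prod_le Finset.univ hη kff kfg dff
  have h2 := abs_prod_sub_prod_le Finset.univ hη kgg kfg dgg
  rw [Finset.card_univ, Fintype.card_fin] at h1 h2
  have e : ∑ n ∈ cube d N, (∏ i, f i (n i) - ∏ i, g i (n i)) ^ 2
      = (∏ i, ∑ k ∈ Finset.range N, f i k * f i k - ∏ i, ∑ k ∈ Finset.range N, f i k * g i k)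
      + (∏ i, ∑ k ∈ Finset.range N, g i k * g i k
        - ∏ i, ∑ k ∈ Finset.range N, f i k * g i k) := by
    simp_rw [Finset.prod_univ_sum, Finset.prod_mul_distrib]
    rw [← Finset.sum_sub_distrib, ← Finset.sum_sub_distrib, ← Finset.sum_add_distrib]
    exact Finset.sum_congr rfl fun n _ => by ring
  rw [e]
  linarith [(abs_le.1 h1).2, (abs_le.1 h2).2]

lemma prod_rpow_add_one (α : Fin d → ℝ) {N : ℝ} (hN : 0 < N) :
    ∏ i, N ^ (α i + 1) = N ^ ((d : ℝ) + ∑ i, α i) := by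
  rw [← Real.rpow_sum_of_pos hN, Finset.sum_add_distrib]
  simp [add_comm]

/-- The volume of a ball of radius `ρ` near the origin scales as `(ρ²)^Q`; this form pairs with
`N^Q`, so that only `Nρ²` matters later. -/
lemma prod_rpow_mul_prod (α : Fin d → ℝ) {h : ℝ} (hh : 0 < h) :
    (∏ i, h ^ (2 * α i + 1)) * ∏ _i : Fin d, h = (h ^ 2) ^ ((d : ℝ) + ∑ i, α i) := by
  rw [← prod_rpow_add_one α (by positivity), ← Finset.prod_mul_distrib]
  refine Finset.prod_congr rfl fun i _ => ?_
  rw [← Real.rpow_natCast, ← Real.rpow_mul hh.le]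
  nth_rewrite 2 [← Real.rpow_one h]
  rw [← Real.rpow_add hh]
  congr 1
  push_cast
  ring

/-- Square-sum bound for differences of the multi-dimensional Laguerre functions. -/
lemma exists_sum_cube_sub_bound {α : Fin d → ℝ} (hα : ∀ i, -1 / 2 ≤ α i) :
    ∃ C : ℝ, 0 < C ∧ ∀ N : ℕ, 0 < N → ∀ x ∈ orthant d, ∀ y ∈ orthant d,
      ∑ n ∈ cube d N, (laguerreFun α n x - laguerreFun α n y) ^ 2
        ≤ C * (N : ℝ) ^ ((d : ℝ) + ∑ i, α i) * Real.sqrt (Real.sqrt N * dist x y) := by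
  choose C hC h using fun i => exists_kernel_bounds (hα i)
  have hCp : 0 < ∏ i, C i := Finset.prod_pos fun i _ => hC i
  refine ⟨(2 * d + 1) * ∏ i, C i, by positivity, fun N hN x hx y hy => ?_⟩
  have hN0 : (0 : ℝ) < N := by exact_mod_cast hN
  -- The one-variable difference bound carries `√N |x_i - y_i|`, which plays the role of `η²`; hence
  -- the nested square root.
  have key := sum_cube_sq_sub_le (N := N) (η := Real.sqrt (Real.sqrt N * dist x y))
    (A := fun i => C i * (N : ℝ) ^ (α i + 1)) (Real.sqrt_nonneg _)
    (f := fun i k => laguerreFun1 (α i) k (x i)) (g := fun i k => laguerreFun1 (α i) k (y i))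
    (fun i => (h i N).1 _ (hx i).le) (fun i => (h i N).1 _ (hy i).le) (fun i => by
      refine ((h i N).2 _ _ (hx i).le (hy i).le).trans ?_
      rw [Real.sq_sqrt (by positivity)]
      have : |x i - y i| ≤ dist x y := by
        rw [dist_eq_norm, ← Real.norm_eq_abs]
        exact PiLp.norm_apply_le (x - y) i
      have := hC i
      gcongr)
  refine key.trans ?_
  rw [Finset.prod_mul_distrib, prod_rpow_add_one α hN0]
  have : 0 ≤ (∏ i, C i) * (N : ℝ) ^ ((d : ℝ) + ∑ i, α i) * Real.sqrt (Real.sqrt N * dist x y) := by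
    positivity
  nlinarith

end

/-! ### Measure of balls, Bessel's inequality and the size estimate. -/

section

variable {d : ℕ}

/-- Lower bound `μ_α(B(x₀,ρ)) ≥ c ρ^{2(d+|α|)}`. -/
lemma exists_measure_ball_ge {α : Fin d → ℝ} (hd : 1 ≤ d) (hα : ∀ i, -1 / 2 ≤ α i) :
    ∃ c : ℝ, 0 < c ∧ ∀ x₀ ∈ orthant d, ∀ ρ : ℝ, 0 < ρ →
      ENNReal.ofReal (c * (ρ ^ 2) ^ ((d : ℝ) + ∑ i, α i)) ≤
        laguerreMeasure α (Metric.ball x₀ ρ) := by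
  have hd0 : (0 : ℝ) < d := by exact_mod_cast hd
  have hd1 : (1 : ℝ) ≤ d := by exact_mod_cast hd
  refine ⟨((1 / (2 * d)) ^ 2 : ℝ) ^ ((d : ℝ) + ∑ i, α i), by positivity, fun x₀ hx₀ ρ hρ => ?_⟩
  -- The box with sides `(x₀ i + h, x₀ i + 2h)` lies in the ball, because `d (2h)² = ρ²/d ≤ ρ²`, and
  -- keeps distance `h` from the coordinate hyperplanes, where the density may vanish.
  set h := ρ / (2 * d) with hh
  have hh0 : 0 < h := by positivity
  have e : ((1 / (2 * d)) ^ 2 : ℝ) ^ ((d : ℝ) + ∑ i, α i) * (ρ ^ 2) ^ ((d : ℝ) + ∑ i, α i)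
      = (∏ i, h ^ (2 * α i + 1)) * ∏ _i : Fin d, h := by
    rw [← Real.mul_rpow (by positivity) (by positivity), ← mul_pow,
      show 1 / (2 * (d : ℝ)) * ρ = h by rw [hh]; ring, prod_rpow_mul_prod α hh0]
  set S : Set (EuclideanSpace ℝ (Fin d)) :=
    {x | ∀ i, x i ∈ Set.Ioo (x₀ i + h) (x₀ i + 2 * h)} with hS
  have hSe : S = (MeasurableEquiv.toLp 2 (Fin d → ℝ)).symm ⁻¹'
      (Set.univ.pi fun i => Set.Ioo (x₀ i + h) (x₀ i + 2 * h)) := by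
    ext x; simp [hS]
  have hSm : MeasurableSet S := by
    rw [hSe]
    exact (MeasurableSet.univ_pi fun i => measurableSet_Ioo).preimage (MeasurableEquiv.measurable _)
  have hvol : volume S = ∏ _i : Fin d, ENNReal.ofReal h := by
    rw [hSe]
    have := (PiLp.volume_preserving_ofLp (Fin d)).measure_preimage
      (s := Set.univ.pi fun i => Set.Ioo (x₀ i + h) (x₀ i + 2 * h))
      (MeasurableSet.univ_pi fun i => measurableSet_Ioo).nullMeasurableSet
    refine this.trans ?_
    rw [volume_pi_pi]
    refine Finset.prod_congr rfl fun i _ => ?_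
    rw [Real.volume_Ioo]
    congr 1; ring
  have hSo : S ⊆ orthant d := fun x hx i => by have := (hx i).1; have := hx₀ i; linarith
  have hSb : S ⊆ Metric.ball x₀ ρ := fun x hx => by
    rw [Metric.mem_ball, EuclideanSpace.dist_eq, Real.sqrt_lt' hρ]
    have : Nonempty (Fin d) := ⟨⟨0, hd⟩⟩
    calc ∑ i, dist (x i) (x₀ i) ^ 2 < ∑ _i : Fin d, (2 * h) ^ 2 := by
          refine Finset.sum_lt_sum_of_nonempty Finset.univ_nonempty fun i _ => ?_
          have := hx i
          rw [Real.dist_eq, sq_abs]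
          nlinarith [this.1, this.2]
      _ = ρ ^ 2 / d := by
          simp only [Finset.sum_const, Finset.card_univ, Fintype.card_fin, nsmul_eq_mul, hh]
          field_simp
      _ ≤ ρ ^ 2 := div_le_self (by positivity) hd1
  calc ENNReal.ofReal (((1 / (2 * d)) ^ 2 : ℝ) ^ ((d : ℝ) + ∑ i, α i)
        * (ρ ^ 2) ^ ((d : ℝ) + ∑ i, α i))
      = ENNReal.ofReal (∏ i, h ^ (2 * α i + 1)) * volume S := by
        rw [e, ENNReal.ofReal_mul (by positivity), hvol, ENNReal.ofReal_prod_of_nonneg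
          (f := fun _ : Fin d => h) (fun _ _ => hh0.le)]
    _ = ∫⁻ _ in S, ENNReal.ofReal (∏ i, h ^ (2 * α i + 1)) := by
        rw [setLIntegral_const]
    _ ≤ ∫⁻ x in S, ENNReal.ofReal (∏ i, x i ^ (2 * α i + 1)) := by
        refine setLIntegral_mono (measurable_density α) fun x hx => ?_
        refine ENNReal.ofReal_le_ofReal (Finset.prod_le_prod (fun i _ => by positivity)
          fun i _ => ?_)
        refine Real.rpow_le_rpow hh0.le ?_ (by linarith [hα i])
        have := (hx i).1; have := hx₀ i; linarith
    _ = laguerreMeasure α S := by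
        rw [laguerreMeasure_apply α hSm, Set.inter_eq_left.2 hSo]
    _ ≤ _ := measure_mono hSb

lemma measure_ball_le {α : Fin d → ℝ} (hα : ∀ i, -1 / 2 ≤ α i)
    (x₀ : EuclideanSpace ℝ (Fin d)) (ρ : ℝ) :
    laguerreMeasure α (Metric.ball x₀ ρ) ≤
      ENNReal.ofReal (∏ i, (|x₀ i| + ρ) ^ (2 * α i + 1)) * volume (Metric.ball x₀ ρ) := by
  rw [laguerreMeasure_apply α Metric.isOpen_ball.measurableSet]
  calc ∫⁻ x in Metric.ball x₀ ρ ∩ orthant d, ENNReal.ofReal (∏ i, x i ^ (2 * α i + 1))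
      ≤ ∫⁻ _ in Metric.ball x₀ ρ ∩ orthant d,
          ENNReal.ofReal (∏ i, (|x₀ i| + ρ) ^ (2 * α i + 1)) := by
        refine setLIntegral_mono measurable_const fun x hx => ?_
        refine ENNReal.ofReal_le_ofReal (Finset.prod_le_prod
          (fun i _ => Real.rpow_nonneg (hx.2 i).le _) fun i _ => ?_)
        refine Real.rpow_le_rpow (hx.2 i).le ?_ (by linarith [hα i])
        have h1 : |x i - x₀ i| ≤ dist x x₀ := by
          rw [dist_eq_norm, ← Real.norm_eq_abs]
          exact PiLp.norm_apply_le (x - x₀) i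
        have h2 := Metric.mem_ball.1 hx.1
        linarith [le_abs_self (x i - x₀ i), le_abs_self (x₀ i)]
    _ ≤ _ := by
        rw [setLIntegral_const]
        exact mul_le_mul_right (measure_mono Set.inter_subset_left) _

lemma measure_ball_lt_top {α : Fin d → ℝ} (hα : ∀ i, -1 / 2 ≤ α i)
    (x₀ : EuclideanSpace ℝ (Fin d)) (ρ : ℝ) : laguerreMeasure α (Metric.ball x₀ ρ) < ⊤ :=
  (measure_ball_le hα x₀ ρ).trans_lt (ENNReal.mul_lt_top ENNReal.ofReal_lt_top MeasureTheory.measure_ball_lt_top)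

section Coefficients

variable {𝕜 : Type*} [RCLike 𝕜]

lemma integrable_mul_laguerreFun {α : Fin d → ℝ} (hα : ∀ i, -1 / 2 ≤ α i) (n : Fin d → ℕ)
    {f : EuclideanSpace ℝ (Fin d) → 𝕜} (hf : Integrable f (laguerreMeasure α)) :
    Integrable (fun x => f x * (laguerreFun α n x : 𝕜)) (laguerreMeasure α) := by
  obtain ⟨C, -, hC⟩ := exists_abs_laguerreFun_le hα n
  refine hf.mul_bdd (c := C) ?_ ?_
  · exact (RCLike.continuous_ofReal.comp (continuous_laguerreFun α n)).aestronglyMeasurable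
  · filter_upwards [ae_mem_orthant α] with x hx
    rw [RCLike.norm_ofReal]
    exact hC x hx

lemma memLp_laguerreFun {α : Fin d → ℝ} (hα : ∀ i, -1 / 2 ≤ α i) (n : Fin d → ℕ) :
    MemLp (fun x => (laguerreFun α n x : 𝕜)) 2 (laguerreMeasure α) := by
  have h1 : Integrable (fun x => laguerreFun α n x * laguerreFun α n x) (laguerreMeasure α) := by
    by_contra h
    have := integral_laguerreFun_mul hα n n
    rw [integral_undef h] at this
    simp at this
  refine (memLp_two_iff_integrable_sq_norm ?_).2 ?_
  · exact (RCLike.continuous_ofReal.comp (continuous_laguerreFun α n)).aestronglyMeasurable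
  · refine h1.congr (Eventually.of_forall fun x => ?_)
    simp only [RCLike.norm_ofReal, sq_abs]
    ring

/-- Bessel's inequality for Laguerre coefficients. -/
lemma sum_norm_laguerreCoeff_sq_le {α : Fin d → ℝ} (hα : ∀ i, -1 / 2 ≤ α i)
    {f : EuclideanSpace ℝ (Fin d) → 𝕜} (hf : MemLp f 2 (laguerreMeasure α))
    (F : Finset (Fin d → ℕ)) :
    ∑ n ∈ F, ‖laguerreCoeff α f n‖ ^ 2 ≤ (eLpNorm f 2 (laguerreMeasure α)).toReal ^ 2 := by
  set v : (Fin d → ℕ) → Lp 𝕜 2 (laguerreMeasure α) := fun n => (memLp_laguerreFun hα n).toLp _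
  have hv : Orthonormal 𝕜 v := by
    classical
    rw [orthonormal_iff_ite]
    intro n m
    rw [L2.inner_def]
    have e : ∫ x, inner 𝕜 (v n x) (v m x) ∂(laguerreMeasure α)
        = ∫ x, ((laguerreFun α n x * laguerreFun α m x : ℝ) : 𝕜) ∂(laguerreMeasure α) := by
      refine integral_congr_ae ?_
      filter_upwards [(memLp_laguerreFun (𝕜 := 𝕜) hα n).coeFn_toLp,
        (memLp_laguerreFun (𝕜 := 𝕜) hα m).coeFn_toLp] with x h1 h2
      rw [h1, h2, RCLike.inner_apply, RCLike.conj_ofReal]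
      push_cast
      ring
    rw [e, integral_ofReal, integral_laguerreFun_mul hα]
    split_ifs <;> simp
  have hb := hv.sum_inner_products_le (s := F) (hf.toLp f)
  rw [Lp.norm_toLp] at hb
  refine le_trans (le_of_eq (Finset.sum_congr rfl fun n _ => ?_)) hb
  congr 2
  rw [L2.inner_def, laguerreCoeff]
  refine integral_congr_ae ?_
  filter_upwards [(memLp_laguerreFun (𝕜 := 𝕜) hα n).coeFn_toLp, hf.coeFn_toLp] with x h1 h2
  rw [h1, h2, RCLike.inner_apply, RCLike.conj_ofReal]

/-- Cauchy–Schwarz over the `N^d` indices of the cube, then Bessel. It serves for atoms of large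
radius, and for the first bump in the sharpness proof. -/
lemma sum_norm_laguerreCoeff_le {α : Fin d → ℝ} (hα : ∀ i, -1 / 2 ≤ α i)
    {f : EuclideanSpace ℝ (Fin d) → 𝕜} (hf : MemLp f 2 (laguerreMeasure α)) (N : ℕ) :
    ∑ n ∈ cube d N, ‖laguerreCoeff α f n‖
      ≤ Real.sqrt ((N : ℝ) ^ d) * (eLpNorm f 2 (laguerreMeasure α)).toReal := by
  refine (Real.le_sqrt_of_sq_le (y := (N : ℝ) ^ d *
    (eLpNorm f 2 (laguerreMeasure α)).toReal ^ 2) ?_).trans (le_of_eq ?_)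
  · have := sq_sum_le_card_mul_sum_sq (s := cube d N) (f := fun n => ‖laguerreCoeff α f n‖)
    refine this.trans ?_
    rw [card_cube]
    push_cast
    exact mul_le_mul_of_nonneg_left (sum_norm_laguerreCoeff_sq_le hα hf _) (by positivity)
  · rw [Real.sqrt_mul (by positivity), Real.sqrt_sq ENNReal.toReal_nonneg]

end Coefficients

end

/-! ### Hardy's inequality for atoms. -/

section

variable {d : ℕ}

/-- Each term is controlled by the increment of the bounded function `x/(1+x)` from `x` to `qx`, and
these telescope. The bound does not depend on `z`, which later carries the radius of the atom. -/
lemma sum_min_geometric_le {z q : ℝ} (hz : 0 < z) (hq : 1 < q) (J : ℕ) :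
    ∑ j ∈ Finset.range J, min (z * q ^ j) (z * q ^ j)⁻¹ ≤ 4 * q / (q - 1) := by
  set g : ℝ → ℝ := fun x => x / (1 + x) with hg
  have step : ∀ x : ℝ, 0 < x → min x x⁻¹ ≤ 4 * q / (q - 1) * (g (x * q) - g x) := by
    intro x hx
    have hq1 : 0 < q - 1 := by linarith
    have e : 4 * q / (q - 1) * (g (x * q) - g x) = 4 * q * x / ((1 + x * q) * (1 + x)) := by
      have : 0 < q := by linarith
      simp only [hg]
      field_simp
      ring
    rw [e, le_div_iff₀ (by positivity)]
    rcases le_total x 1 with h | h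
    · refine (mul_le_mul_of_nonneg_right (min_le_left _ _) (by positivity)).trans ?_
      have : (1 + x * q) * (1 + x) ≤ (2 * q) * 2 :=
        mul_le_mul (by nlinarith) (by linarith) (by positivity) (by linarith)
      nlinarith
    · refine (mul_le_mul_of_nonneg_right (min_le_right _ _) (by positivity)).trans ?_
      rw [inv_mul_le_iff₀ hx]
      have : (1 + x * q) * (1 + x) ≤ (2 * (x * q)) * (2 * x) :=
        mul_le_mul (by nlinarith) (by linarith) (by positivity) (by positivity)
      nlinarith
  have hq0 : 0 < q := by linarith
  calc ∑ j ∈ Finset.range J, min (z * q ^ j) (z * q ^ j)⁻¹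
      ≤ ∑ j ∈ Finset.range J, 4 * q / (q - 1) * (g (z * q ^ (j + 1)) - g (z * q ^ j)) := by
        refine Finset.sum_le_sum fun j _ => ?_
        have := step (z * q ^ j) (by positivity)
        rwa [mul_assoc z, ← pow_succ] at this
    _ = 4 * q / (q - 1) * (g (z * q ^ J) - g (z * q ^ 0)) := by
        rw [← Finset.mul_sum, Finset.sum_range_sub (fun j => g (z * q ^ j))]
    _ ≤ 4 * q / (q - 1) * 1 := by
        have h1 : g (z * q ^ J) ≤ 1 := by
          simp only [hg]; rw [div_le_one (by positivity)]; linarith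
        have h2 : 0 ≤ g (z * q ^ 0) := by simp only [hg]; positivity
        have hq1 : 0 < q - 1 := by linarith
        refine mul_le_mul_of_nonneg_left (by linarith) (by positivity)
    _ = _ := mul_one _

variable {𝕜 : Type*} [RCLike 𝕜]

lemma half_le_homDim {α : Fin d → ℝ} (hα : ∀ i, -1 / 2 ≤ α i) :
    (d : ℝ) / 2 ≤ (d : ℝ) + ∑ i, α i := by
  have h : ∑ _i : Fin d, (-1 / 2 : ℝ) ≤ ∑ i, α i := Finset.sum_le_sum fun i _ => hα i
  simp at h
  linarith

/-- The integrability properties of an atom. -/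
lemma IsAtom.bounds {α : Fin d → ℝ} (hα : ∀ i, -1 / 2 ≤ α i)
    {c : ℝ} (hc : 0 < c)
    (hball : ∀ x₀ ∈ orthant d, ∀ ρ : ℝ, 0 < ρ →
      ENNReal.ofReal (c * (ρ ^ 2) ^ ((d : ℝ) + ∑ i, α i)) ≤
        laguerreMeasure α (Metric.ball x₀ ρ))
    {a : EuclideanSpace ℝ (Fin d) → 𝕜} (ha : IsAtom α a) :
    ∃ x₀ ∈ orthant d, ∃ ρ : ℝ, 0 < ρ ∧ (∀ x ∈ orthant d, x ∉ Metric.ball x₀ ρ → a x = 0) ∧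
      Integrable a (laguerreMeasure α) ∧ ∫ x, a x ∂(laguerreMeasure α) = 0 ∧
      ∫ x, ‖a x‖ ∂(laguerreMeasure α) ≤ 1 ∧ MemLp a 2 (laguerreMeasure α) ∧
      (eLpNorm a 2 (laguerreMeasure α)).toReal ≤
        (c * (ρ ^ 2) ^ ((d : ℝ) + ∑ i, α i)) ^ (-(1 / 2) : ℝ) := by
  obtain ⟨x₀, hx₀, ρ, hρ, hsupp, hint, hnorm⟩ := ha.exists_ball
  set μ := laguerreMeasure α with hμ
  set B := Metric.ball x₀ ρ with hB
  have hBm : MeasurableSet B := Metric.isOpen_ball.measurableSet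
  have hlow := hball x₀ hx₀ ρ hρ
  have hm0 : 0 < c * (ρ ^ 2) ^ ((d : ℝ) + ∑ i, α i) := by positivity
  have hB0 : μ B ≠ 0 := ((ENNReal.ofReal_pos.2 hm0).trans_le hlow).ne'
  have hBt : μ B ≠ ⊤ := (measure_ball_lt_top hα x₀ ρ).ne
  have hpt : (μ B) ^ (-(1 / 2) : ℝ) ≠ ⊤ := ENNReal.rpow_ne_top_of_ne_zero hB0 hBt
  have hmem : MemLp a 2 μ := ⟨ha.aestronglyMeasurable, hnorm.trans_lt hpt.lt_top⟩
  have hind : a =ᵐ[μ] B.indicator a := by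
    filter_upwards [ae_mem_orthant α] with x hx
    by_cases hxB : x ∈ B
    · rw [Set.indicator_of_mem hxB]
    · rw [Set.indicator_of_notMem hxB, hsupp x hx hxB]
  have h1 : eLpNorm a 1 μ ≤ 1 := by
    rw [eLpNorm_congr_ae hind, eLpNorm_indicator_eq_eLpNorm_restrict hBm]
    have := eLpNorm_le_eLpNorm_mul_rpow_measure_univ (μ := μ.restrict B) (p := 1) (q := 2)
      one_le_two ha.aestronglyMeasurable.restrict
    refine this.trans ?_
    rw [Measure.restrict_apply_univ]
    calc eLpNorm a 2 (μ.restrict B) * μ B ^ (1 / (1 : ℝ≥0∞).toReal - 1 / (2 : ℝ≥0∞).toReal)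
        ≤ (μ B) ^ (-(1 / 2) : ℝ) * (μ B) ^ (1 / 2 : ℝ) := by
          refine mul_le_mul' ((eLpNorm_mono_measure a Measure.restrict_le_self).trans hnorm)
            (le_of_eq ?_)
          congr 1
          norm_num
      _ = 1 := by rw [← ENNReal.rpow_add _ _ hB0 hBt]; norm_num
  have hI : Integrable a μ :=
    memLp_one_iff_integrable.1 ⟨ha.aestronglyMeasurable, h1.trans_lt ENNReal.one_lt_top⟩
  refine ⟨x₀, hx₀, ρ, hρ, hsupp, hI, ?_, ?_, hmem, ?_⟩
  · rw [integral_congr_ae hind, integral_indicator hBm]; exact hint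
  · rw [eLpNorm_one_eq_lintegral_enorm] at h1
    rw [integral_norm_eq_lintegral_enorm hI.1]
    exact ENNReal.toReal_le_of_le_ofReal zero_le_one (by simpa using h1)
  · refine ENNReal.toReal_le_of_le_ofReal (by positivity) (hnorm.trans ?_)
    rw [← ENNReal.ofReal_rpow_of_pos hm0]
    rw [ENNReal.rpow_neg, ENNReal.rpow_neg]
    exact ENNReal.inv_le_inv.2 (ENNReal.rpow_le_rpow hlow (by norm_num))

/-- The cancellation estimate: the mean zero allows `ℓ_n(x₀)` to be subtracted, the sum over `n` is
taken under the integral, and Cauchy–Schwarz in `n` brings in the square sum of differences. -/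
lemma sum_norm_laguerreCoeff_le_of_integral_eq_zero {α : Fin d → ℝ} (hα : ∀ i, -1 / 2 ≤ α i)
    {C : ℝ} (hC : 0 < C)
    (hdiff : ∀ N : ℕ, 0 < N → ∀ x ∈ orthant d, ∀ y ∈ orthant d,
      ∑ n ∈ cube d N, (laguerreFun α n x - laguerreFun α n y) ^ 2
        ≤ C * (N : ℝ) ^ ((d : ℝ) + ∑ i, α i) * Real.sqrt (Real.sqrt N * dist x y))
    {a : EuclideanSpace ℝ (Fin d) → 𝕜} {x₀ : EuclideanSpace ℝ (Fin d)} (hx₀ : x₀ ∈ orthant d)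
    {ρ : ℝ} (hsupp : ∀ x ∈ orthant d, x ∉ Metric.ball x₀ ρ → a x = 0)
    (hI : Integrable a (laguerreMeasure α)) (h0 : ∫ x, a x ∂(laguerreMeasure α) = 0)
    (h1 : ∫ x, ‖a x‖ ∂(laguerreMeasure α) ≤ 1) {N : ℕ} (hN : 0 < N) :
    ∑ n ∈ cube d N, ‖laguerreCoeff α a n‖ ≤ Real.sqrt ((N : ℝ) ^ d *
      (C * (N : ℝ) ^ ((d : ℝ) + ∑ i, α i) * Real.sqrt (Real.sqrt N * ρ))) := by
  set K := Real.sqrt ((N : ℝ) ^ d *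
      (C * (N : ℝ) ^ ((d : ℝ) + ∑ i, α i) * Real.sqrt (Real.sqrt N * ρ))) with hK
  have hint : ∀ n, Integrable (fun x => a x * ((laguerreFun α n x - laguerreFun α n x₀ : ℝ) : 𝕜))
      (laguerreMeasure α) := fun n => by
    have := (integrable_mul_laguerreFun hα n hI).sub (hI.mul_const (laguerreFun α n x₀ : 𝕜))
    refine this.congr (Eventually.of_forall fun x => ?_)
    simp only [Pi.sub_apply]
    push_cast
    ring
  have hcoef : ∀ n, laguerreCoeff α a n
      = ∫ x, a x * ((laguerreFun α n x - laguerreFun α n x₀ : ℝ) : 𝕜) ∂(laguerreMeasure α) := by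
    intro n
    have e : ∀ x, a x * ((laguerreFun α n x - laguerreFun α n x₀ : ℝ) : 𝕜)
        = a x * (laguerreFun α n x : 𝕜) - a x * (laguerreFun α n x₀ : 𝕜) := fun x => by
      push_cast; ring
    simp_rw [e]
    rw [integral_sub (integrable_mul_laguerreFun hα n hI) (hI.mul_const _), integral_mul_const, h0]
    simp [laguerreCoeff]
  calc ∑ n ∈ cube d N, ‖laguerreCoeff α a n‖
      ≤ ∑ n ∈ cube d N, ∫ x, ‖a x * ((laguerreFun α n x - laguerreFun α n x₀ : ℝ) : 𝕜)‖
          ∂(laguerreMeasure α) := by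
        refine Finset.sum_le_sum fun n _ => ?_
        rw [hcoef]
        exact norm_integral_le_integral_norm _
    _ = ∫ x, ∑ n ∈ cube d N, ‖a x * ((laguerreFun α n x - laguerreFun α n x₀ : ℝ) : 𝕜)‖
          ∂(laguerreMeasure α) := (integral_finsetSum _ fun n _ => (hint n).norm).symm
    _ ≤ ∫ x, ‖a x‖ * K ∂(laguerreMeasure α) := by
        refine integral_mono_ae (integrable_finsetSum _ fun n _ => (hint n).norm)
          (hI.norm.mul_const K) ?_
        filter_upwards [ae_mem_orthant α] with x hx
        simp_rw [norm_mul, RCLike.norm_ofReal]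
        rw [← Finset.mul_sum]
        by_cases hxB : x ∈ Metric.ball x₀ ρ
        · refine mul_le_mul_of_nonneg_left ?_ (norm_nonneg _)
          refine Real.le_sqrt_of_sq_le ?_
          refine sq_sum_le_card_mul_sum_sq.trans ?_
          rw [card_cube]
          push_cast
          simp_rw [sq_abs]
          refine mul_le_mul_of_nonneg_left ((hdiff N hN x hx x₀ hx₀).trans ?_) (by positivity)
          have := (Metric.mem_ball.1 hxB).le
          gcongr
        · simp [hsupp x hx hxB]
    _ = (∫ x, ‖a x‖ ∂(laguerreMeasure α)) * K := integral_mul_const _ _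
    _ ≤ 1 * K := mul_le_mul_of_nonneg_right h1 (Real.sqrt_nonneg _)
    _ = K := one_mul _

/-- The coefficients of an atom at frequency scale `N`. -/
lemma exists_atom_cube_bound (𝕜 : Type*) [RCLike 𝕜] (hd : 1 ≤ d) {α : Fin d → ℝ}
    (hα : ∀ i, -1 / 2 ≤ α i) :
    ∃ K : ℝ, 0 < K ∧ ∀ a : EuclideanSpace ℝ (Fin d) → 𝕜, IsAtom α a → ∃ ρ : ℝ, 0 < ρ ∧
      ∀ N : ℕ, 0 < N → ∑ n ∈ cube d N, ‖laguerreCoeff α a n‖ ≤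
        K * (N : ℝ) ^ ((d : ℝ) + (∑ i, α i) / 2) *
          min ((N * ρ ^ 2) ^ (1 / 8 : ℝ)) ((N * ρ ^ 2) ^ (1 / 8 : ℝ))⁻¹ := by
  obtain ⟨c, hc, hball⟩ := exists_measure_ball_ge hd hα
  obtain ⟨C, hC, hdiff⟩ := exists_sum_cube_sub_bound hα
  refine ⟨Real.sqrt C + c ^ (-(1 / 2) : ℝ), by positivity, fun a ha => ?_⟩
  obtain ⟨x₀, hx₀, ρ, hρ, hsupp, hI, h0, h1, h2, h3⟩ := ha.bounds hα hc hball
  refine ⟨ρ, hρ, fun N hN => ?_⟩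
  have hN0 : (0 : ℝ) < N := by exact_mod_cast hN
  set Q := (d : ℝ) + ∑ i, α i with hQ
  set E := (d : ℝ) + (∑ i, α i) / 2 with hE
  have hdE : (N : ℝ) ^ ((d : ℝ) / 2) * (N : ℝ) ^ (Q / 2) = (N : ℝ) ^ E := by
    rw [← Real.rpow_add hN0]; congr 1; rw [hQ, hE]; ring
  have hNd : Real.sqrt ((N : ℝ) ^ d) = (N : ℝ) ^ ((d : ℝ) / 2) := by
    rw [Real.sqrt_eq_rpow, ← Real.rpow_natCast, ← Real.rpow_mul hN0.le]
    congr 1; ring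
  have hNQ : Real.sqrt ((N : ℝ) ^ Q) = (N : ℝ) ^ (Q / 2) := by
    rw [Real.sqrt_eq_rpow, ← Real.rpow_mul hN0.le]
    congr 1; ring
  set y := N * ρ ^ 2 with hy
  have hy0 : 0 < y := by positivity
  have hcK : 0 < c ^ (-(1 / 2) : ℝ) := by positivity
  have hCK : 0 < Real.sqrt C := Real.sqrt_pos.2 hC
  rcases le_total y 1 with hy1 | hy1
  -- Small radius, cancellation. The exponent `1/8` comes from three square roots of `y`: two in the
  -- difference bound in several variables once `√N ρ = √y` is substituted, plus the one hidden in
  -- `√y`.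
  · have hmin : min (y ^ (1 / 8 : ℝ)) (y ^ (1 / 8 : ℝ))⁻¹ = y ^ (1 / 8 : ℝ) := by
      refine min_eq_left ?_
      have h8 : y ^ (1 / 8 : ℝ) ≤ 1 := Real.rpow_le_one hy0.le hy1 (by norm_num)
      exact h8.trans ((one_le_inv₀ (by positivity)).2 h8)
    rw [hmin]
    refine (sum_norm_laguerreCoeff_le_of_integral_eq_zero hα hC hdiff hx₀ hsupp hI h0 h1
      hN).trans ?_
    have hyy : Real.sqrt N * ρ = Real.sqrt y := by
      rw [hy, Real.sqrt_mul hN0.le, Real.sqrt_sq hρ.le]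
    have h8 : Real.sqrt (Real.sqrt (Real.sqrt y)) = y ^ (1 / 8 : ℝ) := by
      simp_rw [Real.sqrt_eq_rpow, ← Real.rpow_mul hy0.le]
      norm_num
    rw [hyy, Real.sqrt_mul (by positivity), Real.sqrt_mul (by positivity),
      Real.sqrt_mul hC.le, hNd, hNQ, h8, ← hdE]
    have hP : 0 ≤ (N : ℝ) ^ ((d : ℝ) / 2) * (N : ℝ) ^ (Q / 2) * y ^ (1 / 8 : ℝ) := by positivity
    nlinarith
  · have hmin : min (y ^ (1 / 8 : ℝ)) (y ^ (1 / 8 : ℝ))⁻¹ = (y ^ (1 / 8 : ℝ))⁻¹ := by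
      refine min_eq_right ?_
      have h8 : 1 ≤ y ^ (1 / 8 : ℝ) := Real.one_le_rpow hy1 (by norm_num)
      exact (inv_le_one_of_one_le₀ h8).trans h8
    rw [hmin]
    refine (sum_norm_laguerreCoeff_le hα h2 N).trans ?_
    -- Large radius: size gives `y^{-Q/2}`, which is better than the required `y^{-1/8}`.
    have hQ4 : (1 : ℝ) / 4 ≤ Q / 2 := by
      have := half_le_homDim hα
      have hd1 : (1 : ℝ) ≤ d := by exact_mod_cast hd
      linarith
    have e1 : (c * (ρ ^ 2) ^ Q) ^ (-(1 / 2) : ℝ)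
        = c ^ (-(1 / 2) : ℝ) * ((N : ℝ) ^ (Q / 2) * y ^ (-(Q / 2))) := by
      rw [Real.mul_rpow hc.le (by positivity), ← Real.rpow_mul (by positivity), hy,
        Real.mul_rpow hN0.le (by positivity), ← mul_assoc ((N : ℝ) ^ (Q / 2)),
        ← Real.rpow_add hN0]
      simp only [add_neg_cancel, Real.rpow_zero, one_mul]
      congr 2; ring
    have e2 : y ^ (-(Q / 2)) ≤ (y ^ (1 / 8 : ℝ))⁻¹ := by
      rw [← Real.rpow_neg hy0.le]
      exact Real.rpow_le_rpow_of_exponent_le hy1 (by linarith)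
    calc Real.sqrt ((N : ℝ) ^ d) * (eLpNorm a 2 (laguerreMeasure α)).toReal
        ≤ (N : ℝ) ^ ((d : ℝ) / 2) *
          (c ^ (-(1 / 2) : ℝ) * ((N : ℝ) ^ (Q / 2) * (y ^ (1 / 8 : ℝ))⁻¹)) := by
          rw [hNd]
          refine mul_le_mul_of_nonneg_left (h3.trans ?_) (by positivity)
          rw [e1]
          gcongr
      _ = c ^ (-(1 / 2) : ℝ) * (N : ℝ) ^ E * (y ^ (1 / 8 : ℝ))⁻¹ := by rw [← hdE]; ring
      _ ≤ _ := by
          gcongr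
          linarith

/-- Hardy's inequality for atoms. -/
lemma exists_atom_bound (𝕜 : Type*) [RCLike 𝕜] (hd : 1 ≤ d) {α : Fin d → ℝ}
    (hα : ∀ i, -1 / 2 ≤ α i) :
    ∃ C : ℝ, 0 < C ∧ ∀ a : EuclideanSpace ℝ (Fin d) → 𝕜, IsAtom α a →
      ∀ F : Finset (Fin d → ℕ), ∑ n ∈ F, ‖laguerreCoeff α a n‖ /
        ((∑ i, n i : ℕ) + 1 : ℝ) ^ ((d : ℝ) + (∑ i, α i) / 2) ≤ C := by
  obtain ⟨K, hK, h⟩ := exists_atom_cube_bound 𝕜 hd hα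
  set E := (d : ℝ) + (∑ i, α i) / 2 with hE
  have hE0 : 0 ≤ E := by
    have := half_le_homDim hα
    have hd1 : (1 : ℝ) ≤ d := by exact_mod_cast hd
    rw [hE]; linarith
  set q : ℝ := 2 ^ (1 / 8 : ℝ) with hq
  have hq1 : 1 < q := Real.one_lt_rpow one_lt_two (by norm_num)
  have hq1' : 0 < q - 1 := by linarith
  refine ⟨2 ^ E * K * (4 * q / (q - 1)), by positivity, fun a ha F => ?_⟩
  obtain ⟨ρ, hρ, hN⟩ := h a ha
  -- The shell `2^j ≤ |n| + 1 < 2^{j+1}` lies in the cube of side `2^{j+1}`, so the cube bound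
  -- applies with `Nρ² = 2^j · 2ρ²`; hence the choice of `z` and `q`.
  set lev : (Fin d → ℕ) → ℕ := fun n => Nat.log 2 (∑ i, n i + 1) with hlev
  obtain ⟨J, hJ⟩ : ∃ J, ∀ n ∈ F, lev n ∈ Finset.range J :=
    ⟨F.sup lev + 1, fun n hn => Finset.mem_range.2 (Nat.lt_succ_of_le (Finset.le_sup hn))⟩
  rw [← Finset.sum_fiberwise_of_maps_to hJ]
  set z : ℝ := (2 * ρ ^ 2) ^ (1 / 8 : ℝ) with hz
  have hz0 : 0 < z := by positivity
  calc ∑ j ∈ Finset.range J, ∑ n ∈ F with lev n = j, ‖laguerreCoeff α a n‖ /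
        ((∑ i, n i : ℕ) + 1 : ℝ) ^ E
      ≤ ∑ j ∈ Finset.range J, 2 ^ E * K * min (z * q ^ j) (z * q ^ j)⁻¹ := by
        refine Finset.sum_le_sum fun j _ => ?_
        have hj0 : (0 : ℝ) < 2 ^ j := by positivity
        calc ∑ n ∈ F with lev n = j, ‖laguerreCoeff α a n‖ / ((∑ i, n i : ℕ) + 1 : ℝ) ^ E
            ≤ ∑ n ∈ F with lev n = j, ‖laguerreCoeff α a n‖ / ((2 : ℝ) ^ j) ^ E := by
              refine Finset.sum_le_sum fun n hn => ?_
              have hn' : Nat.log 2 (∑ i, n i + 1) = j := (Finset.mem_filter.1 hn).2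
              have h1 : (2 ^ j : ℕ) ≤ ∑ i, n i + 1 := by
                rw [← hn']; exact Nat.pow_log_le_self 2 (by omega)
              have h2 : (2 : ℝ) ^ j ≤ (∑ i, n i : ℕ) + 1 := by exact_mod_cast h1
              gcongr
          _ ≤ ∑ n ∈ cube d (2 ^ (j + 1)), ‖laguerreCoeff α a n‖ / ((2 : ℝ) ^ j) ^ E := by
              refine Finset.sum_le_sum_of_subset_of_nonneg (fun n hn => ?_)
                fun n _ _ => by positivity
              have hn' : Nat.log 2 (∑ i, n i + 1) = j := (Finset.mem_filter.1 hn).2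
              have h1 : ∑ i, n i + 1 < 2 ^ (j + 1) := by
                rw [← hn']; exact Nat.lt_pow_succ_log_self one_lt_two _
              rw [cube, Fintype.mem_piFinset]
              intro i
              rw [Finset.mem_range]
              have := Finset.single_le_sum (f := n) (fun _ _ => Nat.zero_le _) (Finset.mem_univ i)
              omega
          _ ≤ (K * ((2 ^ (j + 1) : ℕ) : ℝ) ^ E * min ((((2 ^ (j + 1) : ℕ) : ℝ) * ρ ^ 2) ^ (1 / 8 : ℝ))
                ((((2 ^ (j + 1) : ℕ) : ℝ) * ρ ^ 2) ^ (1 / 8 : ℝ))⁻¹) / ((2 : ℝ) ^ j) ^ E := by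
              rw [← Finset.sum_div]
              exact div_le_div_of_nonneg_right (hN _ (by positivity)) (by positivity)
          _ = _ := by
              have e1 : ((2 ^ (j + 1) : ℕ) : ℝ) = 2 * 2 ^ j := by push_cast; ring
              have e2 : ((((2 ^ (j + 1) : ℕ) : ℝ) * ρ ^ 2) ^ (1 / 8 : ℝ)) = z * q ^ j := by
                rw [e1, hz, hq, Real.rpow_pow_comm (by norm_num), ← Real.mul_rpow (by positivity) (by positivity)]
                congr 1; ring
              rw [e2, e1, Real.mul_rpow (by norm_num) hj0.le]
              have : ((2 : ℝ) ^ j) ^ E ≠ 0 := by positivity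
              field_simp
    _ = 2 ^ E * K * ∑ j ∈ Finset.range J, min (z * q ^ j) (z * q ^ j)⁻¹ := by
        rw [Finset.mul_sum]
    _ ≤ _ := mul_le_mul_of_nonneg_left (sum_min_geometric_le hz0 hq1 J) (by positivity)

end

/-! ### From atoms to `H¹`. -/

section

variable {d : ℕ} {𝕜 : Type*} [RCLike 𝕜]

lemma IsAtom.integrable (hd : 1 ≤ d) {α : Fin d → ℝ} (hα : ∀ i, -1 / 2 ≤ α i)
    {a : EuclideanSpace ℝ (Fin d) → 𝕜} (ha : IsAtom α a) : Integrable a (laguerreMeasure α) := by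
  obtain ⟨c, hc, hball⟩ := exists_measure_ball_ge hd hα
  obtain ⟨_, _, _, _, _, hI, _⟩ := ha.bounds hα hc hball
  exact hI

lemma exists_norm_laguerreCoeff_le (𝕜 : Type*) [RCLike 𝕜] {α : Fin d → ℝ}
    (hα : ∀ i, -1 / 2 ≤ α i) (n : Fin d → ℕ) :
    ∃ C : ℝ, 0 ≤ C ∧ ∀ f : EuclideanSpace ℝ (Fin d) → 𝕜, Integrable f (laguerreMeasure α) →
      ‖laguerreCoeff α f n‖ ≤ C * (eLpNorm f 1 (laguerreMeasure α)).toReal := by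
  obtain ⟨C, hC0, hC⟩ := exists_abs_laguerreFun_le hα n
  refine ⟨C, hC0, fun f hf => ?_⟩
  rw [eLpNorm_one_eq_lintegral_enorm, ← integral_norm_eq_lintegral_enorm hf.1,
    ← integral_const_mul]
  refine norm_integral_le_of_norm_le (hf.norm.const_mul C) ?_
  filter_upwards [ae_mem_orthant α] with x hx
  rw [norm_mul, RCLike.norm_ofReal, mul_comm]
  exact mul_le_mul_of_nonneg_right (hC x hx) (norm_nonneg _)

lemma laguerreCoeff_sub_sum {α : Fin d → ℝ} (hα : ∀ i, -1 / 2 ≤ α i)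
    {f : EuclideanSpace ℝ (Fin d) → 𝕜} (hf : Integrable f (laguerreMeasure α))
    {a : ℕ → EuclideanSpace ℝ (Fin d) → 𝕜} (ha : ∀ j, Integrable (a j) (laguerreMeasure α))
    (c : ℕ → 𝕜) (m : ℕ) (n : Fin d → ℕ) :
    laguerreCoeff α (fun x => f x - ∑ j ∈ Finset.range m, c j * a j x) n
      = laguerreCoeff α f n - ∑ j ∈ Finset.range m, c j * laguerreCoeff α (a j) n := by
  have hi : ∀ j, Integrable (fun x => c j * (a j x * (laguerreFun α n x : 𝕜)))
      (laguerreMeasure α) := fun j => (integrable_mul_laguerreFun hα n (ha j)).const_mul _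
  unfold laguerreCoeff
  simp_rw [sub_mul, Finset.sum_mul, mul_assoc]
  rw [integral_sub (integrable_mul_laguerreFun hα n hf) (integrable_finsetSum _ fun j _ => hi j),
    integral_finsetSum _ fun j _ => hi j]
  simp_rw [integral_const_mul]

lemma tendsto_laguerreCoeff_sum {α : Fin d → ℝ} (hα : ∀ i, -1 / 2 ≤ α i)
    {f : EuclideanSpace ℝ (Fin d) → 𝕜} (hf : Integrable f (laguerreMeasure α))
    {a : ℕ → EuclideanSpace ℝ (Fin d) → 𝕜} (ha : ∀ j, Integrable (a j) (laguerreMeasure α))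
    {c : ℕ → 𝕜} (h : Tendsto (fun m : ℕ => eLpNorm
      (fun x => f x - ∑ j ∈ Finset.range m, c j * a j x) 1 (laguerreMeasure α)) atTop (𝓝 0))
    (n : Fin d → ℕ) :
    Tendsto (fun m => ∑ j ∈ Finset.range m, c j * laguerreCoeff α (a j) n) atTop
      (𝓝 (laguerreCoeff α f n)) := by
  obtain ⟨C, -, hC⟩ := exists_norm_laguerreCoeff_le 𝕜 hα n
  rw [tendsto_iff_norm_sub_tendsto_zero]
  have h0 : Tendsto (fun m : ℕ => C * (eLpNorm
      (fun x => f x - ∑ j ∈ Finset.range m, c j * a j x) 1 (laguerreMeasure α)).toReal)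
      atTop (𝓝 0) := by
    have := ((ENNReal.tendsto_toReal ENNReal.zero_ne_top).comp h).const_mul C
    simpa using this
  refine squeeze_zero (fun m => norm_nonneg _) (fun m => ?_) h0
  rw [norm_sub_rev, ← laguerreCoeff_sub_sum hα hf ha]
  exact hC _ (hf.sub (integrable_finsetSum _ fun j _ => (ha j).const_mul _))

/-- Hardy's inequality on finite sets of indices. -/
lemma exists_hardy_bound (𝕜 : Type*) [RCLike 𝕜] (hd : 1 ≤ d) {α : Fin d → ℝ}
    (hα : ∀ i, -1 / 2 ≤ α i) :
    ∃ C : ℝ, 0 < C ∧ ∀ f : EuclideanSpace ℝ (Fin d) → 𝕜, MemH1 α f →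
      ∀ F : Finset (Fin d → ℕ), ∑ n ∈ F, ‖laguerreCoeff α f n‖ /
        ((∑ i, n i : ℕ) + 1 : ℝ) ^ ((d : ℝ) + (∑ i, α i) / 2) ≤ C * normH1 α f := by
  obtain ⟨C, hC, h⟩ := exists_atom_bound 𝕜 hd hα
  refine ⟨C, hC, fun f hf F => ?_⟩
  obtain ⟨hfi, hdec⟩ := hf
  rw [mul_comm, ← div_le_iff₀ hC]
  refine le_csInf ?_ ?_
  -- Some decomposition must exist: otherwise `sInf ∅ = 0` would make the norm meaningless.
  · obtain ⟨c, a, hca⟩ := hdec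
    exact ⟨_, c, a, hca, rfl⟩
  rintro _ ⟨c, a, hca, rfl⟩
  rw [div_le_iff₀ hC]
  have hlim : Tendsto (fun m => ∑ n ∈ F, ‖∑ j ∈ Finset.range m, c j * laguerreCoeff α (a j) n‖ /
        ((∑ i, n i : ℕ) + 1 : ℝ) ^ ((d : ℝ) + (∑ i, α i) / 2)) atTop
      (𝓝 (∑ n ∈ F, ‖laguerreCoeff α f n‖ /
        ((∑ i, n i : ℕ) + 1 : ℝ) ^ ((d : ℝ) + (∑ i, α i) / 2))) :=
    tendsto_finsetSum _ fun n _ => (tendsto_laguerreCoeff_sum hα hfi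
      (fun j => (hca.isAtom j).integrable hd hα) hca.tendsto n).norm.div_const _
  refine le_of_tendsto' hlim fun m => ?_
  calc ∑ n ∈ F, ‖∑ j ∈ Finset.range m, c j * laguerreCoeff α (a j) n‖ /
        ((∑ i, n i : ℕ) + 1 : ℝ) ^ ((d : ℝ) + (∑ i, α i) / 2)
      ≤ ∑ n ∈ F, ∑ j ∈ Finset.range m, ‖c j‖ * (‖laguerreCoeff α (a j) n‖ /
        ((∑ i, n i : ℕ) + 1 : ℝ) ^ ((d : ℝ) + (∑ i, α i) / 2)) := by
        refine Finset.sum_le_sum fun n _ => ?_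
        simp_rw [← mul_div_assoc, ← norm_mul]
        rw [← Finset.sum_div]
        exact div_le_div_of_nonneg_right (norm_sum_le _ _) (by positivity)
    _ = ∑ j ∈ Finset.range m, ‖c j‖ * ∑ n ∈ F, ‖laguerreCoeff α (a j) n‖ /
        ((∑ i, n i : ℕ) + 1 : ℝ) ^ ((d : ℝ) + (∑ i, α i) / 2) := by
        rw [Finset.sum_comm]
        simp_rw [Finset.mul_sum]
    _ ≤ ∑ j ∈ Finset.range m, ‖c j‖ * C :=
        Finset.sum_le_sum fun j _ => mul_le_mul_of_nonneg_left (h _ (hca.isAtom j) F)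
          (norm_nonneg _)
    _ = (∑ j ∈ Finset.range m, ‖c j‖) * C := by rw [Finset.sum_mul]
    _ ≤ (∑' j, ‖c j‖) * C := mul_le_mul_of_nonneg_right
        (hca.summable.sum_le_tsum _ fun j _ => norm_nonneg _) hC.le

end

/-! ### Lower bounds for Laguerre functions near the origin. -/

lemma pow_mul_Gamma_le {x : ℝ} (hx : 0 < x) (m : ℕ) :
    x ^ m * Real.Gamma x ≤ Real.Gamma (x + m) := by
  induction m with
  | zero => simp
  | succ m ih =>
    rw [Nat.cast_succ, ← add_assoc, Real.Gamma_add_one (by positivity), pow_succ']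
    have hm : (0 : ℝ) ≤ m := m.cast_nonneg
    have := Real.Gamma_pos_of_pos hx
    calc x * x ^ m * Real.Gamma x = x * (x ^ m * Real.Gamma x) := by ring
      _ ≤ (x + m) * Real.Gamma (x + m) := mul_le_mul (by linarith) ih (by positivity)
          (by positivity)

/-- A lower bound for a Gamma ratio, from the upper one: shift `k + a + 1` up by `m - a ≥ 0` to
reach `k + 1 + m` for an integer `m ≥ a`, and compare with the elementary integer shift. -/
lemma exists_rpow_mul_Gamma_le {a : ℝ} (ha : -1 / 2 ≤ a) : ∃ C : ℝ, 0 < C ∧ ∀ k : ℕ,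
    ((k : ℝ) + 1) ^ a * Real.Gamma (k + 1) ≤ C * Real.Gamma (k + a + 1) := by
  obtain ⟨m, hm⟩ := exists_nat_ge a
  obtain ⟨C, hC, h⟩ := Gamma_add_le (b := m - a) (by linarith)
  refine ⟨C * (1 + |a|) ^ (m - a), by positivity, fun k => ?_⟩
  have hk : (0 : ℝ) ≤ k := k.cast_nonneg
  have hk1 : (0 : ℝ) < k + 1 := by linarith
  have h1 := h (k + a + 1) (by linarith)
  rw [show (k : ℝ) + a + 1 + (m - a) = k + 1 + m by ring] at h1
  have h2 := pow_mul_Gamma_le hk1 m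
  have hG : 0 < Real.Gamma (k + a + 1) := Real.Gamma_pos_of_pos (by linarith)
  have h3 : ((k : ℝ) + a + 1) ^ (m - a) ≤ (1 + |a|) ^ (m - a) * ((k : ℝ) + 1) ^ (m - a) := by
    rw [← Real.mul_rpow (by positivity) hk1.le]
    refine Real.rpow_le_rpow (by linarith) ?_ (by linarith)
    nlinarith [le_abs_self a, abs_nonneg a]
  have h4 : ((k : ℝ) + 1) ^ m = ((k : ℝ) + 1) ^ a * ((k : ℝ) + 1) ^ (m - a) := by
    rw [← Real.rpow_add hk1, add_sub_cancel, Real.rpow_natCast]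
  rw [h4] at h2
  have hp : 0 < ((k : ℝ) + 1) ^ (m - a) := by positivity
  refine le_of_mul_le_mul_right (a := ((k : ℝ) + 1) ^ (m - a)) ?_ hp
  calc ((k : ℝ) + 1) ^ a * Real.Gamma (k + 1) * ((k : ℝ) + 1) ^ (m - a)
      = ((k : ℝ) + 1) ^ a * ((k : ℝ) + 1) ^ (m - a) * Real.Gamma (k + 1) := by ring
    _ ≤ C * ((k : ℝ) + a + 1) ^ (m - a) * Real.Gamma (k + a + 1) := h2.trans h1
    _ ≤ C * ((1 + |a|) ^ (m - a) * ((k : ℝ) + 1) ^ (m - a)) * Real.Gamma (k + a + 1) := by gcongr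
    _ = _ := by ring

/-- Γ need not increase on the first unit step; there the factor gained is `a + 1 ≥ 1/2`, and all
later factors are at least `1`. -/
lemma Gamma_le_two_mul_Gamma {a : ℝ} (ha : -1 / 2 ≤ a) (j : ℕ) :
    Real.Gamma (a + 1) ≤ 2 * Real.Gamma (a + (j + 1 : ℕ) + 1) := by
  induction j with
  | zero =>
    have := Real.Gamma_pos_of_pos (s := a + 1) (by linarith)
    rw [show a + ((0 + 1 : ℕ) : ℝ) + 1 = a + 1 + 1 by push_cast; ring,
      Real.Gamma_add_one (s := a + 1) (by linarith)]
    nlinarith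
  | succ j ih =>
    have hj : (0 : ℝ) ≤ j := j.cast_nonneg
    have := Real.Gamma_pos_of_pos (s := a + (j + 1 : ℕ) + 1) (by push_cast; linarith)
    rw [show a + ((j + 1 + 1 : ℕ) : ℝ) + 1 = a + (j + 1 : ℕ) + 1 + 1 by push_cast; ring,
      Real.Gamma_add_one (s := a + (j + 1 : ℕ) + 1) (by push_cast; linarith)]
    refine ih.trans ?_
    have : (1 : ℝ) ≤ a + (j + 1 : ℕ) + 1 := by push_cast; linarith
    nlinarith

/-- Compared with the constant coefficient, the factorials cost at most `k^{j+1}` and the Gamma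
values a factor `2`. So for `k u²` small the constant term dominates. -/
lemma abs_polyCoeff_succ_le {a : ℝ} (ha : -1 / 2 ≤ a) {k j : ℕ} (hj : j < k) :
    |polyCoeff a k (j + 1)| ≤ 2 * (k : ℝ) ^ (j + 1) * polyCoeff a k 0 := by
  have hk : (0 : ℝ) ≤ k := k.cast_nonneg
  have g0 : 0 < Real.Gamma (k + a + 1) := Real.Gamma_pos_of_pos (by linarith)
  have g1 : 0 < Real.Gamma (a + 1) := Real.Gamma_pos_of_pos (by linarith)
  have g2 : 0 < Real.Gamma (a + (j + 1 : ℕ) + 1) := Real.Gamma_pos_of_pos (by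
    have : (0 : ℝ) ≤ j := j.cast_nonneg
    push_cast; linarith)
  have h1 := Gamma_le_two_mul_Gamma ha j
  have h2 : (k.factorial : ℝ) ≤ (k : ℝ) ^ (j + 1) * (k - (j + 1)).factorial := by
    have h := Nat.factorial_mul_descFactorial (n := k) (k := j + 1) hj
    have h' := Nat.descFactorial_le_pow k (j + 1)
    rw [← h, mul_comm]
    push_cast
    exact mul_le_mul_of_nonneg_right (by exact_mod_cast h') (by positivity)
  have h3 : (1 : ℝ) ≤ (j + 1).factorial := by exact_mod_cast (j + 1).factorial_pos
  rw [polyCoeff, polyCoeff, abs_div, abs_mul, abs_pow, abs_neg, abs_one, one_pow, one_mul,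
    abs_of_pos (by positivity), abs_of_pos (by positivity : (0 : ℝ) < (j + 1).factorial)]
  simp only [pow_zero, Nat.cast_zero, add_zero, Nat.sub_zero, Nat.factorial_zero, Nat.cast_one,
    div_one, one_mul]
  refine (div_le_self (by positivity) h3).trans ?_
  rw [div_le_iff₀ (by positivity)]
  have e : 2 * (k : ℝ) ^ (j + 1) * (Real.Gamma (k + a + 1) / (Real.Gamma (a + 1) * k.factorial))
      * (Real.Gamma (a + (j + 1 : ℕ) + 1) * (k - (j + 1)).factorial)
      = Real.Gamma (k + a + 1) * ((2 * Real.Gamma (a + (j + 1 : ℕ) + 1)) *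
        ((k : ℝ) ^ (j + 1) * (k - (j + 1)).factorial)) / (Real.Gamma (a + 1) * k.factorial) := by
    ring
  rw [e, le_div_iff₀ (by positivity)]
  gcongr

/-- Near the origin the Laguerre functions are comparable with their value at the origin. -/
lemma exists_laguerreFun1_ge {a : ℝ} (ha : -1 / 2 ≤ a) : ∃ c : ℝ, 0 < c ∧ ∀ (k : ℕ) (u : ℝ),
    ((k : ℝ) + 1) * u ^ 2 ≤ 1 / 32 → c * ((k : ℝ) + 1) ^ (a / 2) ≤ laguerreFun1 a k u := by
  obtain ⟨C, hC, h⟩ := exists_rpow_mul_Gamma_le ha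
  have g1 : 0 < Real.Gamma (a + 1) := Real.Gamma_pos_of_pos (by linarith)
  refine ⟨Real.sqrt (2 / (C * Real.Gamma (a + 1) ^ 2)) / 2, by positivity, fun k u hku => ?_⟩
  have hk : (0 : ℝ) ≤ k := k.cast_nonneg
  have g0 : 0 < Real.Gamma (k + a + 1) := Real.Gamma_pos_of_pos (by linarith)
  have gk : 0 < Real.Gamma (k + 1) := Real.Gamma_pos_of_pos (by linarith)
  have hu2 : u ^ 2 ≤ 1 / 32 := by nlinarith [sq_nonneg u]
  have hku' : (k : ℝ) * u ^ 2 ≤ 1 / 32 := by nlinarith [sq_nonneg u]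
  have hp0 : polyCoeff a k 0 = Real.Gamma (k + a + 1) / (Real.Gamma (a + 1) * Real.Gamma (k + 1)) := by
    simp [polyCoeff, Real.Gamma_nat_eq_factorial]
  have hp0' : 0 < polyCoeff a k 0 := by rw [hp0]; positivity
  -- Since `k u² ≤ 1/32`, the higher terms are bounded by a geometric series with sum at most an
  -- eighth of the constant term. The final factor `1/2` is below `(7/8)²`, the second `7/8` coming
  -- from the Gaussian.
  have hL : 7 / 8 * polyCoeff a k 0 ≤ laguerrePoly a k (u ^ 2) := by
    rw [laguerrePoly_eq_sum, Finset.sum_range_succ', pow_zero, mul_one]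
    have : |∑ j ∈ Finset.range k, polyCoeff a k (j + 1) * (u ^ 2) ^ (j + 1)|
        ≤ 1 / 8 * polyCoeff a k 0 := by
      calc |∑ j ∈ Finset.range k, polyCoeff a k (j + 1) * (u ^ 2) ^ (j + 1)|
          ≤ ∑ j ∈ Finset.range k, |polyCoeff a k (j + 1) * (u ^ 2) ^ (j + 1)| :=
            Finset.abs_sum_le_sum_abs _ _
        _ ≤ ∑ j ∈ Finset.range k, (1 / 16 * polyCoeff a k 0) * (1 / 2) ^ j := by
            refine Finset.sum_le_sum fun j hj => ?_
            rw [abs_mul, abs_of_nonneg (by positivity : (0 : ℝ) ≤ (u ^ 2) ^ (j + 1))]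
            have h1 := abs_polyCoeff_succ_le ha (Finset.mem_range.1 hj)
            have h2 : ((k : ℝ) * u ^ 2) ^ (j + 1) ≤ 1 / 32 * (1 / 2) ^ j := by
              rw [pow_succ, mul_comm]
              have h3 : ((k : ℝ) * u ^ 2) ^ j ≤ (1 / 2) ^ j :=
                pow_le_pow_left₀ (by positivity) (hku'.trans (by norm_num)) j
              exact mul_le_mul hku' h3 (by positivity) (by norm_num)
            calc |polyCoeff a k (j + 1)| * (u ^ 2) ^ (j + 1)
                ≤ (2 * (k : ℝ) ^ (j + 1) * polyCoeff a k 0) * (u ^ 2) ^ (j + 1) := by gcongr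
              _ = 2 * polyCoeff a k 0 * ((k : ℝ) * u ^ 2) ^ (j + 1) := by rw [mul_pow]; ring
              _ ≤ 2 * polyCoeff a k 0 * (1 / 32 * (1 / 2) ^ j) := by gcongr
              _ = _ := by ring
        _ = (1 / 16 * polyCoeff a k 0) * ∑ j ∈ Finset.range k, (1 / 2 : ℝ) ^ j := by
            rw [Finset.mul_sum]
        _ ≤ (1 / 16 * polyCoeff a k 0) * 2 :=
            mul_le_mul_of_nonneg_left (sum_geometric_two_le k) (by positivity)
        _ = _ := by ring
    linarith [(abs_le.1 this).1]
  have hE : 7 / 8 ≤ Real.exp (-u ^ 2 / 2) := by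
    have := Real.add_one_le_exp (-u ^ 2 / 2)
    linarith
  have hval : Real.sqrt (2 / (C * Real.Gamma (a + 1) ^ 2)) * ((k : ℝ) + 1) ^ (a / 2)
      ≤ Real.sqrt (2 * Real.Gamma (k + 1) / Real.Gamma (k + a + 1)) * polyCoeff a k 0 := by
    have e1 : ((k : ℝ) + 1) ^ (a / 2) = Real.sqrt (((k : ℝ) + 1) ^ a) := by
      rw [Real.sqrt_eq_rpow, ← Real.rpow_mul (by positivity)]
      congr 1; ring
    rw [e1, ← Real.sqrt_mul (by positivity), ← Real.sqrt_sq hp0'.le,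
      ← Real.sqrt_mul (by positivity)]
    refine Real.sqrt_le_sqrt ?_
    have e2 : 2 * Real.Gamma (k + 1) / Real.Gamma (k + a + 1) * polyCoeff a k 0 ^ 2
        = 2 * Real.Gamma (k + a + 1) / (Real.Gamma (a + 1) ^ 2 * Real.Gamma (k + 1)) := by
      rw [hp0]; field_simp
    rw [e2, div_mul_eq_mul_div, div_le_div_iff₀ (by positivity) (by positivity)]
    have := mul_le_mul_of_nonneg_left (h k) (by positivity : 0 ≤ 2 * Real.Gamma (a + 1) ^ 2)
    linarith
  rw [laguerreFun1]
  have hs := Real.sqrt_nonneg (2 * Real.Gamma (k + 1) / Real.Gamma (k + a + 1))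
  calc Real.sqrt (2 / (C * Real.Gamma (a + 1) ^ 2)) / 2 * ((k : ℝ) + 1) ^ (a / 2)
      ≤ (Real.sqrt (2 * Real.Gamma (k + 1) / Real.Gamma (k + a + 1)) * polyCoeff a k 0) / 2 := by
        linarith
    _ ≤ Real.sqrt (2 * Real.Gamma (k + 1) / Real.Gamma (k + a + 1)) * (7 / 8 * polyCoeff a k 0)
        * (7 / 8) := by
        have : 0 ≤ Real.sqrt (2 * Real.Gamma (k + 1) / Real.Gamma (k + a + 1)) * polyCoeff a k 0 := by
          positivity
        linarith
    _ ≤ _ := by gcongr; exact mul_nonneg hs ((by positivity : (0 : ℝ) ≤ _).trans hL)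

/-- Covers negative exponents, since `α i / 2` may be as low as `-1/4`. -/
lemma half_mul_rpow_le {b M y : ℝ} (hb : -1 ≤ b) (hM : 0 < M) (h1 : M ≤ y) (h2 : y ≤ 2 * M) :
    1 / 2 * M ^ b ≤ y ^ b := by
  have hp : 0 < M ^ b := by positivity
  rcases le_total 0 b with h | h
  · have := Real.rpow_le_rpow hM.le h1 h
    linarith
  · have h3 : (2 * M) ^ b ≤ y ^ b := Real.rpow_le_rpow_of_nonpos (by linarith) h2 h
    rw [Real.mul_rpow (by norm_num) hM.le] at h3
    have h4 : (2 : ℝ) ^ (-1 : ℝ) ≤ 2 ^ b := Real.rpow_le_rpow_of_exponent_le (by norm_num) hb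
    rw [Real.rpow_neg_one] at h4
    nlinarith

/-- Lower bound for the multi-dimensional Laguerre functions near the origin, for multi-indices
with all entries in `[M, 2M)`. -/
lemma exists_laguerreFun_ge {d : ℕ} {α : Fin d → ℝ} (hα : ∀ i, -1 / 2 ≤ α i) :
    ∃ c : ℝ, 0 < c ∧ ∀ (M : ℕ) (n : Fin d → ℕ) (x : EuclideanSpace ℝ (Fin d)), 0 < M →
      (∀ i, n i ∈ Finset.Ico M (2 * M)) → (∀ i, 2 * M * x i ^ 2 ≤ 1 / 32) →
      c * (M : ℝ) ^ ((∑ i, α i) / 2) ≤ laguerreFun α n x := by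
  choose c hc h using fun i => exists_laguerreFun1_ge (hα i)
  refine ⟨∏ i, (c i * (1 / 2)), Finset.prod_pos fun i _ => by have := hc i; positivity,
    fun M n x hM hn hx => ?_⟩
  have hM0 : (0 : ℝ) < M := by exact_mod_cast hM
  rw [Finset.sum_div, Real.rpow_sum_of_pos hM0, ← Finset.prod_mul_distrib, laguerreFun]
  refine Finset.prod_le_prod (fun i _ => by have := hc i; positivity) fun i _ => ?_
  have h1 := Finset.mem_Ico.1 (hn i)
  have h2 : (M : ℝ) ≤ (n i : ℝ) + 1 := by exact_mod_cast h1.1.trans (Nat.le_succ _)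
  have h3 : (n i : ℝ) + 1 ≤ 2 * M := by exact_mod_cast h1.2
  refine le_trans ?_ (h i (n i) (x i) (le_trans ?_ (hx i)))
  · rw [mul_assoc]
    exact mul_le_mul_of_nonneg_left
      (half_mul_rpow_le (by linarith [hα i]) hM0 h2 h3) (hc i).le
  · exact mul_le_mul_of_nonneg_right h3 (sq_nonneg _)

/-! ### Uniform boundedness on sequences of atoms. -/

section

variable {𝕜 : Type*} [RCLike 𝕜]

/-- Uniform boundedness for weighted absolute sums of coefficients along `ℓ¹`-combinations. -/
lemma exists_uniform_bound_of_summable {ι : Type*} {b : ℕ → ι → 𝕜} {w : ι → ℝ} (hw : ∀ n, 0 ≤ w n)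
    {D : ι → ℝ} (hb : ∀ j n, ‖b j n‖ ≤ D n)
    (h : ∀ c : ℕ → 𝕜, Summable (fun j => ‖c j‖) →
      Summable fun n => w n * ‖∑' j, c j * b j n‖) :
    ∃ K : ℝ, ∀ (j : ℕ) (F : Finset ι), ∑ n ∈ F, w n * ‖b j n‖ ≤ K := by
  have hsum : ∀ c : lp (fun _ : ℕ => 𝕜) 1, Summable fun j => ‖c j‖ := fun c => by
    have := lp.memℓp c
    rw [memℓp_gen_iff (by norm_num)] at this
    simpa using this
  have hnorm : ∀ c : lp (fun _ : ℕ => 𝕜) 1, ‖c‖ = ∑' j, ‖c j‖ := fun c => by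
    rw [lp.norm_eq_tsum_rpow (by norm_num)]
    simp
  have hle : ∀ (c : lp (fun _ : ℕ => 𝕜) 1) (n : ι) (j : ℕ), ‖c j * b j n‖ ≤ ‖c j‖ * D n :=
    fun c n j => by rw [norm_mul]; exact mul_le_mul_of_nonneg_left (hb j n) (norm_nonneg _)
  have hsn : ∀ (c : lp (fun _ : ℕ => 𝕜) 1) (n : ι), Summable fun j => ‖c j * b j n‖ := fun c n =>
    Summable.of_nonneg_of_le (fun _ => norm_nonneg _) (hle c n) ((hsum c).mul_right _)
  let φ : ι → lp (fun _ : ℕ => 𝕜) 1 →L[𝕜] 𝕜 := fun n => LinearMap.mkContinuous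
    { toFun := fun c => ∑' j, c j * b j n
      map_add' := fun c c' => by
        rw [← (hsn c n).of_norm.tsum_add (hsn c' n).of_norm]
        exact tsum_congr fun j => by simp [add_mul]
      map_smul' := fun r c => by
        simp only [RingHom.id_apply, smul_eq_mul]
        rw [← tsum_mul_left]
        exact tsum_congr fun j => by simp [mul_assoc] }
    (D n) (fun c => by
      simp only [LinearMap.coe_mk, AddHom.coe_mk]
      refine (norm_tsum_le_tsum_norm (hsn c n)).trans ?_
      refine ((hsn c n).tsum_le_tsum (hle c n) ((hsum c).mul_right _)).trans ?_
      rw [tsum_mul_right, hnorm, mul_comm])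
  have hφ : ∀ n c, φ n c = ∑' j, c j * b j n := fun n c => rfl
  -- A sum of absolute values is not linear in `c`; indexing by finite sets and by multipliers `θ`
  -- bounded by `1` replaces it by a family of bounded linear functionals with the same supremum.
  let g : Finset ι × {θ : ι → 𝕜 // ∀ n, ‖θ n‖ ≤ 1} → lp (fun _ : ℕ => 𝕜) 1 →L[𝕜] 𝕜 :=
    fun p => ∑ n ∈ p.1, ((w n : 𝕜) * p.2.1 n) • φ n
  have hg : ∀ p c, g p c = ∑ n ∈ p.1, (w n : 𝕜) * p.2.1 n * φ n c := fun p c => by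
    simp [g]
  obtain ⟨K, hK⟩ := banach_steinhaus (g := g) fun c => by
    refine ⟨∑' n, w n * ‖∑' j, c j * b j n‖, fun p => ?_⟩
    rw [hg]
    refine (norm_sum_le _ _).trans (le_trans (Finset.sum_le_sum fun n _ => ?_)
      ((h c (hsum c)).sum_le_tsum p.1 fun n _ => mul_nonneg (hw n) (norm_nonneg _)))
    rw [norm_mul, norm_mul, RCLike.norm_of_nonneg (hw n), hφ]
    exact mul_le_mul_of_nonneg_right (mul_le_of_le_one_right (hw n) (p.2.2 n)) (norm_nonneg _)
  refine ⟨K, fun j F => ?_⟩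
  -- The phase that makes every term nonnegative at the `j`-th basis vector; where `b j n = 0` it is
  -- `0 / 0 = 0`, which is harmless.
  set θ : ι → 𝕜 := fun n => (starRingEnd 𝕜) (b j n) / (‖b j n‖ : 𝕜) with hθ
  have hθ1 : ∀ n, ‖θ n‖ ≤ 1 := fun n => by
    rw [hθ]
    simp only [norm_div, RCLike.norm_conj, RCLike.norm_ofReal, abs_norm]
    exact div_self_le_one _
  have h1 := (g (F, ⟨θ, hθ1⟩)).le_of_opNorm_le (hK _) (lp.single 1 j (1 : 𝕜))
  rw [lp.norm_single (by norm_num), norm_one, mul_one, hg] at h1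
  have e : ∀ n, (w n : 𝕜) * θ n * φ n (lp.single 1 j (1 : 𝕜)) = ((w n * ‖b j n‖ : ℝ) : 𝕜) := by
    intro n
    have : φ n (lp.single 1 j (1 : 𝕜)) = b j n := by
      rw [hφ, tsum_eq_single j]
      · simp
      · intro i hi
        simp [lp.single_apply, Pi.single_eq_of_ne hi]
    rw [this, hθ, mul_assoc, div_mul_eq_mul_div, RCLike.conj_mul]
    push_cast
    congr 1
    rcases eq_or_ne (‖b j n‖ : 𝕜) 0 with h0 | h0
    · simp [h0]
    · field_simp
  simp only [e] at h1
  rw [← RCLike.ofReal_sum, RCLike.norm_of_nonneg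
    (Finset.sum_nonneg fun n _ => mul_nonneg (hw n) (norm_nonneg _))] at h1
  exact h1

/-- Absolutely convergent combinations of atoms define elements of `H¹`. -/
lemma exists_memH1_of_summable {d : ℕ} (hd : 1 ≤ d) {α : Fin d → ℝ} (hα : ∀ i, -1 / 2 ≤ α i)
    {a : ℕ → EuclideanSpace ℝ (Fin d) → 𝕜} (ha : ∀ j, IsAtom α (a j)) {c : ℕ → 𝕜}
    (hc : Summable fun j => ‖c j‖) :
    ∃ f : EuclideanSpace ℝ (Fin d) → 𝕜, MemH1 α f ∧
      ∀ n, laguerreCoeff α f n = ∑' j, c j * laguerreCoeff α (a j) n := by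
  have hI : ∀ j, Integrable (a j) (laguerreMeasure α) := fun j => (ha j).integrable hd hα
  have h1 : ∀ j, (eLpNorm (a j) 1 (laguerreMeasure α)).toReal ≤ 1 := fun j => by
    obtain ⟨c, hc, hball⟩ := exists_measure_ball_ge hd hα
    obtain ⟨_, _, _, _, _, _, _, h, _⟩ := (ha j).bounds hα hc hball
    rw [eLpNorm_one_eq_lintegral_enorm, ← integral_norm_eq_lintegral_enorm (hI j).1]
    exact h
  set A : ℕ → Lp 𝕜 1 (laguerreMeasure α) := fun j => (memLp_one_iff_integrable.2 (hI j)).toLp (a j)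
  have hA : ∀ j, A j =ᵐ[laguerreMeasure α] a j := fun j => MemLp.coeFn_toLp _
  have hs : Summable fun j => c j • A j := by
    refine Summable.of_norm (Summable.of_nonneg_of_le (fun _ => norm_nonneg _) (fun j => ?_) hc)
    rw [norm_smul, Lp.norm_toLp]
    exact mul_le_of_le_one_right (norm_nonneg _) (h1 j)
  set S : Lp 𝕜 1 (laguerreMeasure α) := ∑' j, c j • A j with hS
  have hSI : Integrable S (laguerreMeasure α) := L1.integrable_coeFn S
  have hlim : Tendsto (fun m : ℕ => eLpNorm (fun x => S x - ∑ j ∈ Finset.range m, c j * a j x) 1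
      (laguerreMeasure α)) atTop (𝓝 0) := by
    have h2 := (tendsto_iff_norm_sub_tendsto_zero.1 hs.hasSum.tendsto_sum_nat)
    have h3 := ENNReal.tendsto_ofReal h2
    rw [ENNReal.ofReal_zero] at h3
    refine h3.congr fun m => ?_
    rw [← hS, norm_sub_rev, Lp.norm_def, ENNReal.ofReal_toReal (Lp.eLpNorm_ne_top _)]
    refine eLpNorm_congr_ae ?_
    have hsum : (∑ j ∈ Finset.range m, c j • A j : Lp 𝕜 1 (laguerreMeasure α))
        =ᵐ[laguerreMeasure α] fun x => ∑ j ∈ Finset.range m, c j * a j x := by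
      have h4 : ∀ j, (c j • A j : Lp 𝕜 1 (laguerreMeasure α))
          =ᵐ[laguerreMeasure α] fun x => c j * a j x := fun j => by
        filter_upwards [Lp.coeFn_smul (c j) (A j), hA j] with x hx1 hx2
        rw [hx1, Pi.smul_apply, hx2, smul_eq_mul]
      induction m with
      | zero =>
        simp only [Finset.range_zero, Finset.sum_empty]
        exact Lp.coeFn_zero _ _ _
      | succ m ih =>
        simp only [Finset.sum_range_succ]
        filter_upwards [Lp.coeFn_add (∑ j ∈ Finset.range m, c j • A j) (c m • A m), ih, h4 m]
          with x hx1 hx2 hx3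
        rw [hx1, Pi.add_apply, hx2, hx3]
    filter_upwards [Lp.coeFn_sub S (∑ j ∈ Finset.range m, c j • A j), hsum] with x hx1 hx2
    rw [hx1, Pi.sub_apply, hx2]
  refine ⟨S, ⟨hSI, c, a, ha, hc, hlim⟩, fun n => ?_⟩
  obtain ⟨D, hD0, hD⟩ := exists_norm_laguerreCoeff_le 𝕜 hα n
  have hsc : Summable fun j => c j * laguerreCoeff α (a j) n := by
    refine Summable.of_norm (Summable.of_nonneg_of_le (fun _ => norm_nonneg _) (fun j => ?_)
      (hc.mul_right D))
    rw [norm_mul]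
    refine mul_le_mul_of_nonneg_left ((hD _ (hI j)).trans ?_) (norm_nonneg _)
    exact mul_le_of_le_one_right hD0 (h1 j)
  exact tendsto_nhds_unique (tendsto_laguerreCoeff_sum hα hSI hI hlim n)
    hsc.hasSum.tendsto_sum_nat

/-- If the weighted sum is finite on all of `H¹`, it is bounded uniformly on any sequence of
atoms. -/
lemma exists_uniform_bound_of_forall_memH1 {d : ℕ} (hd : 1 ≤ d) {α : Fin d → ℝ}
    (hα : ∀ i, -1 / 2 ≤ α i) {a : ℕ → EuclideanSpace ℝ (Fin d) → 𝕜} (ha : ∀ j, IsAtom α (a j))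
    {w : (Fin d → ℕ) → ℝ} (hw : ∀ n, 0 ≤ w n)
    (h : ∀ f : EuclideanSpace ℝ (Fin d) → 𝕜, MemH1 α f →
      Summable fun n => w n * ‖laguerreCoeff α f n‖) :
    ∃ K : ℝ, ∀ (j : ℕ) (F : Finset (Fin d → ℕ)), ∑ n ∈ F, w n * ‖laguerreCoeff α (a j) n‖ ≤ K := by
  have hI : ∀ j, Integrable (a j) (laguerreMeasure α) := fun j => (ha j).integrable hd hα
  choose D hD0 hD using fun n => exists_norm_laguerreCoeff_le 𝕜 hα n
  refine exists_uniform_bound_of_summable (D := D) hw (fun j n => (hD n _ (hI j)).trans ?_)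
    fun c hc => ?_
  · obtain ⟨c, hc, hball⟩ := exists_measure_ball_ge hd hα
    obtain ⟨_, _, _, _, _, _, _, h, _⟩ := (ha j).bounds hα hc hball
    rw [eLpNorm_one_eq_lintegral_enorm, ← integral_norm_eq_lintegral_enorm (hI j).1]
    exact mul_le_of_le_one_right (hD0 n) h
  · obtain ⟨f, hf, hfc⟩ := exists_memH1_of_summable hd hα ha hc
    simpa only [hfc] using h f hf

end

/-! ### Normalized indicators of balls and the atoms built from them. -/

section

variable {d : ℕ}

/-- For a centre with coordinates at most `ρ` the density on the ball is at most `∏ (2ρ)^{2α_i+1}`.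
With the lower bound it makes balls near the origin comparable under halving. -/
lemma exists_measure_ball_le {α : Fin d → ℝ} (hα : ∀ i, -1 / 2 ≤ α i) :
    ∃ C : ℝ, 0 < C ∧ ∀ (x₀ : EuclideanSpace ℝ (Fin d)) (ρ : ℝ), 0 < ρ → (∀ i, |x₀ i| ≤ ρ) →
      laguerreMeasure α (Metric.ball x₀ ρ) ≤
        ENNReal.ofReal (C * (ρ ^ 2) ^ ((d : ℝ) + ∑ i, α i)) := by
  set V := (volume (Metric.ball (0 : EuclideanSpace ℝ (Fin d)) 1)) with hV
  have hVt : V ≠ ⊤ := MeasureTheory.measure_ball_lt_top.ne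
  have hV0 : 0 < V.toReal := ENNReal.toReal_pos (Metric.measure_ball_pos _ _ one_pos).ne' hVt
  have h2 : 0 < ∏ i, (2 : ℝ) ^ (2 * α i + 1) := Finset.prod_pos fun i _ => by positivity
  refine ⟨(∏ i, (2 : ℝ) ^ (2 * α i + 1)) * V.toReal, by positivity, fun x₀ ρ hρ hx₀ => ?_⟩
  refine (measure_ball_le hα x₀ ρ).trans ?_
  rw [Measure.addHaar_ball_of_pos _ _ hρ, ← hV, ← ENNReal.ofReal_toReal hVt,
    ← ENNReal.ofReal_mul (by positivity), ← ENNReal.ofReal_mul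
      (Finset.prod_nonneg fun i _ => by positivity)]
  refine ENNReal.ofReal_le_ofReal ?_
  have e : ∏ i, (2 * ρ) ^ (2 * α i + 1)
      = (∏ i, (2 : ℝ) ^ (2 * α i + 1)) * ∏ i, ρ ^ (2 * α i + 1) := by
    rw [← Finset.prod_mul_distrib]
    exact Finset.prod_congr rfl fun i _ => Real.mul_rpow (by norm_num) hρ.le
  have hle : ∏ i, (|x₀ i| + ρ) ^ (2 * α i + 1) ≤ ∏ i, (2 * ρ) ^ (2 * α i + 1) :=
    Finset.prod_le_prod (fun i _ => by positivity) fun i _ =>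
      Real.rpow_le_rpow (by positivity) (by linarith [hx₀ i]) (by linarith [hα i])
  refine (mul_le_mul_of_nonneg_right hle (by positivity)).trans (le_of_eq ?_)
  rw [e, ← prod_rpow_mul_prod α hρ]
  simp only [finrank_euclideanSpace, Fintype.card_fin, Finset.prod_const, Finset.card_univ]
  rw [hV, ENNReal.toReal_ofReal ENNReal.toReal_nonneg]
  ring

section Bump

variable {𝕜 : Type*} [RCLike 𝕜]

/-- The normalized indicator function of a ball. -/
noncomputable def bump (𝕜 : Type*) [RCLike 𝕜] (α : Fin d → ℝ) (x₀ : EuclideanSpace ℝ (Fin d))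
    (ρ : ℝ) : EuclideanSpace ℝ (Fin d) → 𝕜 :=
  (Metric.ball x₀ ρ).indicator fun _ => (((laguerreMeasure α).real (Metric.ball x₀ ρ))⁻¹ : 𝕜)

lemma measureReal_ball_pos (hd : 1 ≤ d) {α : Fin d → ℝ} (hα : ∀ i, -1 / 2 ≤ α i)
    {x₀ : EuclideanSpace ℝ (Fin d)} (hx₀ : x₀ ∈ orthant d) {ρ : ℝ} (hρ : 0 < ρ) :
    0 < (laguerreMeasure α).real (Metric.ball x₀ ρ) := by
  obtain ⟨c, hc, h⟩ := exists_measure_ball_ge hd hα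
  refine ENNReal.toReal_pos ((ENNReal.ofReal_pos.2 ?_).trans_le (h x₀ hx₀ ρ hρ)).ne'
    (measure_ball_lt_top hα x₀ ρ).ne
  positivity

lemma integrable_bump {α : Fin d → ℝ} (hα : ∀ i, -1 / 2 ≤ α i) (x₀ : EuclideanSpace ℝ (Fin d))
    (ρ : ℝ) : Integrable (bump 𝕜 α x₀ ρ) (laguerreMeasure α) :=
  (integrable_indicator_iff Metric.isOpen_ball.measurableSet).2
    (integrableOn_const (measure_ball_lt_top hα x₀ ρ).ne)

lemma integral_bump (hd : 1 ≤ d) {α : Fin d → ℝ} (hα : ∀ i, -1 / 2 ≤ α i)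
    {x₀ : EuclideanSpace ℝ (Fin d)} (hx₀ : x₀ ∈ orthant d) {ρ : ℝ} (hρ : 0 < ρ)
    {s : Set (EuclideanSpace ℝ (Fin d))} (hs : Metric.ball x₀ ρ ⊆ s) :
    ∫ x in s, bump 𝕜 α x₀ ρ x ∂(laguerreMeasure α) = 1 := by
  have h := (measureReal_ball_pos hd hα hx₀ hρ).ne'
  have h' : (((laguerreMeasure α).real (Metric.ball x₀ ρ) : ℝ) : 𝕜) ≠ 0 := by exact_mod_cast h
  rw [bump, setIntegral_indicator Metric.isOpen_ball.measurableSet, Set.inter_eq_right.2 hs,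
    setIntegral_const, RCLike.real_smul_eq_coe_mul, mul_inv_cancel₀ h']

lemma eLpNorm_bump (hd : 1 ≤ d) {α : Fin d → ℝ} (hα : ∀ i, -1 / 2 ≤ α i)
    {x₀ : EuclideanSpace ℝ (Fin d)} (hx₀ : x₀ ∈ orthant d) {ρ : ℝ} (hρ : 0 < ρ) :
    eLpNorm (bump 𝕜 α x₀ ρ) 2 (laguerreMeasure α) =
      ENNReal.ofReal ((laguerreMeasure α).real (Metric.ball x₀ ρ) ^ (-(1 / 2) : ℝ)) := by
  have h := measureReal_ball_pos hd hα hx₀ hρ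
  rw [bump, eLpNorm_indicator_const Metric.isOpen_ball.measurableSet (by norm_num) (by norm_num),
    ← ofReal_measureReal (measure_ball_lt_top hα x₀ ρ).ne, ENNReal.ofReal_rpow_of_pos h,
    enorm_inv (by exact_mod_cast h.ne'), ← ofReal_norm, RCLike.norm_of_nonneg h.le,
    ← ENNReal.ofReal_inv_of_pos h, ← ENNReal.ofReal_mul (by positivity), ← Real.rpow_neg_one,
    ← Real.rpow_add h]
  norm_num

lemma memLp_bump (hd : 1 ≤ d) {α : Fin d → ℝ} (hα : ∀ i, -1 / 2 ≤ α i)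
    {x₀ : EuclideanSpace ℝ (Fin d)} (hx₀ : x₀ ∈ orthant d) {ρ : ℝ} (hρ : 0 < ρ) :
    MemLp (bump 𝕜 α x₀ ρ) 2 (laguerreMeasure α) :=
  ⟨(integrable_bump hα x₀ ρ).1, by rw [eLpNorm_bump hd hα hx₀ hρ]; exact ENNReal.ofReal_lt_top⟩

/-- The coefficient is the mean of `ℓ_n` over the ball. -/
lemma le_norm_laguerreCoeff_bump (hd : 1 ≤ d) {α : Fin d → ℝ} (hα : ∀ i, -1 / 2 ≤ α i)
    {x₀ : EuclideanSpace ℝ (Fin d)} (hx₀ : x₀ ∈ orthant d) {ρ : ℝ} (hρ : 0 < ρ)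
    {n : Fin d → ℕ} {t : ℝ}
    (ht : ∀ x ∈ Metric.ball x₀ ρ, x ∈ orthant d → t ≤ laguerreFun α n x) :
    t ≤ ‖laguerreCoeff α (bump 𝕜 α x₀ ρ) n‖ := by
  have h := measureReal_ball_pos hd hα hx₀ hρ
  set μ := laguerreMeasure α with hμ
  set B := Metric.ball x₀ ρ with hB
  have hBm : MeasurableSet B := Metric.isOpen_ball.measurableSet
  have hBt : μ B ≠ ⊤ := (measure_ball_lt_top hα x₀ ρ).ne
  have e : laguerreCoeff α (bump 𝕜 α x₀ ρ) n
      = (((μ.real B)⁻¹ * ∫ x in B, laguerreFun α n x ∂μ : ℝ) : 𝕜) := by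
    have h1 : ∀ x, bump 𝕜 α x₀ ρ x * (laguerreFun α n x : 𝕜)
        = B.indicator (fun x => (((μ.real B)⁻¹ * laguerreFun α n x : ℝ) : 𝕜)) x := fun x => by
      by_cases hx : x ∈ B
      · rw [bump, Set.indicator_of_mem hx, Set.indicator_of_mem hx]; push_cast; rfl
      · rw [bump, Set.indicator_of_notMem hx, Set.indicator_of_notMem hx, zero_mul]
    rw [laguerreCoeff]
    simp_rw [h1]
    rw [integral_indicator hBm, integral_ofReal, integral_const_mul]
  rw [e, RCLike.norm_ofReal]
  refine le_trans ?_ (le_abs_self _)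
  rw [le_inv_mul_iff₀ h]
  obtain ⟨C, -, hC⟩ := exists_abs_laguerreFun_le hα n
  have hi : IntegrableOn (laguerreFun α n) B μ :=
    Measure.integrableOn_of_bounded (M := C) hBt (continuous_laguerreFun α n).aestronglyMeasurable
      (ae_restrict_of_ae (by
        filter_upwards [ae_mem_orthant α] with x hx using hC x hx))
  have h2 : ∫ _ in B, t ∂μ ≤ ∫ x in B, laguerreFun α n x ∂μ := by
    refine setIntegral_mono_on_ae (integrableOn_const hBt) hi hBm ?_
    filter_upwards [ae_mem_orthant α] with x hx hxB using ht x hxB hx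
  rwa [setIntegral_const, smul_eq_mul] at h2

/-- Both bumps have integral `1`, hence the cancellation. Their `L²` norms are `μ(B)^{-1/2}`, and
the one of the smaller ball exceeds the other at most by `D^{1/2}`; the triangle inequality gives
the factor `D^{1/2} + 1`. -/
lemma isAtom_bump_sub (hd : 1 ≤ d) {α : Fin d → ℝ} (hα : ∀ i, -1 / 2 ≤ α i)
    {x₀ x₁ : EuclideanSpace ℝ (Fin d)} (hx₀ : x₀ ∈ orthant d) (hx₁ : x₁ ∈ orthant d)
    {ρ₀ ρ₁ : ℝ} (hρ₀ : 0 < ρ₀) (hρ₁ : 0 < ρ₁)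
    (hsub : Metric.ball x₁ ρ₁ ⊆ Metric.ball x₀ ρ₀) {D : ℝ} (hD : 0 < D)
    (hle : (laguerreMeasure α).real (Metric.ball x₀ ρ₀)
      ≤ D * (laguerreMeasure α).real (Metric.ball x₁ ρ₁)) :
    IsAtom α fun x => (((D ^ (1 / 2 : ℝ) + 1)⁻¹ : ℝ) : 𝕜) *
      (bump 𝕜 α x₁ ρ₁ x - bump 𝕜 α x₀ ρ₀ x) := by
  have h0 := measureReal_ball_pos hd hα hx₀ hρ₀
  have h1 := measureReal_ball_pos hd hα hx₁ hρ₁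
  have i0 := integrable_bump (𝕜 := 𝕜) hα x₀ ρ₀
  have i1 := integrable_bump (𝕜 := 𝕜) hα x₁ ρ₁
  refine ⟨((i1.sub i0).const_mul _).1, x₀, hx₀, ρ₀, hρ₀, fun x _ hx => ?_, ?_, ?_⟩
  · rw [bump, bump, Set.indicator_of_notMem hx, Set.indicator_of_notMem fun h => hx (hsub h)]
    simp
  · rw [integral_const_mul, integral_sub i1.integrableOn i0.integrableOn,
      integral_bump hd hα hx₁ hρ₁ hsub, integral_bump hd hα hx₀ hρ₀ subset_rfl]
    simp
  · have e := eLpNorm_const_smul (((D ^ (1 / 2 : ℝ) + 1)⁻¹ : ℝ) : 𝕜)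
      (fun x => bump 𝕜 α x₁ ρ₁ x - bump 𝕜 α x₀ ρ₀ x) 2 (laguerreMeasure α)
    have hs : 0 < D ^ (1 / 2 : ℝ) := by positivity
    refine e.le.trans ?_
    have hsubn : eLpNorm (fun x => bump 𝕜 α x₁ ρ₁ x - bump 𝕜 α x₀ ρ₀ x) 2 (laguerreMeasure α)
        ≤ _ := eLpNorm_sub_le i1.1 i0.1 (by norm_num)
    refine (mul_le_mul_right hsubn _).trans ?_
    rw [eLpNorm_bump hd hα hx₀ hρ₀, eLpNorm_bump hd hα hx₁ hρ₁,
      ← ofReal_measureReal (measure_ball_lt_top hα x₀ ρ₀).ne, ENNReal.ofReal_rpow_of_pos h0,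
      ← ofReal_norm, RCLike.norm_of_nonneg (by positivity),
      ← ENNReal.ofReal_add (by positivity) (by positivity), ← ENNReal.ofReal_mul (by positivity)]
    refine ENNReal.ofReal_le_ofReal ?_
    rw [inv_mul_le_iff₀ (by positivity), add_mul, one_mul]
    refine add_le_add_left ?_ _
    have h2 : (laguerreMeasure α).real (Metric.ball x₀ ρ₀) / D
        ≤ (laguerreMeasure α).real (Metric.ball x₁ ρ₁) := by
      rw [div_le_iff₀ hD, mul_comm]; exact hle
    refine (Real.rpow_le_rpow_of_nonpos (by positivity) h2 (by norm_num)).trans (le_of_eq ?_)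
    rw [Real.div_rpow h0.le hD.le, Real.rpow_neg hD.le, div_inv_eq_mul, mul_comm]

end Bump

end

/-! ### Sharpness: dyadic bumps at the origin. -/

section

variable {d : ℕ} {𝕜 : Type*} [RCLike 𝕜]

/-- The point `(r,…,r)`. -/
noncomputable def diagPoint (d : ℕ) (r : ℝ) : EuclideanSpace ℝ (Fin d) :=
  WithLp.toLp 2 fun _ => r

lemma diagPoint_mem_orthant {r : ℝ} (hr : 0 < r) : diagPoint d r ∈ orthant d := fun _ => hr

/-- The centres are at distance `√d r/2 ≤ d r/2`, which is exactly the room left by the radii. -/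
lemma ball_diagPoint_half_subset {r : ℝ} (hr : 0 < r) :
    Metric.ball (diagPoint d (r / 2)) (d * (r / 2)) ⊆ Metric.ball (diagPoint d r) (d * r) := by
  refine Metric.ball_subset_ball' ?_
  have : dist (diagPoint d (r / 2)) (diagPoint d r) ≤ d * (r / 2) := by
    rw [EuclideanSpace.dist_eq, Real.sqrt_le_left (by positivity)]
    have h : ∀ i : Fin d, dist ((diagPoint d (r / 2)) i) ((diagPoint d r) i) ^ 2 = (r / 2) ^ 2 := by
      intro i
      simp only [diagPoint, Real.dist_eq, sq_abs]
      ring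
    simp_rw [h]
    simp only [Finset.sum_const, Finset.card_univ, Fintype.card_fin, nsmul_eq_mul]
    rw [mul_pow]
    refine mul_le_mul_of_nonneg_right ?_ (sq_nonneg _)
    rcases Nat.eq_zero_or_pos d with rfl | hd
    · simp
    · have : (1 : ℝ) ≤ d := by exact_mod_cast hd
      nlinarith
  linarith

lemma abs_apply_le_of_mem_ball_diagPoint {r : ℝ} {x : EuclideanSpace ℝ (Fin d)} (hr : 0 < r)
    (hx : x ∈ Metric.ball (diagPoint d r) (d * r)) (i : Fin d) : |x i| ≤ (d + 1) * r := by
  have h1 : |x i - r| ≤ dist x (diagPoint d r) := by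
    rw [dist_eq_norm, ← Real.norm_eq_abs]
    exact PiLp.norm_apply_le (x - diagPoint d r) i
  have h2 := Metric.mem_ball.1 hx
  have h3 : |x i| ≤ |x i - r| + |r| := by
    simpa using abs_add_le (x i - r) r
  rw [abs_of_pos hr] at h3
  linarith

/-- Differences of consecutive dyadic bumps are multiples of atoms. -/
lemma exists_isAtom_bump (𝕜 : Type*) [RCLike 𝕜] (hd : 1 ≤ d) {α : Fin d → ℝ}
    (hα : ∀ i, -1 / 2 ≤ α i) :
    ∃ κ : ℝ, 0 < κ ∧ ∀ r : ℝ, 0 < r → IsAtom α fun x => (κ : 𝕜) *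
      (bump 𝕜 α (diagPoint d (r / 2)) (d * (r / 2)) x - bump 𝕜 α (diagPoint d r) (d * r) x) := by
  obtain ⟨c, hc, hlow⟩ := exists_measure_ball_ge hd hα
  obtain ⟨C, hC, hup⟩ := exists_measure_ball_le hα
  have hd1 : (1 : ℝ) ≤ d := by exact_mod_cast hd
  have hd0 : (0 : ℝ) < d := by linarith
  set Q := (d : ℝ) + ∑ i, α i with hQ
  have hD : 0 < C * 4 ^ Q / c := by positivity
  refine ⟨_, by positivity, fun r hr => isAtom_bump_sub hd hα (diagPoint_mem_orthant hr)
    (diagPoint_mem_orthant (by positivity)) (by positivity) (by positivity)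
    (ball_diagPoint_half_subset hr) hD ?_⟩
  have h1 := hlow _ (diagPoint_mem_orthant (d := d) (half_pos hr)) (d * (r / 2)) (by positivity)
  have h2 := hup (diagPoint d r) (d * r) (by positivity) fun i => by
    simp only [diagPoint, abs_of_pos hr]; nlinarith
  have h1' : c * ((d * (r / 2)) ^ 2) ^ Q
      ≤ (laguerreMeasure α).real (Metric.ball (diagPoint d (r / 2)) (d * (r / 2))) :=
    (ENNReal.ofReal_le_iff_le_toReal (measure_ball_lt_top hα _ _).ne).1 h1
  have h2' : (laguerreMeasure α).real (Metric.ball (diagPoint d r) (d * r))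
      ≤ C * ((d * r) ^ 2) ^ Q := ENNReal.toReal_le_of_le_ofReal (by positivity) h2
  have e : ((d * r) ^ 2) ^ Q = 4 ^ Q * ((d * (r / 2)) ^ 2) ^ Q := by
    rw [← Real.mul_rpow (by norm_num) (by positivity)]
    congr 1; ring
  rw [e] at h2'
  refine h2'.trans ?_
  calc C * (4 ^ Q * ((d * (r / 2)) ^ 2) ^ Q)
      = C * 4 ^ Q / c * (c * ((d * (r / 2)) ^ 2) ^ Q) := by field_simp
    _ ≤ _ := mul_le_mul_of_nonneg_left h1' hD.le

/-- The dyadic box `[M, 2M)^d` of multi-indices. -/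
def dyadicBox (d M : ℕ) : Finset (Fin d → ℕ) := Fintype.piFinset fun _ => Finset.Ico M (2 * M)

lemma card_dyadicBox (d M : ℕ) : (dyadicBox d M).card = M ^ d := by
  simp [dyadicBox, two_mul]

lemma dyadicBox_subset_cube (d M : ℕ) : dyadicBox d M ⊆ cube d (2 * M) := fun n hn => by
  rw [dyadicBox, Fintype.mem_piFinset] at hn
  rw [cube, Fintype.mem_piFinset]
  exact fun i => Finset.mem_range.2 (Finset.mem_Ico.1 (hn i)).2

lemma sum_add_one_le_of_mem_dyadicBox (hd : 1 ≤ d) {M : ℕ} {n : Fin d → ℕ}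
    (hn : n ∈ dyadicBox d M) : ∑ i, n i + 1 ≤ 2 * d * M := by
  rw [dyadicBox, Fintype.mem_piFinset] at hn
  have h : ∑ i, (n i + 1) ≤ ∑ _i : Fin d, 2 * M :=
    Finset.sum_le_sum fun i _ => (Finset.mem_Ico.1 (hn i)).2
  simp [Finset.sum_add_distrib] at h
  nlinarith

lemma le_sum_of_mem_dyadicBox (hd : 1 ≤ d) {M : ℕ} {n : Fin d → ℕ}
    (hn : n ∈ dyadicBox d M) : M ≤ ∑ i, n i + 1 := by
  rw [dyadicBox, Fintype.mem_piFinset] at hn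
  have h1 := (Finset.mem_Ico.1 (hn ⟨0, hd⟩)).1
  have h2 := Finset.single_le_sum (f := n) (fun _ _ => Nat.zero_le _) (Finset.mem_univ ⟨0, hd⟩)
  omega

lemma laguerreCoeff_const_mul_sub {α : Fin d → ℝ} (hα : ∀ i, -1 / 2 ≤ α i)
    {f g : EuclideanSpace ℝ (Fin d) → 𝕜} (hf : Integrable f (laguerreMeasure α))
    (hg : Integrable g (laguerreMeasure α)) (κ : 𝕜) (n : Fin d → ℕ) :
    laguerreCoeff α (fun x => κ * (f x - g x)) n
      = κ * (laguerreCoeff α f n - laguerreCoeff α g n) := by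
  unfold laguerreCoeff
  simp_rw [mul_assoc, sub_mul]
  rw [integral_const_mul, integral_sub (integrable_mul_laguerreFun hα n hf)
    (integrable_mul_laguerreFun hα n hg)]

/-- Sharpness of the exponent, for small `ε`. -/
lemma exists_memH1_not_summable (𝕜 : Type*) [RCLike 𝕜] (hd : 1 ≤ d) {α : Fin d → ℝ}
    (hα : ∀ i, -1 / 2 ≤ α i) {ε : ℝ} (hε : 0 < ε) (hε' : ε ≤ 1 / 8) :
    ∃ f : EuclideanSpace ℝ (Fin d) → 𝕜, MemH1 α f ∧
      ¬ Summable (fun n : Fin d → ℕ => ‖laguerreCoeff α f n‖ /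
        ((∑ i, n i : ℕ) + 1 : ℝ) ^ ((d : ℝ) + (∑ i, α i) / 2 - ε)) := by
  by_contra! hcon
  have hd1 : (1 : ℝ) ≤ d := by exact_mod_cast hd
  have hd0 : (0 : ℝ) < d := by linarith
  set E := (d : ℝ) + (∑ i, α i) / 2 - ε with hE
  -- The restriction `ε ≤ 1/8` enters here: it keeps the weights strong enough for the coefficients
  -- of the fixed first bump to stay bounded on every dyadic box.
  have hEd : (d : ℝ) / 2 ≤ E := by
    have := half_le_homDim hα
    rw [hE]; linarith
  obtain ⟨κ, hκ, hatom⟩ := exists_isAtom_bump 𝕜 hd hα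
  obtain ⟨c, hc, hlow⟩ := exists_laguerreFun_ge hα
  -- On the `m`-th ball `|x i| ≤ (d + 1) r_m = 2^{-m}/8`, hence `2 · 4^m · x_i² ≤ 1/32`, the range
  -- in which the lower bound for `ℓ_n` holds with `M = 4^m`.
  set η : ℝ := 1 / (8 * (d + 1)) with hη
  have hη0 : 0 < η := by positivity
  set r : ℕ → ℝ := fun m => η / 2 ^ m with hr
  have hr0 : ∀ m, 0 < r m := fun m => by positivity
  have hr1 : ∀ m, r (m + 1) = r m / 2 := fun m => by simp only [hr, pow_succ]; field_simp
  set g : ℕ → EuclideanSpace ℝ (Fin d) → 𝕜 := fun m => bump 𝕜 α (diagPoint d (r m)) (d * r m)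
    with hg
  have hgi : ∀ m, Integrable (g m) (laguerreMeasure α) := fun m => integrable_bump hα _ _
  set w : (Fin d → ℕ) → ℝ := fun n => (((∑ i, n i : ℕ) + 1 : ℝ) ^ E)⁻¹ with hw
  have hw0 : ∀ n, 0 ≤ w n := fun n => by positivity
  have ha : ∀ m, IsAtom α fun x => (κ : 𝕜) * (g (m + 1) x - g m x) := fun m => by
    have := hatom (r m) (hr0 m)
    rw [← hr1] at this
    exact this
  obtain ⟨K, hK⟩ := exists_uniform_bound_of_forall_memH1 hd hα ha hw0 fun f hf => by
    refine (hcon f hf).congr fun n => ?_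
    rw [hw, div_eq_inv_mul]
  -- the growth of the sums for the bumps is at most linear
  have hstep : ∀ (m : ℕ) (F : Finset (Fin d → ℕ)), ∑ n ∈ F, w n * ‖laguerreCoeff α (g m) n‖
      ≤ ∑ n ∈ F, w n * ‖laguerreCoeff α (g 0) n‖ + m * (κ⁻¹ * K) := by
    intro m F
    induction m with
    | zero => simp
    | succ m ih =>
      have h1 : ∀ n, ‖laguerreCoeff α (g (m + 1)) n‖ ≤ ‖laguerreCoeff α (g m) n‖ + κ⁻¹ *
          ‖laguerreCoeff α (fun x => (κ : 𝕜) * (g (m + 1) x - g m x)) n‖ := fun n => by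
        rw [laguerreCoeff_const_mul_sub hα (hgi _) (hgi _), norm_mul, RCLike.norm_of_nonneg hκ.le,
          inv_mul_cancel_left₀ hκ.ne']
        linarith [norm_sub_norm_le (laguerreCoeff α (g (m + 1)) n) (laguerreCoeff α (g m) n)]
      calc ∑ n ∈ F, w n * ‖laguerreCoeff α (g (m + 1)) n‖
          ≤ ∑ n ∈ F, (w n * ‖laguerreCoeff α (g m) n‖ + κ⁻¹ * (w n *
            ‖laguerreCoeff α (fun x => (κ : 𝕜) * (g (m + 1) x - g m x)) n‖)) := by
            refine Finset.sum_le_sum fun n _ => ?_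
            refine (mul_le_mul_of_nonneg_left (h1 n) (hw0 n)).trans (le_of_eq (by ring))
        _ ≤ _ := by
            rw [Finset.sum_add_distrib, ← Finset.mul_sum]
            have := mul_le_mul_of_nonneg_left (hK m F) (inv_pos.2 hκ).le
            push_cast
            linarith
  -- the sum for the first bump stays bounded on dyadic boxes
  set C₀ := Real.sqrt ((2 : ℝ) ^ d) * (eLpNorm (g 0) 2 (laguerreMeasure α)).toReal with hC₀
  have hfirst : ∀ M : ℕ, 0 < M → ∑ n ∈ dyadicBox d M, w n * ‖laguerreCoeff α (g 0) n‖ ≤ C₀ := by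
    intro M hM
    have hM0 : (0 : ℝ) < M := by exact_mod_cast hM
    have hM1 : (1 : ℝ) ≤ M := by exact_mod_cast hM
    calc ∑ n ∈ dyadicBox d M, w n * ‖laguerreCoeff α (g 0) n‖
        ≤ ∑ n ∈ dyadicBox d M, ((M : ℝ) ^ ((d : ℝ) / 2))⁻¹ * ‖laguerreCoeff α (g 0) n‖ := by
          refine Finset.sum_le_sum fun n hn => mul_le_mul_of_nonneg_right ?_ (norm_nonneg _)
          refine inv_anti₀ (by positivity) ?_
          have h1 : (M : ℝ) ≤ (∑ i, n i : ℕ) + 1 := by exact_mod_cast le_sum_of_mem_dyadicBox hd hn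
          exact (Real.rpow_le_rpow_of_exponent_le hM1 hEd).trans
            (Real.rpow_le_rpow hM0.le h1 (by linarith))
      _ ≤ ((M : ℝ) ^ ((d : ℝ) / 2))⁻¹ * ∑ n ∈ cube d (2 * M), ‖laguerreCoeff α (g 0) n‖ := by
          rw [← Finset.mul_sum]
          refine mul_le_mul_of_nonneg_left (Finset.sum_le_sum_of_subset_of_nonneg
            (dyadicBox_subset_cube d M) fun _ _ _ => norm_nonneg _) (by positivity)
      _ ≤ ((M : ℝ) ^ ((d : ℝ) / 2))⁻¹ * (Real.sqrt (((2 * M : ℕ) : ℝ) ^ d) *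
            (eLpNorm (g 0) 2 (laguerreMeasure α)).toReal) := by
          refine mul_le_mul_of_nonneg_left (sum_norm_laguerreCoeff_le hα
            (memLp_bump hd hα (diagPoint_mem_orthant (hr0 0)) (mul_pos hd0 (hr0 0))) _)
            (by positivity)
      _ = C₀ := by
          have e : Real.sqrt (((2 * M : ℕ) : ℝ) ^ d) = Real.sqrt ((2 : ℝ) ^ d) *
              (M : ℝ) ^ ((d : ℝ) / 2) := by
            push_cast
            rw [mul_pow, Real.sqrt_mul (by positivity)]
            congr 1
            rw [Real.sqrt_eq_rpow, ← Real.rpow_natCast, ← Real.rpow_mul hM0.le]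
            congr 1; ring
          rw [e, hC₀]
          have : (M : ℝ) ^ ((d : ℝ) / 2) ≠ 0 := by positivity
          field_simp
  -- the sum for the `m`-th bump on the box at scale `4 ^ m` is large
  set c₁ := c * ((2 * d : ℝ) ^ E)⁻¹ with hc₁
  have hc₁0 : 0 < c₁ := by positivity
  have hlarge : ∀ m : ℕ, c₁ * ((4 : ℝ) ^ ε) ^ m ≤
      ∑ n ∈ dyadicBox d (4 ^ m), w n * ‖laguerreCoeff α (g m) n‖ := by
    intro m
    have hM : 0 < 4 ^ m := by positivity
    have hM0 : (0 : ℝ) < (4 ^ m : ℕ) := by exact_mod_cast hM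
    set M : ℕ := 4 ^ m with hMd
    have hterm : ∀ n ∈ dyadicBox d M, ((2 * d * M : ℝ) ^ E)⁻¹ *
        (c * (M : ℝ) ^ ((∑ i, α i) / 2)) ≤ w n * ‖laguerreCoeff α (g m) n‖ := by
      intro n hn
      have h1 : ((∑ i, n i : ℕ) + 1 : ℝ) ≤ 2 * d * M := by
        exact_mod_cast sum_add_one_le_of_mem_dyadicBox hd hn
      refine mul_le_mul ?_ ?_ (by positivity) (hw0 n)
      · exact inv_anti₀ (by positivity) (Real.rpow_le_rpow (by positivity) h1 (by linarith))
      · refine le_norm_laguerreCoeff_bump hd hα (diagPoint_mem_orthant (hr0 m))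
          (mul_pos hd0 (hr0 m)) fun x hx _ => hlow M n x hM ?_ fun i => ?_
        · rw [dyadicBox, Fintype.mem_piFinset] at hn
          exact hn
        · have h2 := abs_apply_le_of_mem_ball_diagPoint (hr0 m) hx i
          have h3 : x i ^ 2 ≤ ((d + 1) * r m) ^ 2 := by
            rw [← sq_abs (x i)]
            exact pow_le_pow_left₀ (abs_nonneg _) h2 2
          have h4 : ((d + 1) * r m) ^ 2 = 1 / (64 * M) := by
            have : (M : ℝ) = (2 ^ m) ^ 2 := by
              rw [hMd]; push_cast; rw [← pow_mul, mul_comm, pow_mul]; norm_num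
            rw [this]
            simp only [hr, hη]
            field_simp
            norm_num
          rw [h4] at h3
          calc 2 * M * x i ^ 2 ≤ 2 * M * (1 / (64 * M)) := by gcongr
            _ = 1 / 32 := by field_simp; norm_num
    calc c₁ * ((4 : ℝ) ^ ε) ^ m
        = ∑ _n ∈ dyadicBox d M, ((2 * d * M : ℝ) ^ E)⁻¹ * (c * (M : ℝ) ^ ((∑ i, α i) / 2)) := by
          rw [Finset.sum_const, card_dyadicBox, nsmul_eq_mul, hc₁,
            Real.mul_rpow (by positivity) hM0.le]
          have e1 : ((4 : ℝ) ^ ε) ^ m = (M : ℝ) ^ ε := by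
            rw [Real.rpow_pow_comm (by norm_num), hMd]; push_cast; rfl
          have e2 : (M : ℝ) ^ d * (M : ℝ) ^ ((∑ i, α i) / 2) = (M : ℝ) ^ ε * (M : ℝ) ^ E := by
            rw [← Real.rpow_natCast, ← Real.rpow_add hM0, ← Real.rpow_add hM0]
            congr 1; rw [hE]; ring
          have e3 : (M : ℝ) ^ E ≠ 0 := by positivity
          have e4 : (2 * d : ℝ) ^ E ≠ 0 := by positivity
          rw [e1]
          push_cast
          field_simp
          linear_combination (-1 : ℝ) * e2
      _ ≤ _ := Finset.sum_le_sum hterm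
  -- Exponential growth against linear growth: after division by `4^{εm}` the right side tends to
  -- `0`, while `c₁ > 0`.
  have hall : ∀ m : ℕ, c₁ ≤ C₀ * (((4 : ℝ) ^ ε)⁻¹) ^ m
      + (κ⁻¹ * K) * (m * (((4 : ℝ) ^ ε)⁻¹) ^ m) := by
    intro m
    have h1 := (hlarge m).trans ((hstep m _).trans (add_le_add_left (hfirst (4 ^ m) (by positivity)) _))
    have hp : 0 < ((4 : ℝ) ^ ε) ^ m := by positivity
    rw [← le_div_iff₀ hp] at h1
    rw [inv_pow]
    refine h1.trans (le_of_eq ?_)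
    field_simp
  have hq0 : 0 ≤ ((4 : ℝ) ^ ε)⁻¹ := by positivity
  have hq1 : ((4 : ℝ) ^ ε)⁻¹ < 1 := inv_lt_one_of_one_lt₀ (Real.one_lt_rpow (by norm_num) hε)
  have hlim : Tendsto (fun m : ℕ => C₀ * (((4 : ℝ) ^ ε)⁻¹) ^ m
      + (κ⁻¹ * K) * (m * (((4 : ℝ) ^ ε)⁻¹) ^ m)) atTop (𝓝 (C₀ * 0 + (κ⁻¹ * K) * 0)) :=
    ((tendsto_pow_atTop_nhds_zero_of_lt_one hq0 hq1).const_mul _).add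
      ((tendsto_self_mul_const_pow_of_lt_one hq0 hq1).const_mul _)
  have := ge_of_tendsto' hlim hall
  linarith

end

end LaguerreHardy

theorem mainTheorem1 {𝕜 : Type*} [RCLike 𝕜] (d : ℕ) (hd : 1 ≤ d) (α : Fin d → ℝ)
    (hα : ∀ i, -1 / 2 ≤ α i) :
    (∃ C : ℝ, ∀ f : EuclideanSpace ℝ (Fin d) → 𝕜, LaguerreHardy.MemH1 α f →
      (∀ n : Fin d → ℕ, Integrable (fun x => f x * (LaguerreHardy.laguerreFun α n x : 𝕜))
        (LaguerreHardy.laguerreMeasure α)) ∧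
      Summable (fun n : Fin d → ℕ => ‖LaguerreHardy.laguerreCoeff α f n‖ /
        ((∑ i, n i : ℕ) + 1 : ℝ) ^ ((d : ℝ) + (∑ i, α i) / 2)) ∧
      ∑' n : Fin d → ℕ, ‖LaguerreHardy.laguerreCoeff α f n‖ /
        ((∑ i, n i : ℕ) + 1 : ℝ) ^ ((d : ℝ) + (∑ i, α i) / 2) ≤ C * LaguerreHardy.normH1 α f) ∧
    (∀ ε : ℝ, 0 < ε → ∃ f : EuclideanSpace ℝ (Fin d) → 𝕜, LaguerreHardy.MemH1 α f ∧
      ¬ Summable (fun n : Fin d → ℕ => ‖LaguerreHardy.laguerreCoeff α f n‖ /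
        ((∑ i, n i : ℕ) + 1 : ℝ) ^ ((d : ℝ) + (∑ i, α i) / 2 - ε))) := by
  refine ⟨?_, fun ε hε => ?_⟩
  · obtain ⟨C, -, hC⟩ := LaguerreHardy.exists_hardy_bound 𝕜 hd hα
    refine ⟨C, fun f hf => ?_⟩
    have hs := summable_of_sum_le (fun n => by positivity) (hC f hf)
    exact ⟨fun n => LaguerreHardy.integrable_mul_laguerreFun hα n hf.1, hs,
      hs.tsum_le_of_sum_le (hC f hf)⟩
  -- It suffices to treat `min ε (1/8)`: the base `|n| + 1` is at least `1`, so a larger `ε` only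
  -- enlarges the terms.
  · obtain ⟨f, hf, hns⟩ := LaguerreHardy.exists_memH1_not_summable 𝕜 hd hα
      (lt_min hε (by norm_num : (0 : ℝ) < 1 / 8)) (min_le_right _ _)
    refine ⟨f, hf, fun hs => hns (Summable.of_nonneg_of_le (fun n => by positivity) (fun n => ?_) hs)⟩
    refine div_le_div_of_nonneg_left (norm_nonneg _) (by positivity)
      (Real.rpow_le_rpow_of_exponent_le ?_ (by linarith [min_le_left ε (1 / 8)]))
    have : (0 : ℝ) ≤ (∑ i, n i : ℕ) := Nat.cast_nonneg _
    linarith
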